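/- **Setting.** Let $\mathcal A$ be a unital involutive algebra over $\mathbb k=\mathbb R$ or $\mathbb C$. A *real spectral triple* $(\mathcal A,\mathcal H,D;J)$ consists of a complex Hilbert space $\mathcal H$, a unital $\mathbb k$-linear $*$-representation of $\mathcal A$ by bounded operators on $\mathcal H$, a self-adjoint operator $D$ with compact resolvent such that every $a\in\mathcal A$ preserves $\mathrm{Dom}(D)$ and $[D,a]$ is bounded, and an antiunitary operator $J$ preserving $\mathrm{Dom}(D)$ with $J^2=\varepsilon$, $JD=\varepsilon' DJ$ for signs $\varepsilon,\varepsilon'\in\{\pm1\}$, and $[a,JbJ^{-1}]=0$ for all $a,b\in\mathcal A$. The first-order condition $[[D,a],JbJ^{-1}]=0$ is not required. $\mathcal H$ and $\mathrm{Dom}(D)$ are $\mathcal A$-bimodules with right action $\xi b=Jb^*J^{-1}\xi$. Let $\Omega^1(\mathcal A)=\ker(\mathcal A\otimes_{\mathbb k}\mathcal A\to\mathcal A)$ be the bimodule of universal one-forms, with $\delta(a)=1\otimes a-a\otimes 1$ and the involution $(x\otimes y)^*=y^*\otimes x^*$, so that $\delta(a)^*=-\delta(a^*)$. Let $\mathcal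 E$ be a finitely generated projective right $\mathcal A$-module and let $\nabla:\mathcal E\to\mathcal E\otimes_{\mathcal A}\Omega^1(\mathcal A)$ be a universal connection, i.e. an additive map with $\nabla(va)=\nabla(v)a+v\otimes\delta(a)$. Let $\overline{\mathcal E}$ be the conjugate left module, $a\,\overline v=\overline{va^*}$, with the left connection $\overline\nabla(\overline v)=-\sum_i\omega_i^*\otimes\overline{w_i}$ when $\nabla v=\sum_i w_i\otimes\omega_i$. For an operator $T$, one-forms $a\,\delta(b)$ are represented on the left by $a[T,b]$ and on the right by $\xi\mapsto [T,b^\circ](\xi a)$, where $b^\circ$ is right multiplication by $b$; write $\nabla_T(v)\xi$ and $\xi\,\overline\nabla_T(\overline v)$ for the resulting vectors. Put $$(1\otimes_\nabla T)(v\otimes\xi)=\nabla_T(v)\xi+v\otimes T\xi,\qquad (T\otimes_{\overline\nabla}1)(\xi\otimes\overline v)=T\xi\otimes\overline v+\xi\,\overline\nabla_T(\overline v).$$ **Proposition.** (1) As maps $\mathcal E\otimes_{\mathcal A}\mathrm{Dom}(D)\otimes_{\mathcal A}\overline{\mathcal E}\to\mathcal E\otimes_{\mathcal A}\mathcal H\otimes_{\mathcal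 A}\overline{\mathcal E}$ (with the canonical associativity identifications), $$(1\otimes_\nabla D)\otimes_{\overline\nabla}1=1\otimes_\nabla(D\otimes_{\overline\nabla}1).$$ (2) Suppose moreover that $\mathcal E$ carries a hermitian structure, i.e. an $\mathcal A$-valued sesquilinear form with $(v|wa)=(v|w)a$, $(v|w)^*=(w|v)$, $(v|v)$ a positive operator on $\mathcal H$, and $v\mapsto(v|\cdot)$ a bijection of $\mathcal E$ onto $\mathrm{Hom}_{\mathcal A}(\mathcal E,\mathcal A)$, and that $\nabla$ is hermitian: $$(v|\nabla w)-(\nabla v|w)=\delta\big((v|w)\big),\qquad (v|w\otimes\omega)=(v|w)\,\omega,\quad (v\otimes\omega|w)=\omega^*(v|w).$$ Then $\mathcal E\otimes_{\mathcal A}\mathcal H\otimes_{\mathcal A}\overline{\mathcal E}$ is a Hilbert space for the inner product $$\langle v_1\otimes\xi\otimes\overline{v_2},\,w_1\otimes\eta\otimes\overline{w_2}\rangle=\langle\xi,\,(v_1|w_1)\,\eta\,(w_2|v_2)\rangle .$$ Let $\mathrm{End}_{\mathcal A}(\mathcal E)$ have the involution $(T^*v|w)=(v|Tw)$ and act by $T(v_1\otimes\xi\otimes\overline{v_2})=Tv_1\otimes\xi\otimes\overline{v_2}$;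 let $D'=(1\otimes_\nabla D)\otimes_{\overline\nabla}1$, with domain the image of $\mathcal E\otimes_{\mathcal A}\mathrm{Dom}(D)\otimes_{\mathcal A}\overline{\mathcal E}$, and $J'(v_1\otimes\xi\otimes\overline{v_2})=v_2\otimes J\xi\otimes\overline{v_1}$. Then $(\mathrm{End}_{\mathcal A}(\mathcal E),\ \mathcal E\otimes_{\mathcal A}\mathcal H\otimes_{\mathcal A}\overline{\mathcal E},\ D';J')$ is a well-defined real spectral triple, with the same signs $\varepsilon,\varepsilon'$. -/

import Mathlib

open scoped TensorProduct MulOpposite InnerProductSpace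

noncomputable section

/-! ## Tensor products over a noncommutative ring

Right `A`-modules are modules over `Aᵐᵒᵖ`: `v · a` is `MulOpposite.op a • v`. -/

section Balanced

universe u₁ u₂ u₃ u₄ u₅ u₆

/-- The subgroup of relations `(m · a) ⊗ n = m ⊗ (a • n)` in `M ⊗[ℤ] N`. -/
def balancedRel (A : Type u₁) (M : Type u₂) (N : Type u₃) [Ring A] [AddCommGroup M]
    [AddCommGroup N] [Module Aᵐᵒᵖ M] [Module A N] : AddSubgroup (M ⊗[ℤ] N) :=
  AddSubgroup.closure {t | ∃ (m : M) (a : A) (n : N),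
    t = (MulOpposite.op a • m) ⊗ₜ[ℤ] n - m ⊗ₜ[ℤ] (a • n)}

/-- The tensor product `M ⊗_A N` of a right and a left module over a ring `A`. -/
def BTensor (A : Type u₁) (M : Type u₂) (N : Type u₃) [Ring A] [AddCommGroup M]
    [AddCommGroup N] [Module Aᵐᵒᵖ M] [Module A N] : Type (max u₂ u₃) :=
  (M ⊗[ℤ] N) ⧸ balancedRel A M N

namespace BTensor

variable {A : Type u₁} {M : Type u₂} {N : Type u₃} [Ring A] [AddCommGroup M]
    [AddCommGroup N] [Module Aᵐᵒᵖ M] [Module A N]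

instance : AddCommGroup (BTensor A M N) :=
  inferInstanceAs (AddCommGroup ((M ⊗[ℤ] N) ⧸ balancedRel A M N))

variable (A) in
/-- The elementary tensor `m ⊗ n` in `M ⊗_A N`. -/
def tmul (m : M) (n : N) : BTensor A M N :=
  QuotientAddGroup.mk' (balancedRel A M N) (m ⊗ₜ[ℤ] n)

theorem add_tmul (m m' : M) (n : N) : tmul A (m + m') n = tmul A m n + tmul A m' n := by
  simp only [tmul, TensorProduct.add_tmul, map_add]; rfl

theorem tmul_add (m : M) (n n' : N) : tmul A m (n + n') = tmul A m n + tmul A m n' := by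
  simp only [tmul, TensorProduct.tmul_add, map_add]; rfl

theorem smul_tmul (m : M) (a : A) (n : N) :
    tmul A (MulOpposite.op a • m) n = tmul A m (a • n) := by
  refine (QuotientAddGroup.eq_iff_sub_mem).2 ?_
  exact AddSubgroup.subset_closure ⟨m, a, n, rfl⟩

variable (A M N) in
/-- `tmul` as a biadditive map. -/
def mk : M →+ N →+ BTensor A M N :=
  AddMonoidHom.mk' (fun m => AddMonoidHom.mk' (fun n => tmul A m n) (tmul_add m))
    (fun m m' => AddMonoidHom.ext fun n => add_tmul m m' n)

@[simp] theorem mk_apply (m : M) (n : N) : mk A M N m n = tmul A m n := rfl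

/-- A balanced biadditive map factors through `M ⊗_A N`. -/
def lift {P : Type u₄} [AddCommGroup P] (f : M →+ N →+ P)
    (hf : ∀ (m : M) (a : A) (n : N), f (MulOpposite.op a • m) n = f m (a • n)) :
    BTensor A M N →+ P :=
  QuotientAddGroup.lift (balancedRel A M N)
    (TensorProduct.liftAddHom (R := ℤ) f (fun r m n => by simp)) <| by
    rw [balancedRel, AddSubgroup.closure_le]
    rintro _ ⟨m, a, n, rfl⟩
    simp [hf]

@[simp] theorem lift_tmul {P : Type u₄} [AddCommGroup P] (f : M →+ N →+ P)
    (hf : ∀ (m : M) (a : A) (n : N), f (MulOpposite.op a • m) n = f m (a • n))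
    (m : M) (n : N) : lift f hf (tmul A m n) = f m n := rfl

theorem induction_on {p : BTensor A M N → Prop} (x : BTensor A M N) (h0 : p 0)
    (ht : ∀ m n, p (tmul A m n)) (ha : ∀ x y, p x → p y → p (x + y)) : p x := by
  obtain ⟨t, rfl⟩ := QuotientAddGroup.mk'_surjective (balancedRel A M N) x
  induction t using TensorProduct.induction_on with
  | zero => rw [map_zero]; exact h0
  | tmul m n => exact ht m n
  | add x y hx hy => rw [map_add]; exact ha _ _ hx hy

theorem hom_ext {P : Type u₄} [AddCommGroup P] {f g : BTensor A M N →+ P}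
    (h : ∀ m n, f (tmul A m n) = g (tmul A m n)) : f = g := by
  ext x
  induction x using induction_on with
  | h0 => simp
  | ht m n => exact h m n
  | ha x y hx hy => simp [hx, hy]

/-- `f ⊗ g` for a right module map `f` and a left module map `g`. -/
def map {M' : Type u₄} {N' : Type u₅} [AddCommGroup M'] [AddCommGroup N'] [Module Aᵐᵒᵖ M']
    [Module A N'] (f : M →+ M') (g : N →+ N')
    (hf : ∀ (a : A) m, f (MulOpposite.op a • m) = MulOpposite.op a • f m)
    (hg : ∀ (a : A) n, g (a • n) = a • g n) : BTensor A M N →+ BTensor A M' N' :=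
  lift (((mk A M' N').comp f).compl₂ g) (by
    intro m a n
    simp [hf, hg, smul_tmul])

@[simp] theorem map_tmul {M' : Type u₄} {N' : Type u₅} [AddCommGroup M'] [AddCommGroup N']
    [Module Aᵐᵒᵖ M'] [Module A N'] (f : M →+ M') (g : N →+ N')
    (hf : ∀ (a : A) m, f (MulOpposite.op a • m) = MulOpposite.op a • f m)
    (hg : ∀ (a : A) n, g (a • n) = a • g n) (m : M) (n : N) :
    map f g hf hg (tmul A m n) = tmul A (f m) (g n) := rfl

theorem tmul_zero (m : M) : tmul A m (0 : N) = 0 := map_zero (mk A M N m)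

theorem zero_tmul (n : N) : tmul A (0 : M) n = 0 :=
  DFunLike.congr_fun (map_zero (mk A M N)) n

/-- The endomorphism `m ⊗ n ↦ m ⊗ (r • n)`. -/
def smulRight {R : Type u₄} [Ring R] [Module R N] [SMulCommClass A R N] (r : R) :
    BTensor A M N →+ BTensor A M N :=
  map (AddMonoidHom.id M) (DistribSMul.toAddMonoidHom N r) (fun _ _ => rfl)
    (fun a n => (smul_comm a r n).symm)

/-- The endomorphism `m ⊗ n ↦ (r • m) ⊗ n`. -/
def smulLeft {R : Type u₄} [Ring R] [Module R M] [SMulCommClass R Aᵐᵒᵖ M] (r : R) :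
    BTensor A M N →+ BTensor A M N :=
  map (DistribSMul.toAddMonoidHom M r) (AddMonoidHom.id N)
    (fun a m => smul_comm r (MulOpposite.op a) m) (fun _ _ => rfl)

/-- An action on `N` commuting with `A` acts on `M ⊗_A N` by `r • (m ⊗ n) = m ⊗ (r • n)`. -/
@[reducible] def moduleOfRight (R : Type u₄) [Ring R] [Module R N] [SMulCommClass A R N] :
    Module R (BTensor A M N) where
  smul r x := smulRight r x
  one_smul x := DFunLike.congr_fun (f := smulRight (1 : R)) (g := AddMonoidHom.id _)
    (hom_ext fun m n => congrArg (tmul A m) (one_smul R n)) x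
  mul_smul r s x := DFunLike.congr_fun (f := smulRight (r * s))
    (g := (smulRight r).comp (smulRight s))
    (hom_ext fun m n => congrArg (tmul A m) (mul_smul r s n)) x
  smul_zero _ := map_zero _
  smul_add _ x y := map_add _ x y
  add_smul r s x := DFunLike.congr_fun (f := smulRight (r + s)) (g := smulRight r + smulRight s)
    (hom_ext fun m n => (congrArg (tmul A m) (add_smul r s n)).trans (tmul_add _ _ _)) x
  zero_smul x := DFunLike.congr_fun (f := smulRight (0 : R)) (g := (0 : BTensor A M N →+ BTensor A M N))
    (hom_ext fun m n => (congrArg (tmul A m) (zero_smul R n)).trans (tmul_zero m)) x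

/-- An action on `M` commuting with `A` acts on `M ⊗_A N` by `r • (m ⊗ n) = (r • m) ⊗ n`. -/
@[reducible] def moduleOfLeft (R : Type u₄) [Ring R] [Module R M] [SMulCommClass R Aᵐᵒᵖ M] :
    Module R (BTensor A M N) where
  smul r x := smulLeft r x
  one_smul x := DFunLike.congr_fun (f := smulLeft (1 : R)) (g := AddMonoidHom.id _)
    (hom_ext fun m n => congrArg (tmul A · n) (one_smul R m)) x
  mul_smul r s x := DFunLike.congr_fun (f := smulLeft (r * s))
    (g := (smulLeft r).comp (smulLeft s))
    (hom_ext fun m n => congrArg (tmul A · n) (mul_smul r s m)) x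
  smul_zero _ := map_zero _
  smul_add _ x y := map_add _ x y
  add_smul r s x := DFunLike.congr_fun (f := smulLeft (r + s)) (g := smulLeft r + smulLeft s)
    (hom_ext fun m n => (congrArg (tmul A · n) (add_smul r s m)).trans (add_tmul _ _ _)) x
  zero_smul x := DFunLike.congr_fun (f := smulLeft (0 : R)) (g := (0 : BTensor A M N →+ BTensor A M N))
    (hom_ext fun m n => (congrArg (tmul A · n) (zero_smul R m)).trans (zero_tmul n)) x

section Instances

/-- Right multiplication on `M ⊗_A N` for a bimodule `N`. -/
instance instModuleOp [Module Aᵐᵒᵖ N] [SMulCommClass A Aᵐᵒᵖ N] : Module Aᵐᵒᵖ (BTensor A M N) :=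
  moduleOfRight Aᵐᵒᵖ

/-- Left multiplication on `M ⊗_A N` for a bimodule `M`. -/
instance instModule [Module A M] [SMulCommClass A Aᵐᵒᵖ M] : Module A (BTensor A M N) :=
  moduleOfLeft A

/-- Complex scalars acting through the right factor. -/
instance instModuleComplexRight [Module ℂ N] [SMulCommClass A ℂ N] : Module ℂ (BTensor A M N) :=
  moduleOfRight ℂ

/-- Complex scalars acting through the left factor. -/
instance instModuleComplexLeft [Module ℂ M] [SMulCommClass ℂ Aᵐᵒᵖ M] : Module ℂ (BTensor A M N) :=
  moduleOfLeft ℂ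

theorem op_smul_tmul [Module Aᵐᵒᵖ N] [SMulCommClass A Aᵐᵒᵖ N] (a : A) (m : M) (n : N) :
    MulOpposite.op a • tmul A m n = tmul A m (MulOpposite.op a • n) := rfl

theorem left_smul_tmul [Module A M] [SMulCommClass A Aᵐᵒᵖ M] (a : A) (m : M) (n : N) :
    a • tmul A m n = tmul A (a • m) n := rfl

instance [Module Aᵐᵒᵖ N] [SMulCommClass A Aᵐᵒᵖ N] [Module ℂ N] [SMulCommClass A ℂ N]
    [SMulCommClass ℂ Aᵐᵒᵖ N] : SMulCommClass ℂ Aᵐᵒᵖ (BTensor A M N) where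
  smul_comm r a x := by
    induction x using induction_on with
    | h0 => simp
    | ht m n => exact congrArg (tmul A m) (smul_comm r a n)
    | ha x y hx hy => simp only [smul_add, hx, hy]

end Instances

/-- A biadditive map with values in additive maps, from a triadditive function. -/
def triHom {P : Type u₄} {Q : Type u₅} [AddCommGroup P] [AddCommGroup Q] (f : M → N → P → Q)
    (h₁ : ∀ m m' n p, f (m + m') n p = f m n p + f m' n p)
    (h₂ : ∀ m n n' p, f m (n + n') p = f m n p + f m n' p)
    (h₃ : ∀ m n p p', f m n (p + p') = f m n p + f m n p') : M →+ N →+ P →+ Q :=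
  AddMonoidHom.mk' (fun m => AddMonoidHom.mk' (fun n => AddMonoidHom.mk' (f m n) (h₃ m n))
    (fun n n' => AddMonoidHom.ext (h₂ m n n'))) (fun m m' => AddMonoidHom.ext fun n =>
      AddMonoidHom.ext (h₁ m m' n))

section Assoc

variable {P : Type u₄} [AddCommGroup P] [Module A P] [Module Aᵐᵒᵖ N] [SMulCommClass A Aᵐᵒᵖ N]

/-- `(m ⊗ n) ⊗ p ↦ m ⊗ (n ⊗ p)`. -/
def assocHom : BTensor A (BTensor A M N) P →+ BTensor A M (BTensor A N P) :=
  lift (lift (triHom (fun m n p => tmul A m (tmul A n p))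
      (fun m m' n p => add_tmul m m' _)
      (fun m n n' p => (congrArg (tmul A m) (add_tmul n n' p)).trans (tmul_add _ _ _))
      (fun m n p p' => (congrArg (tmul A m) (tmul_add n p p')).trans (tmul_add _ _ _)))
      (fun m a n => AddMonoidHom.ext fun p => smul_tmul m a (tmul A n p)))
    (fun x a p => by
      induction x using induction_on with
      | h0 => rw [smul_zero, map_zero]; rfl
      | ht m n => exact congrArg (tmul A m) (smul_tmul n a p)
      | ha x y hx hy =>
        rw [smul_add, map_add, map_add, AddMonoidHom.add_apply, AddMonoidHom.add_apply, hx, hy])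

/-- `m ⊗ (n ⊗ p) ↦ (m ⊗ n) ⊗ p`. -/
def assocInv : BTensor A M (BTensor A N P) →+ BTensor A (BTensor A M N) P :=
  lift (AddMonoidHom.mk' (fun m => lift ((mk A (BTensor A M N) P).comp (mk A M N m))
      (fun n a p => smul_tmul (tmul A m n) a p))
      (fun m m' => hom_ext fun n p =>
        (congrArg (tmul A · p) (add_tmul m m' n)).trans (add_tmul _ _ _)))
    (fun m a x => by
      induction x using induction_on with
      | h0 => rw [smul_zero, map_zero, map_zero]
      | ht n p => exact congrArg (tmul A · p) (smul_tmul m a n)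
      | ha x y hx hy => rw [smul_add, map_add, map_add, hx, hy])

/-- The associativity isomorphism `(M ⊗_A N) ⊗_A P ≃ M ⊗_A (N ⊗_A P)` for a bimodule `N`. -/
def assoc : BTensor A (BTensor A M N) P ≃+ BTensor A M (BTensor A N P) :=
  AddMonoidHom.toAddEquiv assocHom assocInv
    (hom_ext fun x p => by
      induction x using induction_on with
      | h0 => rw [zero_tmul, map_zero, map_zero]
      | ht m n => rfl
      | ha x y hx hy => rw [add_tmul, map_add, map_add, hx, hy])
    (hom_ext fun m x => by
      induction x using induction_on with
      | h0 => rw [tmul_zero, map_zero, map_zero]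
      | ht n p => rfl
      | ha x y hx hy => rw [tmul_add, map_add, map_add, hx, hy])

theorem assoc_tmul (m : M) (n : N) (p : P) :
    assoc (tmul A (tmul A m n) p) = tmul A m (tmul A n p) := rfl

end Assoc

end BTensor

end Balanced

/-! ## Universal one-forms and universal connections -/

section Forms

universe u₀ u₁ u₂ u₃ u₄

variable (𝕜 : Type u₀) (A : Type u₁) [RCLike 𝕜] [Ring A] [Algebra 𝕜 A]

/-- The bimodule `Ω¹(A)` of universal one-forms: the kernel of the multiplication
`A ⊗[𝕜] A → A`. -/
def UnivForm : Type u₁ := LinearMap.ker (LinearMap.mul' 𝕜 A)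

namespace UnivForm

instance : AddCommGroup (UnivForm 𝕜 A) :=
  inferInstanceAs (AddCommGroup (LinearMap.ker (LinearMap.mul' 𝕜 A)))

variable {𝕜 A}

/-- The element of `A ⊗[𝕜] A` underlying a universal one-form. -/
def val : UnivForm 𝕜 A →+ A ⊗[𝕜] A := (LinearMap.ker (LinearMap.mul' 𝕜 A)).subtype.toAddMonoidHom

theorem val_injective : Function.Injective (val : UnivForm 𝕜 A →+ A ⊗[𝕜] A) :=
  Subtype.val_injective

theorem mul_val (ω : UnivForm 𝕜 A) : LinearMap.mul' 𝕜 A ω.val = 0 := ω.2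

/-- Constructor: a tensor with vanishing product. -/
def ofTensor (t : A ⊗[𝕜] A) (ht : LinearMap.mul' 𝕜 A t = 0) : UnivForm 𝕜 A := ⟨t, ht⟩

theorem val_ofTensor (t : A ⊗[𝕜] A) (ht : LinearMap.mul' 𝕜 A t = 0) : (ofTensor t ht).val = t := rfl

theorem mul_lmul (a : A) (t : A ⊗[𝕜] A) :
    LinearMap.mul' 𝕜 A (LinearMap.rTensor A (LinearMap.mulLeft 𝕜 a) t) =
      a * LinearMap.mul' 𝕜 A t := by
  induction t using TensorProduct.induction_on with
  | zero => simp
  | tmul x y => simp [mul_assoc]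
  | add x y hx hy => simp only [map_add, mul_add, hx, hy]

theorem mul_rmul (a : A) (t : A ⊗[𝕜] A) :
    LinearMap.mul' 𝕜 A (LinearMap.lTensor A (LinearMap.mulRight 𝕜 a) t) =
      LinearMap.mul' 𝕜 A t * a := by
  induction t using TensorProduct.induction_on with
  | zero => simp
  | tmul x y => simp [mul_assoc]
  | add x y hx hy => simp only [map_add, add_mul, hx, hy]

/-- `a • (x ⊗ y) = (a x) ⊗ y`. -/
instance : Module A (UnivForm 𝕜 A) where
  smul a ω := ofTensor (LinearMap.rTensor A (LinearMap.mulLeft 𝕜 a) ω.val) (by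
    rw [mul_lmul, mul_val, mul_zero])
  one_smul ω := val_injective (by
    change LinearMap.rTensor A (LinearMap.mulLeft 𝕜 1) ω.val = ω.val
    simp)
  mul_smul a b ω := val_injective (by
    change LinearMap.rTensor A (LinearMap.mulLeft 𝕜 (a * b)) ω.val =
      LinearMap.rTensor A (LinearMap.mulLeft 𝕜 a) (LinearMap.rTensor A (LinearMap.mulLeft 𝕜 b) ω.val)
    rw [LinearMap.mulLeft_mul, LinearMap.rTensor_comp, LinearMap.comp_apply])
  smul_zero a := val_injective (map_zero (LinearMap.rTensor A (LinearMap.mulLeft 𝕜 a)))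
  smul_add a ω η := val_injective (map_add (LinearMap.rTensor A (LinearMap.mulLeft 𝕜 a)) ω.val η.val)
  add_smul a b ω := val_injective (by
    change LinearMap.rTensor A (LinearMap.mulLeft 𝕜 (a + b)) ω.val =
      LinearMap.rTensor A (LinearMap.mulLeft 𝕜 a) ω.val +
        LinearMap.rTensor A (LinearMap.mulLeft 𝕜 b) ω.val
    have h : LinearMap.mulLeft 𝕜 (a + b) = LinearMap.mulLeft 𝕜 a + LinearMap.mulLeft 𝕜 b := by
      ext; simp [add_mul]
    rw [h, LinearMap.rTensor_add, LinearMap.add_apply])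
  zero_smul ω := val_injective (by
    change LinearMap.rTensor A (LinearMap.mulLeft 𝕜 0) ω.val = 0
    simp)

/-- `(x ⊗ y) · a = x ⊗ (y a)`. -/
instance : Module Aᵐᵒᵖ (UnivForm 𝕜 A) where
  smul a ω := ofTensor (LinearMap.lTensor A (LinearMap.mulRight 𝕜 a.unop) ω.val) (by
    rw [mul_rmul, mul_val, zero_mul])
  one_smul ω := val_injective (by
    change LinearMap.lTensor A (LinearMap.mulRight 𝕜 1) ω.val = ω.val
    simp)
  mul_smul a b ω := val_injective (by
    change LinearMap.lTensor A (LinearMap.mulRight 𝕜 (b.unop * a.unop)) ω.val =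
      LinearMap.lTensor A (LinearMap.mulRight 𝕜 a.unop)
        (LinearMap.lTensor A (LinearMap.mulRight 𝕜 b.unop) ω.val)
    rw [LinearMap.mulRight_mul, LinearMap.lTensor_comp, LinearMap.comp_apply])
  smul_zero a := val_injective (map_zero (LinearMap.lTensor A (LinearMap.mulRight 𝕜 a.unop)))
  smul_add a ω η := val_injective
    (map_add (LinearMap.lTensor A (LinearMap.mulRight 𝕜 a.unop)) ω.val η.val)
  add_smul a b ω := val_injective (by
    change LinearMap.lTensor A (LinearMap.mulRight 𝕜 (a.unop + b.unop)) ω.val =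
      LinearMap.lTensor A (LinearMap.mulRight 𝕜 a.unop) ω.val +
        LinearMap.lTensor A (LinearMap.mulRight 𝕜 b.unop) ω.val
    have h : LinearMap.mulRight 𝕜 (a.unop + b.unop) =
        LinearMap.mulRight 𝕜 a.unop + LinearMap.mulRight 𝕜 b.unop := by
      ext; simp [mul_add]
    rw [h, LinearMap.lTensor_add, LinearMap.add_apply])
  zero_smul ω := val_injective (by
    change LinearMap.lTensor A (LinearMap.mulRight 𝕜 0) ω.val = 0
    simp)

theorem val_smul (a : A) (ω : UnivForm 𝕜 A) :
    (a • ω).val = LinearMap.rTensor A (LinearMap.mulLeft 𝕜 a) ω.val := rfl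

theorem val_op_smul (a : A) (ω : UnivForm 𝕜 A) :
    (MulOpposite.op a • ω).val = LinearMap.lTensor A (LinearMap.mulRight 𝕜 a) ω.val := rfl

instance : SMulCommClass A Aᵐᵒᵖ (UnivForm 𝕜 A) where
  smul_comm a b ω := val_injective (by
    change LinearMap.rTensor A (LinearMap.mulLeft 𝕜 a)
        (LinearMap.lTensor A (LinearMap.mulRight 𝕜 b.unop) ω.val) =
      LinearMap.lTensor A (LinearMap.mulRight 𝕜 b.unop)
        (LinearMap.rTensor A (LinearMap.mulLeft 𝕜 a) ω.val)
    rw [← LinearMap.comp_apply, ← LinearMap.comp_apply, LinearMap.rTensor_comp_lTensor,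
      LinearMap.lTensor_comp_rTensor])

variable (𝕜) in
/-- The universal differential `δ a = 1 ⊗ a - a ⊗ 1`. -/
def δ : A →+ UnivForm 𝕜 A :=
  AddMonoidHom.mk' (fun a => ofTensor ((1 : A) ⊗ₜ[𝕜] a - a ⊗ₜ[𝕜] (1 : A)) (by simp))
    (fun a b => val_injective (by
      change (1 : A) ⊗ₜ[𝕜] (a + b) - (a + b) ⊗ₜ[𝕜] (1 : A) =
        ((1 : A) ⊗ₜ[𝕜] a - a ⊗ₜ[𝕜] (1 : A)) + ((1 : A) ⊗ₜ[𝕜] b - b ⊗ₜ[𝕜] (1 : A))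
      rw [TensorProduct.tmul_add, TensorProduct.add_tmul]
      abel))

theorem val_δ (a : A) : (δ 𝕜 a).val = (1 : A) ⊗ₜ[𝕜] a - a ⊗ₜ[𝕜] (1 : A) := rfl

section Star

variable [StarRing A] [StarModule 𝕜 A]

/-- `x ⊗ y ↦ y* ⊗ x*` on `A ⊗[𝕜] A`. -/
def starTensor : A ⊗[𝕜] A →+ A ⊗[𝕜] A :=
  TensorProduct.liftAddHom
    (AddMonoidHom.mk' (fun x => AddMonoidHom.mk' (fun y => star y ⊗ₜ[𝕜] star x)
      (fun y y' => by rw [star_add, TensorProduct.add_tmul]))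
      (fun x x' => AddMonoidHom.ext fun y => by
        simp [TensorProduct.tmul_add]))
    (fun c x y => by simp [TensorProduct.smul_tmul])

theorem starTensor_tmul (x y : A) : starTensor (x ⊗ₜ[𝕜] y) = star y ⊗ₜ[𝕜] star x := rfl

theorem mul_starTensor (t : A ⊗[𝕜] A) :
    LinearMap.mul' 𝕜 A (starTensor t) = star (LinearMap.mul' 𝕜 A t) := by
  induction t using TensorProduct.induction_on with
  | zero => simp
  | tmul x y => simp [starTensor_tmul]
  | add x y hx hy => simp only [map_add, star_add, hx, hy]

/-- The involution of universal one-forms; it satisfies `(δ a)* = - δ (a*)` and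
`(a ω b)* = b* ω* a*`. -/
def starHom : UnivForm 𝕜 A →+ UnivForm 𝕜 A :=
  AddMonoidHom.mk' (fun ω => ofTensor (starTensor ω.val) (by
      rw [mul_starTensor, mul_val, star_zero]))
    (fun ω η => val_injective (map_add starTensor ω.val η.val))

theorem val_starHom (ω : UnivForm 𝕜 A) : (starHom ω).val = starTensor ω.val := rfl

theorem starHom_δ (a : A) : starHom (δ 𝕜 a) = - δ 𝕜 (star a) := val_injective (by
  rw [val_starHom, map_neg, val_δ, val_δ, map_sub, starTensor_tmul, starTensor_tmul, star_one,
    neg_sub])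

theorem starHom_smul (a : A) (ω : UnivForm 𝕜 A) :
    starHom (a • ω) = MulOpposite.op (star a) • starHom ω := val_injective (by
  rw [val_starHom, val_smul, val_op_smul, val_starHom]
  induction ω.val using TensorProduct.induction_on with
  | zero => simp
  | tmul x y => simp [starTensor_tmul]
  | add x y hx hy => simp only [map_add, hx, hy])

theorem starHom_op_smul (a : A) (ω : UnivForm 𝕜 A) :
    starHom (MulOpposite.op a • ω) = star a • starHom ω := val_injective (by
  rw [val_starHom, val_smul, val_op_smul, val_starHom]
  induction ω.val using TensorProduct.induction_on with
  | zero => simp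
  | tmul x y => simp [starTensor_tmul]
  | add x y hx hy => simp only [map_add, hx, hy])

end Star

/-! ### Representing one-forms by commutators -/

section Action

variable {M₀ : Type u₂} {M : Type u₃} [AddCommGroup M₀] [AddCommGroup M]

section Left

variable [Module A M₀] [Module A M]

/-- `a ⊗ b ↦ a [D, b]` on `A ⊗[𝕜] A`, for a map `D` of left modules commuting with the scalars. -/
def commTensorLeft (D : M₀ →+ M)
    (hD : ∀ (c : 𝕜) (x : M₀), D (algebraMap 𝕜 A c • x) = algebraMap 𝕜 A c • D x) :
    A ⊗[𝕜] A →+ M₀ →+ M :=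
  TensorProduct.liftAddHom
    (BTensor.triHom (fun (a b : A) (x : M₀) => a • (D (b • x) - b • D x))
      (fun a a' b x => add_smul _ _ _)
      (fun a b b' x => by simp only [add_smul, map_add, smul_sub, smul_add]; abel)
      (fun a b x x' => by simp only [map_add, smul_sub, smul_add]; abel))
    (fun c a b => AddMonoidHom.ext fun x => by
      change (c • a) • (D (b • x) - b • D x) = a • (D ((c • b) • x) - (c • b) • D x)
      rw [Algebra.smul_def c b, mul_smul, mul_smul, hD, ← smul_sub, smul_smul a,
        ← Algebra.commutes, ← Algebra.smul_def])

/-- The representation `a δ(b) ↦ a [D, b]` of universal one-forms, as operators on the domain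
`M₀` of `D`. -/
def actLeft (D : M₀ →+ M)
    (hD : ∀ (c : 𝕜) (x : M₀), D (algebraMap 𝕜 A c • x) = algebraMap 𝕜 A c • D x) :
    UnivForm 𝕜 A →+ M₀ →+ M :=
  (commTensorLeft D hD).comp val

variable (D : M₀ →+ M)
    (hD : ∀ (c : 𝕜) (x : M₀), D (algebraMap 𝕜 A c • x) = algebraMap 𝕜 A c • D x)

theorem commTensorLeft_tmul (a b : A) (x : M₀) :
    commTensorLeft D hD (a ⊗ₜ[𝕜] b) x = a • (D (b • x) - b • D x) := rfl

theorem actLeft_smul_δ (a b : A) (x : M₀) :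
    actLeft D hD (a • δ 𝕜 b) x = a • (D (b • x) - b • D x) := by
  change commTensorLeft D hD (a • δ 𝕜 b).val x = _
  rw [val_smul, val_δ]
  simp [commTensorLeft_tmul]

theorem actLeft_smul (a : A) (ω : UnivForm 𝕜 A) (x : M₀) :
    actLeft D hD (a • ω) x = a • actLeft D hD ω x := by
  change commTensorLeft D hD (a • ω).val x = a • commTensorLeft D hD ω.val x
  rw [val_smul]
  induction ω.val using TensorProduct.induction_on with
  | zero => simp
  | tmul b c => simp [commTensorLeft_tmul, mul_smul]
  | add s t hs ht => simp only [map_add, AddMonoidHom.add_apply, smul_add, hs, ht]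

theorem commTensorLeft_rmul (a : A) (t : A ⊗[𝕜] A) (x : M₀) :
    commTensorLeft D hD (LinearMap.lTensor A (LinearMap.mulRight 𝕜 a) t) x =
      commTensorLeft D hD t (a • x) + LinearMap.mul' 𝕜 A t • (D (a • x) - a • D x) := by
  induction t using TensorProduct.induction_on with
  | zero => simp
  | tmul b c =>
    simp only [LinearMap.lTensor_tmul, LinearMap.mulRight_apply, commTensorLeft_tmul,
      LinearMap.mul'_apply, mul_smul, smul_sub]
    abel
  | add s t hs ht => simp only [map_add, AddMonoidHom.add_apply, add_smul, hs, ht]; abel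

theorem actLeft_op_smul (a : A) (ω : UnivForm 𝕜 A) (x : M₀) :
    actLeft D hD (MulOpposite.op a • ω) x = actLeft D hD ω (a • x) := by
  change commTensorLeft D hD (MulOpposite.op a • ω).val x = commTensorLeft D hD ω.val (a • x)
  rw [val_op_smul, commTensorLeft_rmul, mul_val, zero_smul, add_zero]

theorem actLeft_comm_op [Module Aᵐᵒᵖ M₀] [Module Aᵐᵒᵖ M] [SMulCommClass A Aᵐᵒᵖ M₀]
    [SMulCommClass A Aᵐᵒᵖ M] (b : Aᵐᵒᵖ) (hb : ∀ x, D (b • x) = b • D x) (ω : UnivForm 𝕜 A)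
    (x : M₀) : actLeft D hD ω (b • x) = b • actLeft D hD ω x := by
  change commTensorLeft D hD ω.val (b • x) = b • commTensorLeft D hD ω.val x
  induction ω.val using TensorProduct.induction_on with
  | zero => simp
  | tmul c d => simp only [commTensorLeft_tmul, smul_comm _ b, hb, smul_sub]
  | add s t hs ht => simp only [map_add, AddMonoidHom.add_apply, smul_add, hs, ht]

end Left

section Right

variable [Module Aᵐᵒᵖ M₀] [Module Aᵐᵒᵖ M]

/-- `a ⊗ b ↦ (x ↦ D(x a b) - D(x a) b)` on `A ⊗[𝕜] A`, for a map `D` of right modules. -/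
def commTensorRight (D : M₀ →+ M)
    (hD : ∀ (c : 𝕜) (x : M₀), D (MulOpposite.op (algebraMap 𝕜 A c) • x) =
      MulOpposite.op (algebraMap 𝕜 A c) • D x) :
    A ⊗[𝕜] A →+ M₀ →+ M :=
  TensorProduct.liftAddHom
    (BTensor.triHom (fun (a b : A) (x : M₀) => D (MulOpposite.op b • MulOpposite.op a • x) -
        MulOpposite.op b • D (MulOpposite.op a • x))
      (fun a a' b x => by simp only [MulOpposite.op_add, add_smul, map_add, smul_add]; abel)
      (fun a b b' x => by simp only [MulOpposite.op_add, add_smul, map_add]; abel)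
      (fun a b x x' => by simp only [map_add, smul_add]; abel))
    (fun c a b => AddMonoidHom.ext fun x => by
      change D (MulOpposite.op b • MulOpposite.op (c • a) • x) -
        MulOpposite.op b • D (MulOpposite.op (c • a) • x) =
        D (MulOpposite.op (c • b) • MulOpposite.op a • x) -
        MulOpposite.op (c • b) • D (MulOpposite.op a • x)
      have e : c • a = a * algebraMap 𝕜 A c := by rw [Algebra.smul_def, Algebra.commutes]
      rw [e, Algebra.smul_def c b, MulOpposite.op_mul, MulOpposite.op_mul, mul_smul, mul_smul,
        mul_smul, hD])

/-- The representation of universal one-forms through the right action: `a δ(b)` acts by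
`x ↦ [D, b°] (x a)`, where `b°` is right multiplication by `b`. -/
def actRight (D : M₀ →+ M)
    (hD : ∀ (c : 𝕜) (x : M₀), D (MulOpposite.op (algebraMap 𝕜 A c) • x) =
      MulOpposite.op (algebraMap 𝕜 A c) • D x) :
    UnivForm 𝕜 A →+ M₀ →+ M :=
  (commTensorRight D hD).comp val

variable (D : M₀ →+ M)
    (hD : ∀ (c : 𝕜) (x : M₀), D (MulOpposite.op (algebraMap 𝕜 A c) • x) =
      MulOpposite.op (algebraMap 𝕜 A c) • D x)

theorem commTensorRight_tmul (a b : A) (x : M₀) :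
    commTensorRight D hD (a ⊗ₜ[𝕜] b) x = D (MulOpposite.op b • MulOpposite.op a • x) -
        MulOpposite.op b • D (MulOpposite.op a • x) := rfl

theorem actRight_smul_δ (a b : A) (x : M₀) :
    actRight D hD (a • δ 𝕜 b) x = D (MulOpposite.op b • MulOpposite.op a • x) -
        MulOpposite.op b • D (MulOpposite.op a • x) := by
  change commTensorRight D hD (a • δ 𝕜 b).val x = _
  rw [val_smul, val_δ]
  simp [commTensorRight_tmul]

theorem actRight_smul (a : A) (ω : UnivForm 𝕜 A) (x : M₀) :
    actRight D hD (a • ω) x = actRight D hD ω (MulOpposite.op a • x) := by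
  change commTensorRight D hD (a • ω).val x = commTensorRight D hD ω.val (MulOpposite.op a • x)
  rw [val_smul]
  induction ω.val using TensorProduct.induction_on with
  | zero => simp
  | tmul b c => simp [commTensorRight_tmul, mul_smul]
  | add s t hs ht => simp only [map_add, AddMonoidHom.add_apply, hs, ht]

theorem commTensorRight_rmul (a : A) (t : A ⊗[𝕜] A) (x : M₀) :
    commTensorRight D hD (LinearMap.lTensor A (LinearMap.mulRight 𝕜 a) t) x =
      MulOpposite.op a • commTensorRight D hD t x +
        (D (MulOpposite.op a • MulOpposite.op (LinearMap.mul' 𝕜 A t) • x) -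
          MulOpposite.op a • D (MulOpposite.op (LinearMap.mul' 𝕜 A t) • x)) := by
  induction t using TensorProduct.induction_on with
  | zero => simp
  | tmul b c =>
    simp only [LinearMap.lTensor_tmul, LinearMap.mulRight_apply, commTensorRight_tmul,
      LinearMap.mul'_apply, MulOpposite.op_mul, mul_smul, smul_sub]
    abel
  | add s t hs ht =>
    simp only [map_add, AddMonoidHom.add_apply, MulOpposite.op_add, add_smul, smul_add, hs, ht]
    abel

theorem actRight_op_smul (a : A) (ω : UnivForm 𝕜 A) (x : M₀) :
    actRight D hD (MulOpposite.op a • ω) x = MulOpposite.op a • actRight D hD ω x := by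
  change commTensorRight D hD (MulOpposite.op a • ω).val x =
    MulOpposite.op a • commTensorRight D hD ω.val x
  rw [val_op_smul, commTensorRight_rmul, mul_val]
  simp

theorem actRight_comm [Module A M₀] [Module A M] [SMulCommClass A Aᵐᵒᵖ M₀]
    [SMulCommClass A Aᵐᵒᵖ M] (b : A) (hb : ∀ x, D (b • x) = b • D x) (ω : UnivForm 𝕜 A)
    (x : M₀) : actRight D hD ω (b • x) = b • actRight D hD ω x := by
  change commTensorRight D hD ω.val (b • x) = b • commTensorRight D hD ω.val x
  induction ω.val using TensorProduct.induction_on with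
  | zero => simp
  | tmul c d => simp only [commTensorRight_tmul, ← smul_comm b, hb, smul_sub]
  | add s t hs ht => simp only [map_add, AddMonoidHom.add_apply, smul_add, hs, ht]

end Right

end Action

end UnivForm

/-! ### Connections -/

/-- A universal connection on a right module: `∇(v a) = ∇(v) a + v ⊗ δ(a)`. -/
structure UnivConnection (E : Type u₂) [AddCommGroup E] [Module Aᵐᵒᵖ E] where
  toHom : E →+ BTensor A E (UnivForm 𝕜 A)
  leibniz : ∀ (v : E) (a : A), toHom (MulOpposite.op a • v) =
    MulOpposite.op a • toHom v + BTensor.tmul A v (UnivForm.δ 𝕜 a)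

/-- A universal connection on a left module: `∇(a f) = a ∇(f) + δ(a) ⊗ f`. -/
structure UnivLeftConnection (F : Type u₂) [AddCommGroup F] [Module A F] where
  toHom : F →+ BTensor A (UnivForm 𝕜 A) F
  leibniz : ∀ (a : A) (f : F), toHom (a • f) =
    a • toHom f + BTensor.tmul A (UnivForm.δ 𝕜 a) f

variable {𝕜 A}

section Twist

variable {M₀ : Type u₂} {M : Type u₃} [AddCommGroup M₀] [AddCommGroup M]

namespace UnivConnection

variable {E : Type u₄} [AddCommGroup E] [Module Aᵐᵒᵖ E] [Module A M₀] [Module A M]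

/-- `v ⊗ ω ↦ (ξ ↦ v ⊗ ω_D ξ)` with `ω ↦ ω_D` the representation `a δ(b) ↦ a [D, b]`. -/
def formAct (D : M₀ →+ M)
    (hD : ∀ (c : 𝕜) (x : M₀), D (algebraMap 𝕜 A c • x) = algebraMap 𝕜 A c • D x) :
    BTensor A E (UnivForm 𝕜 A) →+ M₀ →+ BTensor A E M :=
  BTensor.lift (BTensor.triHom (fun v ω x => BTensor.tmul A v (UnivForm.actLeft D hD ω x))
      (fun v v' ω x => BTensor.add_tmul _ _ _)
      (fun v ω ω' x => by
        rw [map_add, AddMonoidHom.add_apply, BTensor.tmul_add])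
      (fun v ω x x' => by rw [map_add, BTensor.tmul_add]))
    (fun v a ω => AddMonoidHom.ext fun x => by
      change BTensor.tmul A (MulOpposite.op a • v) (UnivForm.actLeft D hD ω x) =
        BTensor.tmul A v (UnivForm.actLeft D hD (a • ω) x)
      rw [UnivForm.actLeft_smul, BTensor.smul_tmul])

theorem formAct_tmul (D : M₀ →+ M)
    (hD : ∀ (c : 𝕜) (x : M₀), D (algebraMap 𝕜 A c • x) = algebraMap 𝕜 A c • D x)
    (v : E) (ω : UnivForm 𝕜 A) (x : M₀) :
    formAct D hD (BTensor.tmul A v ω) x = BTensor.tmul A v (UnivForm.actLeft D hD ω x) := rfl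

theorem formAct_op_smul (D : M₀ →+ M)
    (hD : ∀ (c : 𝕜) (x : M₀), D (algebraMap 𝕜 A c • x) = algebraMap 𝕜 A c • D x)
    (a : A) (θ : BTensor A E (UnivForm 𝕜 A)) (x : M₀) :
    formAct D hD (MulOpposite.op a • θ) x = formAct D hD θ (a • x) := by
  induction θ using BTensor.induction_on with
  | h0 => simp
  | ht v ω => rw [BTensor.op_smul_tmul, formAct_tmul, formAct_tmul, UnivForm.actLeft_op_smul]
  | ha x y hx hy => simp only [smul_add, map_add, AddMonoidHom.add_apply, hx, hy]

/-- The operator `1 ⊗_∇ D`, given by `v ⊗ ξ ↦ ∇_D(v) ξ + v ⊗ D ξ`. -/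
def twist (nabla : UnivConnection 𝕜 A E) (D : M₀ →+ M)
    (hD : ∀ (c : 𝕜) (x : M₀), D (algebraMap 𝕜 A c • x) = algebraMap 𝕜 A c • D x) :
    BTensor A E M₀ →+ BTensor A E M :=
  BTensor.lift ((formAct D hD).comp nabla.toHom + (BTensor.mk A E M).compl₂ D) (by
    intro v a x
    change formAct D hD (nabla.toHom (MulOpposite.op a • v)) x +
        BTensor.tmul A (MulOpposite.op a • v) (D x) =
      formAct D hD (nabla.toHom v) (a • x) + BTensor.tmul A v (D (a • x))
    have e : UnivForm.actLeft D hD (UnivForm.δ 𝕜 a) x = D (a • x) - a • D x := by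
      simpa using UnivForm.actLeft_smul_δ D hD 1 a x
    rw [nabla.leibniz, map_add, AddMonoidHom.add_apply, formAct_op_smul, formAct_tmul,
      BTensor.smul_tmul, e, add_assoc, ← BTensor.tmul_add, sub_add_cancel])

theorem twist_tmul (nabla : UnivConnection 𝕜 A E) (D : M₀ →+ M)
    (hD : ∀ (c : 𝕜) (x : M₀), D (algebraMap 𝕜 A c • x) = algebraMap 𝕜 A c • D x)
    (v : E) (x : M₀) : nabla.twist D hD (BTensor.tmul A v x) =
      formAct D hD (nabla.toHom v) x + BTensor.tmul A v (D x) := rfl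

theorem twist_comm_op [Module Aᵐᵒᵖ M₀] [Module Aᵐᵒᵖ M] [SMulCommClass A Aᵐᵒᵖ M₀]
    [SMulCommClass A Aᵐᵒᵖ M] (nabla : UnivConnection 𝕜 A E) (D : M₀ →+ M)
    (hD : ∀ (c : 𝕜) (x : M₀), D (algebraMap 𝕜 A c • x) = algebraMap 𝕜 A c • D x)
    (b : A) (hb : ∀ x, D (MulOpposite.op b • x) = MulOpposite.op b • D x) (y : BTensor A E M₀) :
    nabla.twist D hD (MulOpposite.op b • y) = MulOpposite.op b • nabla.twist D hD y := by
  have key : ∀ (θ : BTensor A E (UnivForm 𝕜 A)) (x : M₀),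
      formAct D hD θ (MulOpposite.op b • x) = MulOpposite.op b • formAct D hD θ x := by
    intro θ x
    induction θ using BTensor.induction_on with
    | h0 => simp
    | ht v ω =>
      rw [formAct_tmul, formAct_tmul, UnivForm.actLeft_comm_op D hD _ hb, BTensor.op_smul_tmul]
    | ha s t hs ht => simp only [smul_add, map_add, AddMonoidHom.add_apply, hs, ht]
  induction y using BTensor.induction_on with
  | h0 => rw [smul_zero, map_zero, smul_zero]
  | ht v x =>
    rw [BTensor.op_smul_tmul, twist_tmul, twist_tmul, smul_add, key, hb, BTensor.op_smul_tmul]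
  | ha s t hs ht => simp only [smul_add, map_add, hs, ht]

end UnivConnection

namespace UnivLeftConnection

variable {F : Type u₄} [AddCommGroup F] [Module A F] [Module Aᵐᵒᵖ M₀] [Module Aᵐᵒᵖ M]

/-- `ω ⊗ f ↦ (ξ ↦ (ξ ω)_D ⊗ f)` with `a δ(b)` acting on the right by `ξ ↦ [D, b°] (ξ a)`. -/
def formAct (D : M₀ →+ M)
    (hD : ∀ (c : 𝕜) (x : M₀), D (MulOpposite.op (algebraMap 𝕜 A c) • x) =
      MulOpposite.op (algebraMap 𝕜 A c) • D x) :
    BTensor A (UnivForm 𝕜 A) F →+ M₀ →+ BTensor A M F :=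
  BTensor.lift (BTensor.triHom (fun ω f x => BTensor.tmul A (UnivForm.actRight D hD ω x) f)
      (fun ω ω' f x => by rw [map_add, AddMonoidHom.add_apply, BTensor.add_tmul])
      (fun ω f f' x => BTensor.tmul_add _ _ _)
      (fun ω f x x' => by rw [map_add, BTensor.add_tmul]))
    (fun ω a f => AddMonoidHom.ext fun x => by
      change BTensor.tmul A (UnivForm.actRight D hD (MulOpposite.op a • ω) x) f =
        BTensor.tmul A (UnivForm.actRight D hD ω x) (a • f)
      rw [UnivForm.actRight_op_smul, BTensor.smul_tmul])

theorem formAct_tmul (D : M₀ →+ M)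
    (hD : ∀ (c : 𝕜) (x : M₀), D (MulOpposite.op (algebraMap 𝕜 A c) • x) =
      MulOpposite.op (algebraMap 𝕜 A c) • D x)
    (ω : UnivForm 𝕜 A) (f : F) (x : M₀) :
    formAct D hD (BTensor.tmul A ω f) x = BTensor.tmul A (UnivForm.actRight D hD ω x) f := rfl

theorem formAct_smul (D : M₀ →+ M)
    (hD : ∀ (c : 𝕜) (x : M₀), D (MulOpposite.op (algebraMap 𝕜 A c) • x) =
      MulOpposite.op (algebraMap 𝕜 A c) • D x)
    (a : A) (θ : BTensor A (UnivForm 𝕜 A) F) (x : M₀) :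
    formAct D hD (a • θ) x = formAct D hD θ (MulOpposite.op a • x) := by
  induction θ using BTensor.induction_on with
  | h0 => simp
  | ht ω f => rw [BTensor.left_smul_tmul, formAct_tmul, formAct_tmul, UnivForm.actRight_smul]
  | ha x y hx hy => simp only [smul_add, map_add, AddMonoidHom.add_apply, hx, hy]

/-- The operator `D ⊗_∇ 1`, given by `ξ ⊗ f ↦ D ξ ⊗ f + ξ ∇_D(f)`. -/
def twist (nabla : UnivLeftConnection 𝕜 A F) (D : M₀ →+ M)
    (hD : ∀ (c : 𝕜) (x : M₀), D (MulOpposite.op (algebraMap 𝕜 A c) • x) =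
      MulOpposite.op (algebraMap 𝕜 A c) • D x) :
    BTensor A M₀ F →+ BTensor A M F :=
  BTensor.lift ((BTensor.mk A M F).comp D + ((formAct D hD).comp nabla.toHom).flip) (by
    intro x a f
    change BTensor.tmul A (D (MulOpposite.op a • x)) f +
        formAct D hD (nabla.toHom f) (MulOpposite.op a • x) =
      BTensor.tmul A (D x) (a • f) + formAct D hD (nabla.toHom (a • f)) x
    have e : UnivForm.actRight D hD (UnivForm.δ 𝕜 a) x =
        D (MulOpposite.op a • x) - MulOpposite.op a • D x := by
      simpa using UnivForm.actRight_smul_δ D hD 1 a x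
    rw [nabla.leibniz, map_add, AddMonoidHom.add_apply, formAct_smul, formAct_tmul,
      ← BTensor.smul_tmul, e, add_left_comm, ← BTensor.add_tmul, add_sub_cancel, add_comm])

theorem twist_tmul (nabla : UnivLeftConnection 𝕜 A F) (D : M₀ →+ M)
    (hD : ∀ (c : 𝕜) (x : M₀), D (MulOpposite.op (algebraMap 𝕜 A c) • x) =
      MulOpposite.op (algebraMap 𝕜 A c) • D x)
    (x : M₀) (f : F) : nabla.twist D hD (BTensor.tmul A x f) =
      BTensor.tmul A (D x) f + formAct D hD (nabla.toHom f) x := rfl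

theorem twist_comm [Module A M₀] [Module A M] [SMulCommClass A Aᵐᵒᵖ M₀]
    [SMulCommClass A Aᵐᵒᵖ M] (nabla : UnivLeftConnection 𝕜 A F) (D : M₀ →+ M)
    (hD : ∀ (c : 𝕜) (x : M₀), D (MulOpposite.op (algebraMap 𝕜 A c) • x) =
      MulOpposite.op (algebraMap 𝕜 A c) • D x)
    (b : A) (hb : ∀ x, D (b • x) = b • D x) (y : BTensor A M₀ F) :
    nabla.twist D hD (b • y) = b • nabla.twist D hD y := by
  have key : ∀ (θ : BTensor A (UnivForm 𝕜 A) F) (x : M₀),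
      formAct D hD θ (b • x) = b • formAct D hD θ x := by
    intro θ x
    induction θ using BTensor.induction_on with
    | h0 => simp
    | ht ω f =>
      rw [formAct_tmul, formAct_tmul, UnivForm.actRight_comm D hD _ hb, BTensor.left_smul_tmul]
    | ha s t hs ht => simp only [smul_add, map_add, AddMonoidHom.add_apply, hs, ht]
  induction y using BTensor.induction_on with
  | h0 => rw [smul_zero, map_zero, smul_zero]
  | ht x f =>
    rw [BTensor.left_smul_tmul, twist_tmul, twist_tmul, smul_add, key, hb, BTensor.left_smul_tmul]
  | ha s t hs ht => simp only [smul_add, map_add, hs, ht]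

end UnivLeftConnection

end Twist

/-! ### The conjugate module and the conjugate connection -/

/-- The conjugate `Ē` of a right module `E`: the left module with `a • v̄ = conj (v · a*)`. -/
def ConjModule (E : Type u₂) : Type u₂ := E

namespace ConjModule

variable {E : Type u₂} [AddCommGroup E] [Module Aᵐᵒᵖ E]

instance : AddCommGroup (ConjModule E) := inferInstanceAs (AddCommGroup E)

/-- The map `v ↦ v̄`. -/
def bar : E ≃+ ConjModule E := AddEquiv.refl E

instance [StarRing A] : Module A (ConjModule E) where
  smul a v := bar (MulOpposite.op (star a) • bar.symm v)
  one_smul v := by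
    change MulOpposite.op (star (1 : A)) • bar.symm v = bar.symm v
    rw [star_one, MulOpposite.op_one, one_smul]
  mul_smul a b v := by
    change MulOpposite.op (star (a * b)) • bar.symm v =
      MulOpposite.op (star a) • MulOpposite.op (star b) • bar.symm v
    rw [star_mul, MulOpposite.op_mul, mul_smul]
  smul_zero a := by
    change MulOpposite.op (star a) • (0 : E) = 0
    exact smul_zero _
  smul_add a v w := by
    change MulOpposite.op (star a) • (bar.symm v + bar.symm w) =
      MulOpposite.op (star a) • bar.symm v + MulOpposite.op (star a) • bar.symm w
    exact smul_add _ _ _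
  add_smul a b v := by
    change MulOpposite.op (star (a + b)) • bar.symm v =
      MulOpposite.op (star a) • bar.symm v + MulOpposite.op (star b) • bar.symm v
    rw [star_add, MulOpposite.op_add, add_smul]
  zero_smul v := by
    change MulOpposite.op (star (0 : A)) • bar.symm v = (0 : E)
    rw [star_zero, MulOpposite.op_zero, zero_smul]

theorem smul_bar [StarRing A] (a : A) (v : E) :
    a • bar v = bar (MulOpposite.op (star a) • v) := rfl

end ConjModule

namespace UnivConnection

open ConjModule

variable [StarRing A] [StarModule 𝕜 A] {E : Type u₂} [AddCommGroup E] [Module Aᵐᵒᵖ E]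

/-- The map `E ⊗ Ω¹(A) → Ω¹(A) ⊗ Ē`, `v ⊗ ω ↦ ω* ⊗ v̄`. -/
def conjForm : BTensor A E (UnivForm 𝕜 A) →+ BTensor A (UnivForm 𝕜 A) (ConjModule E) :=
  BTensor.lift (AddMonoidHom.mk' (fun v => AddMonoidHom.mk'
      (fun ω => BTensor.tmul A (UnivForm.starHom ω) (bar v))
      (fun ω η => by rw [map_add, BTensor.add_tmul]))
      (fun v w => AddMonoidHom.ext fun ω => by
        change BTensor.tmul A (UnivForm.starHom ω) (bar (v + w)) =
          BTensor.tmul A (UnivForm.starHom ω) (bar v) + BTensor.tmul A (UnivForm.starHom ω) (bar w)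
        rw [map_add, BTensor.tmul_add]))
    (fun v a ω => by
      change BTensor.tmul A (UnivForm.starHom ω) (bar (MulOpposite.op a • v)) =
        BTensor.tmul A (UnivForm.starHom (a • ω)) (bar v)
      rw [UnivForm.starHom_smul, BTensor.smul_tmul, smul_bar, star_star])

theorem conjForm_tmul (v : E) (ω : UnivForm 𝕜 A) :
    conjForm (BTensor.tmul A v ω) = BTensor.tmul A (UnivForm.starHom ω) (bar v) := rfl

theorem conjForm_op_smul (a : A) (θ : BTensor A E (UnivForm 𝕜 A)) :
    conjForm (MulOpposite.op a • θ) = star a • conjForm θ := by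
  induction θ using BTensor.induction_on with
  | h0 => simp
  | ht v ω =>
    rw [BTensor.op_smul_tmul, conjForm_tmul, conjForm_tmul, UnivForm.starHom_op_smul,
      BTensor.left_smul_tmul]
  | ha x y hx hy => simp only [smul_add, map_add, hx, hy]

/-- The conjugate left connection on `Ē`: if `∇ v = ∑ wᵢ ⊗ ωᵢ` then `∇̄ v̄ = - ∑ ωᵢ* ⊗ w̄ᵢ`. The
sign comes from `(δ a)* = - δ (a*)`; thus `w ⊗ a δ(b)` is sent to `δ(b*) a* ⊗ w̄`. -/
def conjugate (nabla : UnivConnection 𝕜 A E) : UnivLeftConnection 𝕜 A (ConjModule E) where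
  toHom := -(conjForm.comp (nabla.toHom.comp bar.symm.toAddMonoidHom))
  leibniz a f := by
    obtain ⟨v, rfl⟩ := (bar (E := E)).surjective f
    change -(conjForm (nabla.toHom (MulOpposite.op (star a) • v))) =
      a • -(conjForm (nabla.toHom v)) + BTensor.tmul A (UnivForm.δ 𝕜 a) (bar v)
    rw [nabla.leibniz, map_add, conjForm_op_smul, conjForm_tmul, UnivForm.starHom_δ, star_star,
      smul_neg, neg_add]
    have h : BTensor.tmul A (-UnivForm.δ 𝕜 a) (bar v) = -BTensor.tmul A (UnivForm.δ 𝕜 a) (bar v) :=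
      DFunLike.congr_fun (map_neg (BTensor.mk A (UnivForm 𝕜 A) (ConjModule E))
        (UnivForm.δ 𝕜 a)) (bar v)
    rw [h, neg_neg]

theorem conjugate_bar (nabla : UnivConnection 𝕜 A E) (v : E) :
    nabla.conjugate.toHom (bar v) = - conjForm (nabla.toHom v) := rfl

end UnivConnection

end Forms

/-! ## Real spectral triples -/

section Triples

universe u₀ u₁ u₂ u₃

/-- A real spectral triple `(A, H, D; J)` over an involutive unital algebra `A` with ground field
`𝕜 = ℝ` or `ℂ`. The first-order condition is not required. -/
structure RealSpectralTriple (𝕜 : Type u₀) (A : Type u₁) (H : Type u₂) [RCLike 𝕜] [Ring A]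
    [StarRing A] [Algebra 𝕜 A] [StarModule 𝕜 A] [NormedAddCommGroup H] [InnerProductSpace ℂ H]
    [CompleteSpace H] where
  /-- the representation of `A` by bounded operators -/
  π : A →+* (H →L[ℂ] H)
  π_algebraMap : ∀ c : 𝕜, π (algebraMap 𝕜 A c) = RCLike.map 𝕜 ℂ c • ContinuousLinearMap.id ℂ H
  π_star : ∀ a : A, π (star a) = ContinuousLinearMap.adjoint (π a)
  /-- the Dirac operator, an unbounded operator -/
  D : H →ₗ.[ℂ] H
  selfAdjoint : IsSelfAdjoint D
  compactResolvent : ∀ z : ℂ, z.im ≠ 0 → ∃ R : H →L[ℂ] H, IsCompactOperator R ∧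
    (∀ x : H, ∃ hx : R x ∈ D.domain, D ⟨R x, hx⟩ - z • R x = x) ∧
    ∀ x : D.domain, R (D x - z • (x : H)) = x
  π_mem_domain : ∀ (a : A) (x : H), x ∈ D.domain → π a x ∈ D.domain
  bounded_commutator : ∀ a : A, ∃ C : ℝ, ∀ x : D.domain,
    ‖D ⟨π a x, π_mem_domain a x x.2⟩ - π a (D x)‖ ≤ C * ‖(x : H)‖
  /-- the real structure, an antiunitary operator -/
  J : H ≃ₗᵢ⋆[ℂ] H
  /-- the sign in `J² = ε` -/
  ε : ℤˣ
  /-- the sign in `J D = ε' D J` -/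
  ε' : ℤˣ
  J_sq : ∀ x : H, J (J x) = ε • x
  J_mem_domain : ∀ x : H, x ∈ D.domain → J x ∈ D.domain
  J_D : ∀ x : D.domain, J (D x) = ε' • D ⟨J x, J_mem_domain x x.2⟩
  /-- `[a, J b J⁻¹] = 0` -/
  commutant : ∀ (a b : A) (x : H), π a (J (π b (J.symm x))) = J (π b (J.symm (π a x)))

namespace RealSpectralTriple

variable {𝕜 : Type u₀} {A : Type u₁} {H : Type u₂} [RCLike 𝕜] [Ring A]
    [StarRing A] [Algebra 𝕜 A] [StarModule 𝕜 A] [NormedAddCommGroup H] [InnerProductSpace ℂ H]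
    [CompleteSpace H] (S : RealSpectralTriple 𝕜 A H)

theorem J_symm_apply (x : H) : S.J.symm x = S.ε • S.J x := by
  apply S.J.injective
  have h : S.J (S.ε • S.J x) = S.ε • S.J (S.J x) := by
    rcases Int.units_eq_one_or S.ε with h | h <;> simp [h]
  rw [h, S.J_sq, smul_smul, Int.units_mul_self, one_smul, LinearIsometryEquiv.apply_symm_apply]

theorem J_symm_mem_domain (x : H) (hx : x ∈ S.D.domain) : S.J.symm x ∈ S.D.domain := by
  rw [J_symm_apply]
  rcases Int.units_eq_one_or S.ε with h | h
  · simpa [h] using S.J_mem_domain x hx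
  · simpa [h] using S.J_mem_domain x hx

/-- The Hilbert space `H` as an `A`-bimodule: `a • ξ = π(a) ξ` and `ξ b = J π(b)* J⁻¹ ξ`. -/
def Space (_S : RealSpectralTriple 𝕜 A H) : Type u₂ := H

/-- The domain of `D` as an `A`-bimodule. -/
def Dom : Type u₂ := S.D.domain

instance : AddCommGroup S.Space := inferInstanceAs (AddCommGroup H)
instance : Module ℂ S.Space := inferInstanceAs (Module ℂ H)
instance : AddCommGroup S.Dom := inferInstanceAs (AddCommGroup S.D.domain)

/-- A vector of `H`, as an element of the bimodule. -/
def vec : H ≃+ S.Space := AddEquiv.refl H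

/-- The inclusion of the domain of `D`. -/
def incl : S.Dom →+ S.Space := S.D.domain.subtype.toAddMonoidHom

theorem incl_injective : Function.Injective S.incl := Subtype.val_injective

instance : Module A S.Space where
  smul a x := S.vec (S.π a (S.vec.symm x))
  one_smul x := by
    change S.π 1 (S.vec.symm x) = S.vec.symm x
    rw [map_one]; rfl
  mul_smul a b x := by
    change S.π (a * b) (S.vec.symm x) = S.π a (S.π b (S.vec.symm x))
    rw [map_mul]; rfl
  smul_zero a := by
    change S.π a 0 = 0
    exact map_zero _
  smul_add a x y := by
    change S.π a (S.vec.symm x + S.vec.symm y) = S.π a (S.vec.symm x) + S.π a (S.vec.symm y)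
    exact map_add _ _ _
  add_smul a b x := by
    change S.π (a + b) (S.vec.symm x) = S.π a (S.vec.symm x) + S.π b (S.vec.symm x)
    rw [map_add]; rfl
  zero_smul x := by
    change S.π 0 (S.vec.symm x) = 0
    rw [map_zero]; rfl

instance : Module Aᵐᵒᵖ S.Space where
  smul b x := S.vec (S.J (S.π (star b.unop) (S.J.symm (S.vec.symm x))))
  one_smul x := by
    change S.J (S.π (star (1 : A)) (S.J.symm (S.vec.symm x))) = S.vec.symm x
    rw [star_one, map_one]
    exact S.J.apply_symm_apply _
  mul_smul a b x := by
    change S.J (S.π (star (b.unop * a.unop)) (S.J.symm (S.vec.symm x))) =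
      S.J (S.π (star a.unop) (S.J.symm (S.J (S.π (star b.unop) (S.J.symm (S.vec.symm x))))))
    rw [star_mul, map_mul, S.J.symm_apply_apply]; rfl
  smul_zero a := by
    change S.J (S.π (star a.unop) (S.J.symm 0)) = 0
    simp
  smul_add a x y := by
    change S.J (S.π (star a.unop) (S.J.symm (S.vec.symm x + S.vec.symm y))) =
      S.J (S.π (star a.unop) (S.J.symm (S.vec.symm x))) +
      S.J (S.π (star a.unop) (S.J.symm (S.vec.symm y)))
    simp
  add_smul a b x := by
    change S.J (S.π (star (a.unop + b.unop)) (S.J.symm (S.vec.symm x))) =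
      S.J (S.π (star a.unop) (S.J.symm (S.vec.symm x))) +
      S.J (S.π (star b.unop) (S.J.symm (S.vec.symm x)))
    rw [star_add, map_add]
    exact map_add S.J.toLinearEquiv _ _
  zero_smul x := by
    change S.J (S.π (star (0 : A)) (S.J.symm (S.vec.symm x))) = 0
    simp

theorem smul_vec (a : A) (x : H) : a • S.vec x = S.vec (S.π a x) := rfl

theorem op_smul_vec (b : A) (x : H) :
    MulOpposite.op b • S.vec x = S.vec (S.J (S.π (star b) (S.J.symm x))) := rfl

instance : SMulCommClass A Aᵐᵒᵖ S.Space where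
  smul_comm a b x := S.commutant a (star b.unop) (S.vec.symm x)

instance : SMulCommClass A ℂ S.Space where
  smul_comm a z x := map_smul (S.π a) z (S.vec.symm x)

instance : SMulCommClass ℂ Aᵐᵒᵖ S.Space where
  smul_comm z b x := by
    have e : ∀ y : H, z • S.J (S.π (star b.unop) (S.J.symm y)) =
        S.J (S.π (star b.unop) (S.J.symm (z • y))) := fun y => by
      rw [LinearIsometryEquiv.map_smulₛₗ S.J.symm, map_smul, LinearIsometryEquiv.map_smulₛₗ S.J,
        starRingEnd_self_apply]
    exact e (S.vec.symm x)

theorem smul_mem_domain (a : A) (x : S.Dom) : (a • S.incl x : S.Space) ∈ S.D.domain :=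
  S.π_mem_domain a _ x.2

theorem op_smul_mem_domain (b : Aᵐᵒᵖ) (x : S.Dom) : (b • S.incl x : S.Space) ∈ S.D.domain :=
  S.J_mem_domain _ (S.π_mem_domain _ _ (S.J_symm_mem_domain _ x.2))

instance : Module A S.Dom where
  smul a x := ⟨_, S.smul_mem_domain a x⟩
  one_smul x := S.incl_injective (one_smul A (S.incl x))
  mul_smul a b x := S.incl_injective (mul_smul a b (S.incl x))
  smul_zero a := S.incl_injective (smul_zero a)
  smul_add a x y := S.incl_injective (smul_add a (S.incl x) (S.incl y))
  add_smul a b x := S.incl_injective (add_smul a b (S.incl x))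
  zero_smul x := S.incl_injective (zero_smul A (S.incl x))

instance : Module Aᵐᵒᵖ S.Dom where
  smul b x := ⟨_, S.op_smul_mem_domain b x⟩
  one_smul x := S.incl_injective (one_smul Aᵐᵒᵖ (S.incl x))
  mul_smul a b x := S.incl_injective (mul_smul a b (S.incl x))
  smul_zero a := S.incl_injective (smul_zero a)
  smul_add a x y := S.incl_injective (smul_add a (S.incl x) (S.incl y))
  add_smul a b x := S.incl_injective (add_smul a b (S.incl x))
  zero_smul x := S.incl_injective (zero_smul Aᵐᵒᵖ (S.incl x))

theorem incl_smul (a : A) (x : S.Dom) : S.incl (a • x) = a • S.incl x := rfl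

theorem incl_op_smul (a : A) (x : S.Dom) :
    S.incl (MulOpposite.op a • x) = MulOpposite.op a • S.incl x := rfl

instance : SMulCommClass A Aᵐᵒᵖ S.Dom where
  smul_comm a b x := S.incl_injective (smul_comm a b (S.incl x))

/-- The Dirac operator as a map from its domain to `H`. -/
def dirac : S.Dom →+ S.Space := S.D.toFun.toAddMonoidHom

theorem dirac_eq (x : H) (hx : x ∈ S.D.domain) : S.dirac ⟨x, hx⟩ = S.vec (S.D ⟨x, hx⟩) := rfl

theorem algebraMap_smul_space (c : 𝕜) (x : S.Space) :
    algebraMap 𝕜 A c • x = RCLike.map 𝕜 ℂ c • x := by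
  change S.π (algebraMap 𝕜 A c) (S.vec.symm x) = _
  rw [S.π_algebraMap]
  rfl

theorem op_algebraMap_smul_space (c : 𝕜) (x : S.Space) :
    MulOpposite.op (algebraMap 𝕜 A c) • x = RCLike.map 𝕜 ℂ c • x := by
  have e : ∀ y : H, S.J (S.π (star (algebraMap 𝕜 A c)) (S.J.symm y)) =
      RCLike.map 𝕜 ℂ c • y := fun y => by
    have h : RCLike.map 𝕜 ℂ (star c) = star (RCLike.map 𝕜 ℂ c) := by
      simp
    rw [← algebraMap_star_comm, S.π_algebraMap, h]
    generalize RCLike.map 𝕜 ℂ c = z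
    change S.J (star z • S.J.symm y) = z • y
    rw [LinearIsometryEquiv.map_smulₛₗ S.J, starRingEnd_apply, star_star, S.J.apply_symm_apply]
  exact e (S.vec.symm x)

theorem dirac_smul (c : 𝕜) (x : S.Dom) :
    S.dirac (algebraMap 𝕜 A c • x) = algebraMap 𝕜 A c • S.dirac x := by
  rw [algebraMap_smul_space]
  have h : algebraMap 𝕜 A c • x = (RCLike.map 𝕜 ℂ c • (show S.D.domain from x) : S.D.domain) :=
    S.incl_injective (S.algebraMap_smul_space c (S.incl x))
  rw [h]
  exact S.D.map_smul _ _

theorem dirac_op_smul (c : 𝕜) (x : S.Dom) :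
    S.dirac (MulOpposite.op (algebraMap 𝕜 A c) • x) =
      MulOpposite.op (algebraMap 𝕜 A c) • S.dirac x := by
  rw [op_algebraMap_smul_space]
  have h : MulOpposite.op (algebraMap 𝕜 A c) • x =
      (RCLike.map 𝕜 ℂ c • (show S.D.domain from x) : S.D.domain) :=
    S.incl_injective (S.op_algebraMap_smul_space c (S.incl x))
  rw [h]
  exact S.D.map_smul _ _

end RealSpectralTriple

/-! ## Hermitian modules and hermitian connections -/

/-- A hermitian structure on the right `A`-module `E`: an `A`-valued inner product, antilinear in
the first variable, positive in the representation on `H`, such that `v ↦ (v|·)` is a bijection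
from `E` onto the dual module of `E`. -/
structure HermitianStructure {𝕜 : Type u₀} {A : Type u₁} {H : Type u₂} [RCLike 𝕜] [Ring A]
    [StarRing A] [Algebra 𝕜 A] [StarModule 𝕜 A] [NormedAddCommGroup H] [InnerProductSpace ℂ H]
    [CompleteSpace H] (S : RealSpectralTriple 𝕜 A H) (E : Type u₃) [AddCommGroup E] [Module 𝕜 E]
    [Module Aᵐᵒᵖ E] [IsScalarTower 𝕜 Aᵐᵒᵖ E] where
  form : E →+ E →+ A
  form_op_smul : ∀ (v w : E) (a : A), form v (MulOpposite.op a • w) = form v w * a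
  star_form : ∀ v w : E, star (form v w) = form w v
  form_nonneg : ∀ v : E, (S.π (form v v)).IsPositive
  nondegenerate : ∀ v : E, (∀ w : E, form v w = 0) → v = 0
  selfDual : ∀ φ : E →ₗ[Aᵐᵒᵖ] A, ∃ v : E, ∀ w : E, φ w = form v w

namespace HermitianStructure

variable {𝕜 : Type u₀} {A : Type u₁} {H : Type u₂} [RCLike 𝕜] [Ring A]
    [StarRing A] [Algebra 𝕜 A] [StarModule 𝕜 A] [NormedAddCommGroup H] [InnerProductSpace ℂ H]
    [CompleteSpace H] {S : RealSpectralTriple 𝕜 A H} {E : Type u₃} [AddCommGroup E] [Module 𝕜 E]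
    [Module Aᵐᵒᵖ E] [IsScalarTower 𝕜 Aᵐᵒᵖ E] (h : HermitianStructure S E)

theorem op_smul_form (v w : E) (a : A) :
    h.form (MulOpposite.op a • v) w = star a * h.form v w := by
  rw [← h.star_form, h.form_op_smul, star_mul, h.star_form]

theorem ext_left {v v' : E} (hv : ∀ w, h.form v w = h.form v' w) : v = v' := by
  rw [← sub_eq_zero]
  exact h.nondegenerate _ fun w => by rw [map_sub, AddMonoidHom.sub_apply, hv, sub_self]

theorem form_smul (c : 𝕜) (v w : E) : h.form v (c • w) = h.form v w * algebraMap 𝕜 A c := by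
  have e : c • w = MulOpposite.op (algebraMap 𝕜 A c) • w := by
    rw [← one_smul Aᵐᵒᵖ w, ← smul_assoc, one_smul, Algebra.algebraMap_eq_smul_one,
      MulOpposite.op_smul, MulOpposite.op_one]
  rw [e, h.form_op_smul]

theorem smul_form (c : 𝕜) (v w : E) :
    h.form (c • v) w = algebraMap 𝕜 A (star c) * h.form v w := by
  rw [← h.star_form, form_smul, star_mul, h.star_form, ← algebraMap_star_comm]

/-- The algebra `End_A(E)`, with the involution given by the hermitian structure. -/
def EndAlg (_h : HermitianStructure S E) : Type u₃ := Module.End Aᵐᵒᵖ E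

instance : Ring h.EndAlg := inferInstanceAs (Ring (Module.End Aᵐᵒᵖ E))
instance : Algebra 𝕜 h.EndAlg := inferInstanceAs (Algebra 𝕜 (Module.End Aᵐᵒᵖ E))

/-- The endomorphism of `E` underlying an element of `End_A(E)`. -/
def toEnd : h.EndAlg ≃ₐ[𝕜] Module.End Aᵐᵒᵖ E := AlgEquiv.refl

theorem exists_adjoint (T : Module.End Aᵐᵒᵖ E) (v : E) :
    ∃ v' : E, ∀ w : E, h.form v (T w) = h.form v' w :=
  h.selfDual
    { toFun := fun w => h.form v (T w)
      map_add' := fun w w' => by rw [map_add, map_add]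
      map_smul' := fun a w => by
        rw [map_smul, ← MulOpposite.op_unop a, h.form_op_smul]; rfl }

/-- The vector `T* v`, determined by `(T* v | w) = (v | T w)`. -/
def adjointFun (T : Module.End Aᵐᵒᵖ E) (v : E) : E := (h.exists_adjoint T v).choose

theorem adjointFun_form (T : Module.End Aᵐᵒᵖ E) (v w : E) :
    h.form (h.adjointFun T v) w = h.form v (T w) :=
  ((h.exists_adjoint T v).choose_spec w).symm

/-- The adjoint of an endomorphism: `(T* v | w) = (v | T w)`. -/
def adjoint (T : Module.End Aᵐᵒᵖ E) : Module.End Aᵐᵒᵖ E where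
  toFun v := h.adjointFun T v
  map_add' v v' := h.ext_left fun w => by
    simp only [map_add, AddMonoidHom.add_apply, adjointFun_form]
  map_smul' a v := h.ext_left fun w => by
    rw [RingHom.id_apply, adjointFun_form, ← MulOpposite.op_unop a, h.op_smul_form,
      h.op_smul_form, adjointFun_form]

theorem adjoint_form (T : Module.End Aᵐᵒᵖ E) (v w : E) :
    h.form (h.adjoint T v) w = h.form v (T w) := h.adjointFun_form T v w

theorem form_adjoint (T : Module.End Aᵐᵒᵖ E) (v w : E) :
    h.form v (h.adjoint T w) = h.form (T v) w := by
  rw [← h.star_form, adjoint_form, h.star_form]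

theorem adjoint_adjoint (T : Module.End Aᵐᵒᵖ E) : h.adjoint (h.adjoint T) = T :=
  LinearMap.ext fun v => h.ext_left fun w => by rw [adjoint_form, form_adjoint]

theorem adjoint_mul (T U : Module.End Aᵐᵒᵖ E) :
    h.adjoint (T * U) = h.adjoint U * h.adjoint T :=
  LinearMap.ext fun v => h.ext_left fun w => by
    rw [Module.End.mul_apply, adjoint_form, adjoint_form, adjoint_form, Module.End.mul_apply]

theorem adjoint_add (T U : Module.End Aᵐᵒᵖ E) :
    h.adjoint (T + U) = h.adjoint T + h.adjoint U :=
  LinearMap.ext fun v => h.ext_left fun w => by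
    rw [LinearMap.add_apply, map_add, AddMonoidHom.add_apply, adjoint_form, adjoint_form,
      adjoint_form, LinearMap.add_apply, map_add]

theorem adjoint_smul (c : 𝕜) (T : Module.End Aᵐᵒᵖ E) :
    h.adjoint (c • T) = star c • h.adjoint T :=
  LinearMap.ext fun v => h.ext_left fun w => by
    rw [LinearMap.smul_apply, adjoint_form, smul_form, star_star, adjoint_form,
      LinearMap.smul_apply, form_smul, Algebra.commutes]

instance : StarRing h.EndAlg where
  star T := h.adjoint T
  star_involutive T := h.adjoint_adjoint T
  star_mul T U := h.adjoint_mul T U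
  star_add T U := h.adjoint_add T U

instance : StarModule 𝕜 h.EndAlg where
  star_smul c T := h.adjoint_smul c T

theorem star_form_apply (T : h.EndAlg) (v w : E) :
    h.form (h.toEnd (star T) v) w = h.form v (h.toEnd T w) := h.adjoint_form T v w

/-- The pairing `(v | w ⊗ ω) = (v|w) ω` of `E` with `E ⊗_A Ω¹(A)`. -/
def formPair : E →+ BTensor A E (UnivForm 𝕜 A) →+ UnivForm 𝕜 A :=
  AddMonoidHom.mk' (fun v => BTensor.lift
      (AddMonoidHom.mk' (fun w => DistribSMul.toAddMonoidHom (UnivForm 𝕜 A) (h.form v w))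
        (fun w w' => AddMonoidHom.ext fun ω => by simp [add_smul]))
      (fun w a ω => by simp [h.form_op_smul, mul_smul]))
    (fun v v' => BTensor.hom_ext fun w ω => by simp [add_smul])

theorem formPair_tmul (v w : E) (ω : UnivForm 𝕜 A) :
    h.formPair v (BTensor.tmul A w ω) = h.form v w • ω := by
  simp [formPair]

end HermitianStructure

variable {𝕜 : Type u₀} {A : Type u₁} {H : Type u₂} [RCLike 𝕜] [Ring A]
    [StarRing A] [Algebra 𝕜 A] [StarModule 𝕜 A] [NormedAddCommGroup H] [InnerProductSpace ℂ H]
    [CompleteSpace H] {S : RealSpectralTriple 𝕜 A H} {E : Type u₃} [AddCommGroup E] [Module 𝕜 E]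
    [Module Aᵐᵒᵖ E] [IsScalarTower 𝕜 Aᵐᵒᵖ E]

/-- A hermitian connection: `(v | ∇ w) - (∇ v | w) = δ (v|w)`, where
`(v ⊗ ω | w) = ω* (v|w) = (w | v ⊗ ω)*`. -/
def UnivConnection.IsHermitian (nabla : UnivConnection 𝕜 A E) (h : HermitianStructure S E) : Prop :=
  ∀ v w : E, h.formPair v (nabla.toHom w) - UnivForm.starHom (h.formPair w (nabla.toHom v)) =
    UnivForm.δ 𝕜 (h.form v w)

/-! ## The twisted Dirac operators -/

namespace RealSpectralTriple

variable (S) (E)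

/-- The space `E ⊗_A H ⊗_A Ē`. -/
abbrev TwistSpace : Type (max u₂ u₃) :=
  BTensor A (BTensor A E S.Space) (ConjModule E)

/-- The domain `E ⊗_A Dom(D) ⊗_A Ē`. -/
abbrev TwistDom : Type (max u₂ u₃) :=
  BTensor A (BTensor A E S.Dom) (ConjModule E)

variable {E}

/-- The elementary tensor `v₁ ⊗ ξ ⊗ v̄₂`. -/
def elem (v₁ : E) (ξ : H) (v₂ : E) : S.TwistSpace E :=
  BTensor.tmul A (BTensor.tmul A v₁ (S.vec ξ)) (ConjModule.bar v₂)

variable (E) in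
/-- The natural map `E ⊗_A Dom(D) ⊗_A Ē → E ⊗_A H ⊗_A Ē`. -/
def twistIncl : S.TwistDom E →+ S.TwistSpace E :=
  BTensor.map (BTensor.map (AddMonoidHom.id E) S.incl (fun _ _ => rfl) S.incl_smul)
    (AddMonoidHom.id (ConjModule E))
    (fun a x => by
      induction x using BTensor.induction_on with
      | h0 => rw [smul_zero, map_zero, smul_zero]
      | ht v x => rfl
      | ha x y hx hy => simp only [smul_add, map_add, hx, hy])
    (fun _ _ => rfl)

/-- The operator `(1 ⊗_∇ D) ⊗_∇̄ 1` on `(E ⊗_A Dom(D)) ⊗_A Ē`. -/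
def twistLeftRight (nabla : UnivConnection 𝕜 A E) : S.TwistDom E →+ S.TwistSpace E :=
  nabla.conjugate.twist (nabla.twist S.dirac S.dirac_smul)
    (fun c x => nabla.twist_comm_op S.dirac S.dirac_smul _ (S.dirac_op_smul c) x)

/-- The operator `1 ⊗_∇ (D ⊗_∇̄ 1)` on `E ⊗_A (Dom(D) ⊗_A Ē)`. -/
def twistRightLeft (nabla : UnivConnection 𝕜 A E) :
    BTensor A E (BTensor A S.Dom (ConjModule E)) →+
      BTensor A E (BTensor A S.Space (ConjModule E)) :=
  nabla.twist (nabla.conjugate.twist S.dirac S.dirac_op_smul)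
    (fun c x => nabla.conjugate.twist_comm S.dirac S.dirac_op_smul _ (S.dirac_smul c) x)

end RealSpectralTriple

end Triples
end

/-!
# Morita equivalence of real spectral triples without the first-order condition

*Associativity.* Twisting on the left by `∇` adds to `v ⊗ D ξ` a term built from commutators of `D`
with left multiplications, and twisting on the right by the conjugate connection adds commutators
with right multiplications. In `(1 ⊗_∇ D) ⊗_∇̄ 1` the mixed term is a commutator with a right
multiplication of a commutator with a left multiplication; without the first-order condition it does
not vanish, but left and right multiplications commute, so the two commutators may be taken in either
order (`UnivConnection.assoc_twist_twist`).

*Inner product.* Self-duality and projectivity give a frame: vectors `eᵢ`, `fᵢ` with `v = ∑ eᵢ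
(fᵢ|v)` (`RealSpectralTriple.exists_frame`). It writes every tensor as `∑ eᵢ ⊗ ξᵢₖ ⊗ ēₖ` and reduces
positivity to that of a Gram form: the block operator of the left multiplications by `(eᵢ|eⱼ)` and
that of the right multiplications by `(eₗ|eₖ)` commute, so it is enough that each of them is
positive. The axioms only give positivity of the block operator on vectors `(aᵢ ξ)`, where it
becomes `⟪ξ, (v|v) ξ⟫` with `v = ∑ eᵢ aᵢ`. This suffices: real polynomials in the block operator are
matrices over `A`, so they map vectors with a single nonzero entry to vectors `(aᵢ ξ)`, and they
approximate the negative part of the operator, which therefore vanishes (`blockOp_nonneg`).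
Definiteness and completeness follow from the frame as well, since `ξ ↦ v ⊗ ξ ⊗ w̄` is bounded, with
adjoint `v₁ ⊗ ξ ⊗ v̄₂ ↦ (v|v₁) ξ (v₂|w)`.

*The Dirac operator.* Symmetry of the twisted operator is a formal consequence of hermiticity of the
connection (`HermitianStructure.leftPairing_twist`, `HermitianStructure.rightPairing_twist`);
symmetry and density of the domain also make the operator well defined on the image of
`E ⊗_A Dom(D) ⊗_A Ē`. Every map `ξ ↦ v ⊗ ξ ⊗ w̄` intertwines `D` and the twisted operator up to a
bounded term, and finitely many products of such maps with adjoints of such maps add up to the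
identity. Hence self-adjointness, compactness of the resolvent and boundedness of the commutators
are inherited from `D` (`LinearPMap.isSelfAdjoint_of_frame`,
`LinearPMap.isCompactOperator_of_frame`, `LinearPMap.bounded_commutator_of_frame`).

*The real structure.* Exchanging the outer factors turns a left twist into a right twist, so
compatibility of the real structure with the Dirac operator is again the associativity statement
(`RealSpectralTriple.twistJ_twistLeftRight`). The real structure carries operators on the left factor
to operators on the right factor, which commute with the former.
-/

/-! ### Left and right representations of one-forms -/

namespace UnivForm

section Bimodule

variable {𝕜 A M₀ M : Type*} [RCLike 𝕜] [Ring A] [Algebra 𝕜 A] [AddCommGroup M₀] [AddCommGroup M]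
    [Module A M₀] [Module A M] [Module Aᵐᵒᵖ M₀] [Module Aᵐᵒᵖ M] [SMulCommClass A Aᵐᵒᵖ M₀]
    [SMulCommClass A Aᵐᵒᵖ M] (D : M₀ →+ M)
    (hD : ∀ (c : 𝕜) (x : M₀), D (algebraMap 𝕜 A c • x) = algebraMap 𝕜 A c • D x)
    (hD' : ∀ (c : 𝕜) (x : M₀), D (MulOpposite.op (algebraMap 𝕜 A c) • x) =
      MulOpposite.op (algebraMap 𝕜 A c) • D x)

include hD' in
theorem commTensorLeft_op_algebraMap (t : A ⊗[𝕜] A) (c : 𝕜) (x : M₀) :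
    commTensorLeft D hD t (MulOpposite.op (algebraMap 𝕜 A c) • x) =
      MulOpposite.op (algebraMap 𝕜 A c) • commTensorLeft D hD t x := by
  induction t using TensorProduct.induction_on with
  | zero => simp
  | tmul a b => simp only [commTensorLeft_tmul, smul_comm _ (MulOpposite.op _), hD', smul_sub]
  | add s t hs ht => simp only [map_add, AddMonoidHom.add_apply, smul_add, hs, ht]

include hD in
theorem commTensorRight_algebraMap (t : A ⊗[𝕜] A) (c : 𝕜) (x : M₀) :
    commTensorRight D hD' t (algebraMap 𝕜 A c • x) =
      algebraMap 𝕜 A c • commTensorRight D hD' t x := by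
  induction t using TensorProduct.induction_on with
  | zero => simp
  | tmul a b => simp only [commTensorRight_tmul, ← smul_comm (algebraMap 𝕜 A c), hD, smul_sub]
  | add s t hs ht => simp only [map_add, AddMonoidHom.add_apply, smul_add, hs, ht]

theorem commTensorLeft_commTensorRight (s t : A ⊗[𝕜] A) (x : M₀) :
    commTensorLeft (commTensorRight D hD' t) (commTensorRight_algebraMap D hD hD' t) s x =
      commTensorRight (commTensorLeft D hD s) (commTensorLeft_op_algebraMap D hD hD' s) t x := by
  induction s using TensorProduct.induction_on with
  | zero =>
    have h (y : M₀) : commTensorLeft D hD (0 : A ⊗[𝕜] A) y = 0 := by simp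
    rw [map_zero, AddMonoidHom.zero_apply]
    induction t using TensorProduct.induction_on with
    | zero => simp
    | tmul a b => simp [commTensorRight_tmul]
    | add t t' ht ht' => rw [map_add, AddMonoidHom.add_apply, ← ht, ← ht', add_zero]
  | tmul a b =>
    rw [commTensorLeft_tmul]
    induction t using TensorProduct.induction_on with
    | zero => simp
    | tmul a' b' =>
      simp only [commTensorLeft_tmul, commTensorRight_tmul, smul_sub, ← smul_comm a, ← smul_comm b]
      abel
    | add t t' ht ht' =>
      simp only [map_add, AddMonoidHom.add_apply, ← ht, ← ht', smul_sub, smul_add]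
      abel
  | add s s' hs hs' =>
    rw [map_add, AddMonoidHom.add_apply, hs, hs']
    clear hs hs'
    induction t using TensorProduct.induction_on with
    | zero => simp
    | tmul a b =>
      simp only [commTensorRight_tmul, map_add, AddMonoidHom.add_apply, smul_add]
      abel
    | add t t' ht ht' =>
      simp only [map_add, AddMonoidHom.add_apply] at ht ht' ⊢
      rw [← ht, ← ht']
      abel

/-- The left and the right representations of one-forms commute, as double commutators do: both
sides are sums of `a [[D, b], b'°] (ξ a')`. This is why the two twists of `D` can be formed in either
order without any first-order condition. -/
theorem actLeft_actRight (ω η : UnivForm 𝕜 A) (x : M₀) :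
    actLeft (actRight D hD' η) (commTensorRight_algebraMap D hD hD' η.val) ω x =
      actRight (actLeft D hD ω) (commTensorLeft_op_algebraMap D hD hD' ω.val) η x :=
  commTensorLeft_commTensorRight D hD hD' ω.val η.val x

end Bimodule

section Naturality

variable {𝕜 A M₀ M M' : Type*} [RCLike 𝕜] [Ring A] [Algebra 𝕜 A] [AddCommGroup M₀]
    [AddCommGroup M] [AddCommGroup M']

section Left

variable [Module A M₀] [Module A M] [Module A M'] {D₁ D₂ : M₀ →+ M} {D : M₀ →+ M'}
    (h₁ : ∀ (c : 𝕜) (x : M₀), D₁ (algebraMap 𝕜 A c • x) = algebraMap 𝕜 A c • D₁ x)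
    (h₂ : ∀ (c : 𝕜) (x : M₀), D₂ (algebraMap 𝕜 A c • x) = algebraMap 𝕜 A c • D₂ x)
    (h : ∀ (c : 𝕜) (x : M₀), D (algebraMap 𝕜 A c • x) = algebraMap 𝕜 A c • D x)

theorem actLeft_of_eq_comp {g : M →+ M'} (hg : ∀ (a : A) (x : M), g (a • x) = a • g x)
    (e : ∀ x, D x = g (D₁ x)) (ω : UnivForm 𝕜 A) (x : M₀) :
    actLeft D h ω x = g (actLeft D₁ h₁ ω x) := by
  change commTensorLeft D h ω.val x = g (commTensorLeft D₁ h₁ ω.val x)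
  induction ω.val using TensorProduct.induction_on with
  | zero => simp
  | tmul a b => simp only [commTensorLeft_tmul, e, ← hg, ← map_sub]
  | add s t hs ht => simp only [map_add, AddMonoidHom.add_apply, hs, ht]

theorem actLeft_of_eq_add {D : M₀ →+ M}
    (h : ∀ (c : 𝕜) (x : M₀), D (algebraMap 𝕜 A c • x) = algebraMap 𝕜 A c • D x)
    (e : ∀ x, D x = D₁ x + D₂ x) (ω : UnivForm 𝕜 A) (x : M₀) :
    actLeft D h ω x = actLeft D₁ h₁ ω x + actLeft D₂ h₂ ω x := by
  change commTensorLeft D h ω.val x = commTensorLeft D₁ h₁ ω.val x + commTensorLeft D₂ h₂ ω.val x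
  induction ω.val using TensorProduct.induction_on with
  | zero => simp
  | tmul a b => simp only [commTensorLeft_tmul, e, smul_add, smul_sub]; abel
  | add s t hs ht => simp only [map_add, AddMonoidHom.add_apply, hs, ht]; abel

theorem actLeft_of_eq_zero (e : ∀ x, D x = 0) (ω : UnivForm 𝕜 A) (x : M₀) :
    actLeft D h ω x = 0 := by
  change commTensorLeft D h ω.val x = 0
  induction ω.val using TensorProduct.induction_on with
  | zero => simp
  | tmul a b => simp only [commTensorLeft_tmul, e, smul_zero, sub_zero]
  | add s t hs ht => simp only [map_add, AddMonoidHom.add_apply, hs, ht, add_zero]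

end Left

section Right

variable [Module Aᵐᵒᵖ M₀] [Module Aᵐᵒᵖ M] [Module Aᵐᵒᵖ M'] {D₁ D₂ : M₀ →+ M} {D : M₀ →+ M'}
    (h₁ : ∀ (c : 𝕜) (x : M₀), D₁ (MulOpposite.op (algebraMap 𝕜 A c) • x) =
      MulOpposite.op (algebraMap 𝕜 A c) • D₁ x)
    (h₂ : ∀ (c : 𝕜) (x : M₀), D₂ (MulOpposite.op (algebraMap 𝕜 A c) • x) =
      MulOpposite.op (algebraMap 𝕜 A c) • D₂ x)
    (h : ∀ (c : 𝕜) (x : M₀), D (MulOpposite.op (algebraMap 𝕜 A c) • x) =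
      MulOpposite.op (algebraMap 𝕜 A c) • D x)

theorem actRight_of_eq_comp {g : M →+ M'}
    (hg : ∀ (a : A) (x : M), g (MulOpposite.op a • x) = MulOpposite.op a • g x)
    (e : ∀ x, D x = g (D₁ x)) (ω : UnivForm 𝕜 A) (x : M₀) :
    actRight D h ω x = g (actRight D₁ h₁ ω x) := by
  change commTensorRight D h ω.val x = g (commTensorRight D₁ h₁ ω.val x)
  induction ω.val using TensorProduct.induction_on with
  | zero => simp
  | tmul a b => simp only [commTensorRight_tmul, e, ← hg, ← map_sub]
  | add s t hs ht => simp only [map_add, AddMonoidHom.add_apply, hs, ht]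

theorem actRight_of_eq_add {D : M₀ →+ M}
    (h : ∀ (c : 𝕜) (x : M₀), D (MulOpposite.op (algebraMap 𝕜 A c) • x) =
      MulOpposite.op (algebraMap 𝕜 A c) • D x)
    (e : ∀ x, D x = D₁ x + D₂ x) (ω : UnivForm 𝕜 A) (x : M₀) :
    actRight D h ω x = actRight D₁ h₁ ω x + actRight D₂ h₂ ω x := by
  change commTensorRight D h ω.val x =
    commTensorRight D₁ h₁ ω.val x + commTensorRight D₂ h₂ ω.val x
  induction ω.val using TensorProduct.induction_on with
  | zero => simp
  | tmul a b => simp only [commTensorRight_tmul, e, smul_add]; abel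
  | add s t hs ht => simp only [map_add, AddMonoidHom.add_apply, hs, ht]; abel

theorem actRight_of_eq_zero (e : ∀ x, D x = 0) (ω : UnivForm 𝕜 A) (x : M₀) :
    actRight D h ω x = 0 := by
  change commTensorRight D h ω.val x = 0
  induction ω.val using TensorProduct.induction_on with
  | zero => simp
  | tmul a b => simp only [commTensorRight_tmul, e, smul_zero, sub_zero]
  | add s t hs ht => simp only [map_add, AddMonoidHom.add_apply, hs, ht, add_zero]

end Right

end Naturality

end UnivForm

/-! ### Associativity of the twists -/

section Associativity

variable {𝕜 A M₀ M E F : Type*} [RCLike 𝕜] [Ring A] [Algebra 𝕜 A] [AddCommGroup M₀]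
    [AddCommGroup M] [Module A M₀] [Module A M] [Module Aᵐᵒᵖ M₀] [Module Aᵐᵒᵖ M]
    [SMulCommClass A Aᵐᵒᵖ M₀] [SMulCommClass A Aᵐᵒᵖ M] [AddCommGroup E] [Module Aᵐᵒᵖ E]
    [AddCommGroup F] [Module A F] (D : M₀ →+ M)
    (hD : ∀ (c : 𝕜) (x : M₀), D (algebraMap 𝕜 A c • x) = algebraMap 𝕜 A c • D x)
    (hD' : ∀ (c : 𝕜) (x : M₀), D (MulOpposite.op (algebraMap 𝕜 A c) • x) =
      MulOpposite.op (algebraMap 𝕜 A c) • D x)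

include hD' in
theorem UnivConnection.formAct_op_algebraMap (χ : BTensor A E (UnivForm 𝕜 A)) (c : 𝕜) (x : M₀) :
    formAct D hD χ (MulOpposite.op (algebraMap 𝕜 A c) • x) =
      MulOpposite.op (algebraMap 𝕜 A c) • formAct D hD χ x := by
  induction χ using BTensor.induction_on with
  | h0 => simp
  | ht v ω =>
    rw [formAct_tmul, formAct_tmul, UnivForm.actLeft_comm_op D hD _ (hD' c), BTensor.op_smul_tmul]
  | ha s t hs ht => simp only [smul_add, map_add, AddMonoidHom.add_apply, hs, ht]

include hD in
theorem UnivLeftConnection.formAct_algebraMap (θ : BTensor A (UnivForm 𝕜 A) F) (c : 𝕜) (x : M₀) :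
    formAct D hD' θ (algebraMap 𝕜 A c • x) = algebraMap 𝕜 A c • formAct D hD' θ x := by
  induction θ using BTensor.induction_on with
  | h0 => simp
  | ht ω f =>
    rw [formAct_tmul, formAct_tmul, UnivForm.actRight_comm D hD' _ (hD c), BTensor.left_smul_tmul]
  | ha s t hs ht => simp only [smul_add, map_add, AddMonoidHom.add_apply, hs, ht]

theorem UnivLeftConnection.formAct_twist_tmul (nabla : UnivConnection 𝕜 A E) (v : E) (x : M₀)
    (h : ∀ (c : 𝕜) (y : BTensor A E M₀), nabla.twist D hD (MulOpposite.op (algebraMap 𝕜 A c) • y) =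
      MulOpposite.op (algebraMap 𝕜 A c) • nabla.twist D hD y)
    (θ : BTensor A (UnivForm 𝕜 A) F) :
    BTensor.assoc (formAct (nabla.twist D hD) h θ (BTensor.tmul A v x)) =
      BTensor.tmul A v (formAct D hD' θ x) +
        BTensor.assoc (formAct (UnivConnection.formAct D hD (nabla.toHom v))
          (UnivConnection.formAct_op_algebraMap D hD hD' _) θ x) := by
  induction θ using BTensor.induction_on with
  | h0 => simp [BTensor.tmul_zero]
  | ht η f =>
    have key : UnivForm.actRight (nabla.twist D hD) h η (BTensor.tmul A v x) =
        BTensor.tmul A v (UnivForm.actRight D hD' η x) +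
          UnivForm.actRight (UnivConnection.formAct D hD (nabla.toHom v))
            (UnivConnection.formAct_op_algebraMap D hD hD' _) η x := by
      change UnivForm.commTensorRight _ h η.val _ = BTensor.tmul A v
        (UnivForm.commTensorRight D hD' η.val x) +
          UnivForm.commTensorRight _ (UnivConnection.formAct_op_algebraMap D hD hD' _) η.val x
      induction η.val using TensorProduct.induction_on with
      | zero => simp [BTensor.tmul_zero]
      | tmul a b =>
        have e (y z : M) : BTensor.tmul A v (y - z) = BTensor.tmul A v y - BTensor.tmul A v z :=
          map_sub (BTensor.mk A E M v) y z
        simp only [UnivForm.commTensorRight_tmul, BTensor.op_smul_tmul, UnivConnection.twist_tmul,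
          smul_add, e]
        abel
      | add s t hs ht =>
        simp only [map_add, AddMonoidHom.add_apply, hs, ht, BTensor.tmul_add]
        abel
    rw [formAct_tmul, formAct_tmul, formAct_tmul, key, BTensor.add_tmul, map_add,
      BTensor.assoc_tmul]
  | ha s t hs ht =>
    simp only [map_add, AddMonoidHom.add_apply, hs, ht, BTensor.tmul_add]
    abel

theorem UnivConnection.formAct_twist_tmul (nabla : UnivLeftConnection 𝕜 A F) (f : F) (x : M₀)
    (h : ∀ (c : 𝕜) (y : BTensor A M₀ F), nabla.twist D hD' (algebraMap 𝕜 A c • y) =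
      algebraMap 𝕜 A c • nabla.twist D hD' y)
    (χ : BTensor A E (UnivForm 𝕜 A)) :
    formAct (nabla.twist D hD') h χ (BTensor.tmul A x f) =
      BTensor.assoc (BTensor.tmul A (formAct D hD χ x) f) +
        formAct (UnivLeftConnection.formAct D hD' (nabla.toHom f))
          (UnivLeftConnection.formAct_algebraMap D hD hD' _) χ x := by
  induction χ using BTensor.induction_on with
  | h0 => simp [BTensor.zero_tmul]
  | ht v ω =>
    have key : UnivForm.actLeft (nabla.twist D hD') h ω (BTensor.tmul A x f) =
        BTensor.tmul A (UnivForm.actLeft D hD ω x) f +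
          UnivForm.actLeft (UnivLeftConnection.formAct D hD' (nabla.toHom f))
            (UnivLeftConnection.formAct_algebraMap D hD hD' _) ω x := by
      change UnivForm.commTensorLeft _ h ω.val _ = BTensor.tmul A
        (UnivForm.commTensorLeft D hD ω.val x) f +
          UnivForm.commTensorLeft _ (UnivLeftConnection.formAct_algebraMap D hD hD' _) ω.val x
      induction ω.val using TensorProduct.induction_on with
      | zero => simp [BTensor.zero_tmul]
      | tmul a b =>
        have e (y z : M) : BTensor.tmul A (y - z) f = BTensor.tmul A y f - BTensor.tmul A z f :=
          map_sub ((BTensor.mk A M F).flip f) y z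
        simp only [UnivForm.commTensorLeft_tmul, BTensor.left_smul_tmul,
          UnivLeftConnection.twist_tmul, smul_add, smul_sub, e]
        abel
      | add s t hs ht =>
        simp only [map_add, AddMonoidHom.add_apply, hs, ht, BTensor.add_tmul]
        abel
    rw [formAct_tmul, formAct_tmul, formAct_tmul, key, BTensor.tmul_add, BTensor.assoc_tmul]
  | ha s t hs ht =>
    simp only [map_add, AddMonoidHom.add_apply, hs, ht, BTensor.add_tmul]
    abel

/-- The mixed terms of the two iterated twists agree. -/
theorem UnivLeftConnection.formAct_formAct (χ : BTensor A E (UnivForm 𝕜 A))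
    (θ : BTensor A (UnivForm 𝕜 A) F) (x : M₀) :
    BTensor.assoc (UnivLeftConnection.formAct (UnivConnection.formAct D hD χ)
        (UnivConnection.formAct_op_algebraMap D hD hD' χ) θ x) =
      UnivConnection.formAct (UnivLeftConnection.formAct D hD' θ)
        (UnivLeftConnection.formAct_algebraMap D hD hD' θ) χ x := by
  induction θ using BTensor.induction_on with
  | h0 =>
    rw [map_zero, AddMonoidHom.zero_apply, map_zero]
    symm
    induction χ using BTensor.induction_on with
    | h0 => simp
    | ht v ω =>
      rw [UnivConnection.formAct_tmul, UnivForm.actLeft_of_eq_zero _ (fun y => by simp),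
        BTensor.tmul_zero]
    | ha s t hs ht => rw [map_add, AddMonoidHom.add_apply, hs, ht, add_zero]
  | ht η f =>
    rw [UnivLeftConnection.formAct_tmul]
    induction χ using BTensor.induction_on with
    | h0 =>
      rw [UnivForm.actRight_of_eq_zero _ (fun y => by simp)]
      simp [BTensor.zero_tmul]
    | ht v ω =>
      rw [UnivConnection.formAct_tmul,
        UnivForm.actLeft_of_eq_comp (D₁ := UnivForm.actRight D hD' η)
          (UnivForm.commTensorRight_algebraMap D hD hD' η.val) (g := (BTensor.mk A M F).flip f) _
          (fun _ _ => rfl) (fun _ => rfl),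
        UnivForm.actRight_of_eq_comp (D₁ := UnivForm.actLeft D hD ω)
          (UnivForm.commTensorLeft_op_algebraMap D hD hD' ω.val) (g := BTensor.mk A E M v) _
          (fun _ _ => rfl) (fun _ => rfl),
        UnivForm.actLeft_actRight D hD hD']
      rfl
    | ha s t hs ht =>
      rw [map_add (UnivConnection.formAct (UnivLeftConnection.formAct D hD' _) _),
        AddMonoidHom.add_apply, ← hs, ← ht, ← map_add, ← BTensor.add_tmul,
        ← UnivForm.actRight_of_eq_add (UnivConnection.formAct_op_algebraMap D hD hD' s)
          (UnivConnection.formAct_op_algebraMap D hD hD' t)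
          (UnivConnection.formAct_op_algebraMap D hD hD' (s + t))
          (fun y => by rw [map_add, AddMonoidHom.add_apply])]
  | ha s t hs ht =>
    rw [map_add, AddMonoidHom.add_apply, map_add, hs, ht]
    clear hs ht
    induction χ using BTensor.induction_on with
    | h0 => simp
    | ht v ω =>
      simp only [UnivConnection.formAct_tmul]
      rw [← BTensor.tmul_add, ← UnivForm.actLeft_of_eq_add
        (UnivLeftConnection.formAct_algebraMap D hD hD' s)
        (UnivLeftConnection.formAct_algebraMap D hD hD' t)
        (UnivLeftConnection.formAct_algebraMap D hD hD' (s + t))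
        (fun y => by rw [map_add, AddMonoidHom.add_apply])]
    | ha s' t' hs ht =>
      simp only [map_add, AddMonoidHom.add_apply] at hs ht ⊢
      rw [← hs, ← ht]
      exact add_add_add_comm _ _ _ _

/-- Twisting on the left and twisting on the right are compatible with associativity. -/
theorem UnivConnection.assoc_twist_twist (nabla : UnivConnection 𝕜 A E)
    (nabla' : UnivLeftConnection 𝕜 A F)
    (h : ∀ (c : 𝕜) (y : BTensor A E M₀), nabla.twist D hD (MulOpposite.op (algebraMap 𝕜 A c) • y) =
      MulOpposite.op (algebraMap 𝕜 A c) • nabla.twist D hD y)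
    (h' : ∀ (c : 𝕜) (y : BTensor A M₀ F), nabla'.twist D hD' (algebraMap 𝕜 A c • y) =
      algebraMap 𝕜 A c • nabla'.twist D hD' y)
    (x : BTensor A (BTensor A E M₀) F) :
    BTensor.assoc (nabla'.twist (nabla.twist D hD) h x) =
      nabla.twist (nabla'.twist D hD') h' (BTensor.assoc x) := by
  induction x using BTensor.induction_on with
  | h0 => simp only [map_zero]
  | ht y f =>
    induction y using BTensor.induction_on with
    | h0 => rw [BTensor.zero_tmul]; simp only [map_zero]
    | ht v x =>
      rw [UnivLeftConnection.twist_tmul, UnivConnection.twist_tmul, BTensor.assoc_tmul,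
        UnivConnection.twist_tmul, UnivLeftConnection.twist_tmul, map_add,
        UnivLeftConnection.formAct_twist_tmul D hD hD',
        UnivConnection.formAct_twist_tmul D hD hD', UnivLeftConnection.formAct_formAct D hD hD',
        BTensor.add_tmul, map_add, BTensor.assoc_tmul, BTensor.tmul_add]
      abel
    | ha s t hs ht => rw [BTensor.add_tmul]; simp only [map_add, hs, ht]
  | ha s t hs ht => simp only [map_add, hs, ht]

end Associativity

/-! ### Exchanging left and right twists -/

namespace UnivForm

variable {𝕜 A : Type*} [RCLike 𝕜] [Ring A] [Algebra 𝕜 A] [StarRing A] [StarModule 𝕜 A]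

theorem starHom_starHom (ω : UnivForm 𝕜 A) : starHom (starHom ω) = ω := val_injective (by
  rw [val_starHom, val_starHom]
  induction ω.val using TensorProduct.induction_on with
  | zero => simp
  | tmul x y => simp [starTensor_tmul]
  | add x y hx hy => simp only [map_add, hx, hy])

/-- An antilinear map `J` from right to left modules with `J T = T' J` turns the right representation
of `ω` by `T` into minus the left representation of `ω*` by `T'`. -/
theorem map_actRight {M₀ M N₀ N : Type*} [AddCommGroup M₀] [AddCommGroup M] [AddCommGroup N₀]
    [AddCommGroup N] [Module Aᵐᵒᵖ M₀] [Module Aᵐᵒᵖ M] [Module A N₀] [Module A N]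
    {J₀ : M₀ →+ N₀} {J : M →+ N} {T : M₀ →+ M} {T' : N₀ →+ N}
    (hJ₀ : ∀ (a : A) x, J₀ (MulOpposite.op a • x) = star a • J₀ x)
    (hJ : ∀ (a : A) x, J (MulOpposite.op a • x) = star a • J x)
    (hT : ∀ (c : 𝕜) (x : M₀), T (MulOpposite.op (algebraMap 𝕜 A c) • x) =
      MulOpposite.op (algebraMap 𝕜 A c) • T x)
    (hT' : ∀ (c : 𝕜) (x : N₀), T' (algebraMap 𝕜 A c • x) = algebraMap 𝕜 A c • T' x)
    (hJT : ∀ x, J (T x) = T' (J₀ x)) (ω : UnivForm 𝕜 A) (x : M₀) :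
    J (actRight T hT ω x) = -actLeft T' hT' (starHom ω) (J₀ x) := by
  have key (t : A ⊗[𝕜] A) : J (commTensorRight T hT t x) =
      -commTensorLeft T' hT' (starTensor t) (J₀ x) +
        (T' (star (LinearMap.mul' 𝕜 A t) • J₀ x) - star (LinearMap.mul' 𝕜 A t) • T' (J₀ x)) := by
    induction t using TensorProduct.induction_on with
    | zero => simp
    | tmul a b =>
      simp only [commTensorRight_tmul, starTensor_tmul, commTensorLeft_tmul, map_sub, hJ, hJT, hJ₀,
        LinearMap.mul'_apply, star_mul, mul_smul, smul_sub]
      abel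
    | add s t hs ht =>
      simp only [map_add, AddMonoidHom.add_apply, star_add, add_smul, hs, ht]
      abel
  change J (commTensorRight T hT ω.val x) = -commTensorLeft T' hT' (starTensor ω.val) (J₀ x)
  rw [key, mul_val, star_zero, zero_smul, zero_smul, map_zero, sub_zero, add_zero]

/-- The counterpart of `map_actRight` for an antilinear map from left to right modules. -/
theorem map_actLeft {M₀ M N₀ N : Type*} [AddCommGroup M₀] [AddCommGroup M] [AddCommGroup N₀]
    [AddCommGroup N] [Module A M₀] [Module A M] [Module Aᵐᵒᵖ N₀] [Module Aᵐᵒᵖ N]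
    {J₀ : M₀ →+ N₀} {J : M →+ N} {T : M₀ →+ M} {T' : N₀ →+ N}
    (hJ₀ : ∀ (a : A) x, J₀ (a • x) = MulOpposite.op (star a) • J₀ x)
    (hJ : ∀ (a : A) x, J (a • x) = MulOpposite.op (star a) • J x)
    (hT : ∀ (c : 𝕜) (x : M₀), T (algebraMap 𝕜 A c • x) = algebraMap 𝕜 A c • T x)
    (hT' : ∀ (c : 𝕜) (x : N₀), T' (MulOpposite.op (algebraMap 𝕜 A c) • x) =
      MulOpposite.op (algebraMap 𝕜 A c) • T' x)
    (hJT : ∀ x, J (T x) = T' (J₀ x)) (ω : UnivForm 𝕜 A) (x : M₀) :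
    J (actLeft T hT ω x) = -actRight T' hT' (starHom ω) (J₀ x) := by
  have key (t : A ⊗[𝕜] A) : J (commTensorLeft T hT t x) =
      -commTensorRight T' hT' (starTensor t) (J₀ x) +
        (T' (MulOpposite.op (star (LinearMap.mul' 𝕜 A t)) • J₀ x) -
          MulOpposite.op (star (LinearMap.mul' 𝕜 A t)) • T' (J₀ x)) := by
    induction t using TensorProduct.induction_on with
    | zero => simp
    | tmul a b =>
      simp only [commTensorRight_tmul, starTensor_tmul, commTensorLeft_tmul, map_sub, hJ, hJT, hJ₀,
        LinearMap.mul'_apply, star_mul, MulOpposite.op_mul, mul_smul, smul_sub]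
      abel
    | add s t hs ht =>
      simp only [map_add, AddMonoidHom.add_apply, star_add, MulOpposite.op_add, add_smul, hs, ht]
      abel
  change J (commTensorLeft T hT ω.val x) = -commTensorRight T' hT' (starTensor ω.val) (J₀ x)
  rw [key, mul_val, star_zero, MulOpposite.op_zero, zero_smul, zero_smul, map_zero, sub_zero,
    add_zero]

end UnivForm

section Swap

open ConjModule

variable {A M N E : Type*} [Ring A] [StarRing A] [AddCommGroup M] [AddCommGroup N]
    [AddCommGroup E] [Module Aᵐᵒᵖ E]

variable (E) in
/-- The map `x ⊗ v̄ ↦ v ⊗ J x`, for an antilinear map `J` from a right to a left module. -/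
def swapRight [Module Aᵐᵒᵖ M] [Module A N] (J : M →+ N)
    (hJ : ∀ (a : A) x, J (MulOpposite.op a • x) = star a • J x) :
    BTensor A M (ConjModule E) →+ BTensor A E N :=
  BTensor.lift (((BTensor.mk A E N).flip.comp J).compl₂ (bar (E := E)).symm.toAddMonoidHom)
    (fun x a f => by
      change BTensor.tmul A (bar.symm f) (J (MulOpposite.op a • x)) =
        BTensor.tmul A (MulOpposite.op (star a) • bar.symm f) (J x)
      rw [hJ, BTensor.smul_tmul])

theorem swapRight_tmul [Module Aᵐᵒᵖ M] [Module A N] (J : M →+ N)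
    (hJ : ∀ (a : A) x, J (MulOpposite.op a • x) = star a • J x) (x : M) (v : E) :
    swapRight E J hJ (BTensor.tmul A x (bar v)) = BTensor.tmul A v (J x) := rfl

variable (E) in
/-- The map `v ⊗ x ↦ J x ⊗ v̄`, for an antilinear map `J` from a left to a right module. -/
def swapLeft [Module A M] [Module Aᵐᵒᵖ N] (J : M →+ N)
    (hJ : ∀ (a : A) x, J (a • x) = MulOpposite.op (star a) • J x) :
    BTensor A E M →+ BTensor A N (ConjModule E) :=
  BTensor.lift (((BTensor.mk A N (ConjModule E)).comp J).flip.comp (bar (E := E)).toAddMonoidHom)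
    (fun v a x => by
      change BTensor.tmul A (J x) (bar (MulOpposite.op a • v)) =
        BTensor.tmul A (J (a • x)) (bar v)
      rw [hJ, BTensor.smul_tmul, smul_bar, star_star])

theorem swapLeft_tmul [Module A M] [Module Aᵐᵒᵖ N] (J : M →+ N)
    (hJ : ∀ (a : A) x, J (a • x) = MulOpposite.op (star a) • J x) (v : E) (x : M) :
    swapLeft E J hJ (BTensor.tmul A v x) = BTensor.tmul A (J x) (bar v) := rfl

theorem swapLeft_op_smul [Module A M] [Module Aᵐᵒᵖ N] [Module Aᵐᵒᵖ M] [SMulCommClass A Aᵐᵒᵖ M]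
    [Module A N] [SMulCommClass A Aᵐᵒᵖ N] (J : M →+ N)
    (hJ : ∀ (a : A) x, J (a • x) = MulOpposite.op (star a) • J x)
    (hJ' : ∀ (a : A) x, J (MulOpposite.op a • x) = star a • J x) (a : A) (y : BTensor A E M) :
    swapLeft E J hJ (MulOpposite.op a • y) = star a • swapLeft E J hJ y := by
  induction y using BTensor.induction_on with
  | h0 => simp
  | ht v x =>
    rw [BTensor.op_smul_tmul, swapLeft_tmul, swapLeft_tmul, hJ', BTensor.left_smul_tmul]
  | ha s t hs ht => simp only [smul_add, map_add, hs, ht]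

variable {𝕜 M₀ N₀ : Type*} [RCLike 𝕜] [Algebra 𝕜 A] [StarModule 𝕜 A] [AddCommGroup M₀]
    [AddCommGroup N₀]

/-- Exchanging the factors carries the right twist by the conjugate connection to the left twist: the
sign in the conjugate connection cancels that in `UnivForm.map_actRight`. -/
theorem swapRight_twist [Module Aᵐᵒᵖ M₀] [Module Aᵐᵒᵖ M] [Module A N₀] [Module A N]
    (nabla : UnivConnection 𝕜 A E) {J₀ : M₀ →+ N₀} {J : M →+ N} {T : M₀ →+ M} {T' : N₀ →+ N}
    (hJ₀ : ∀ (a : A) x, J₀ (MulOpposite.op a • x) = star a • J₀ x)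
    (hJ : ∀ (a : A) x, J (MulOpposite.op a • x) = star a • J x)
    (hT : ∀ (c : 𝕜) (x : M₀), T (MulOpposite.op (algebraMap 𝕜 A c) • x) =
      MulOpposite.op (algebraMap 𝕜 A c) • T x)
    (hT' : ∀ (c : 𝕜) (x : N₀), T' (algebraMap 𝕜 A c • x) = algebraMap 𝕜 A c • T' x)
    (hJT : ∀ x, J (T x) = T' (J₀ x)) (y : BTensor A M₀ (ConjModule E)) :
    swapRight E J hJ (nabla.conjugate.twist T hT y) = nabla.twist T' hT' (swapRight E J₀ hJ₀ y) := by
  have key (χ : BTensor A E (UnivForm 𝕜 A)) (x : M₀) :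
      swapRight E J hJ (UnivLeftConnection.formAct T hT (UnivConnection.conjForm χ) x) =
        -UnivConnection.formAct T' hT' χ (J₀ x) := by
    induction χ using BTensor.induction_on with
    | h0 => simp
    | ht w ω =>
      rw [UnivConnection.conjForm_tmul, UnivLeftConnection.formAct_tmul, swapRight_tmul,
        UnivForm.map_actRight hJ₀ hJ hT hT' hJT, UnivForm.starHom_starHom,
        UnivConnection.formAct_tmul]
      exact map_neg (BTensor.mk A E N w) _
    | ha s t hs ht =>
      simp only [map_add, AddMonoidHom.add_apply, hs, ht]
      abel
  induction y using BTensor.induction_on with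
  | h0 => simp only [map_zero]
  | ht x f =>
    obtain ⟨v, rfl⟩ := (bar (E := E)).surjective f
    rw [UnivLeftConnection.twist_tmul, UnivConnection.conjugate_bar, map_neg, map_add,
      AddMonoidHom.neg_apply, map_neg, key, neg_neg, swapRight_tmul, swapRight_tmul,
      UnivConnection.twist_tmul, hJT, add_comm]
  | ha s t hs ht => simp only [map_add, hs, ht]

theorem swapLeft_twist [Module A M₀] [Module A M] [Module Aᵐᵒᵖ N₀] [Module Aᵐᵒᵖ N]
    (nabla : UnivConnection 𝕜 A E) {J₀ : M₀ →+ N₀} {J : M →+ N} {T : M₀ →+ M} {T' : N₀ →+ N}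
    (hJ₀ : ∀ (a : A) x, J₀ (a • x) = MulOpposite.op (star a) • J₀ x)
    (hJ : ∀ (a : A) x, J (a • x) = MulOpposite.op (star a) • J x)
    (hT : ∀ (c : 𝕜) (x : M₀), T (algebraMap 𝕜 A c • x) = algebraMap 𝕜 A c • T x)
    (hT' : ∀ (c : 𝕜) (x : N₀), T' (MulOpposite.op (algebraMap 𝕜 A c) • x) =
      MulOpposite.op (algebraMap 𝕜 A c) • T' x)
    (hJT : ∀ x, J (T x) = T' (J₀ x)) (y : BTensor A E M₀) :
    swapLeft E J hJ (nabla.twist T hT y) = nabla.conjugate.twist T' hT' (swapLeft E J₀ hJ₀ y) := by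
  have key (χ : BTensor A E (UnivForm 𝕜 A)) (x : M₀) :
      swapLeft E J hJ (UnivConnection.formAct T hT χ x) =
        -UnivLeftConnection.formAct T' hT' (UnivConnection.conjForm χ) (J₀ x) := by
    induction χ using BTensor.induction_on with
    | h0 => simp
    | ht w ω =>
      rw [UnivConnection.conjForm_tmul, UnivLeftConnection.formAct_tmul, UnivConnection.formAct_tmul,
        swapLeft_tmul, UnivForm.map_actLeft hJ₀ hJ hT hT' hJT]
      exact map_neg ((BTensor.mk A N (ConjModule E)).flip (bar w)) _
    | ha s t hs ht =>
      simp only [map_add, AddMonoidHom.add_apply, hs, ht]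
      abel
  induction y using BTensor.induction_on with
  | h0 => simp only [map_zero]
  | ht v x =>
    rw [UnivConnection.twist_tmul, map_add, key, swapLeft_tmul, swapLeft_tmul, hJT,
      UnivLeftConnection.twist_tmul, UnivConnection.conjugate_bar, map_neg, AddMonoidHom.neg_apply,
      add_comm]
  | ha s t hs ht => simp only [map_add, hs, ht]

end Swap

/-! ### Pairings on twisted modules -/

namespace HermitianStructure

variable {𝕜 A H E : Type*} [RCLike 𝕜] [Ring A]
    [StarRing A] [Algebra 𝕜 A] [StarModule 𝕜 A] [NormedAddCommGroup H] [InnerProductSpace ℂ H]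
    [CompleteSpace H] {S : RealSpectralTriple 𝕜 A H} [AddCommGroup E] [Module 𝕜 E]
    [Module Aᵐᵒᵖ E] [IsScalarTower 𝕜 Aᵐᵒᵖ E] (h : HermitianStructure S E)

section Left

variable {M₀ M : Type*} [AddCommGroup M₀] [AddCommGroup M] [Module A M₀] [Module A M]
    (β : M →+ M →+ ℂ) (hβ : ∀ (a : A) x y, β (a • x) y = β x (star a • y))

/-- The additive map `w ⊗ y ↦ β x ((v|w) y)`. -/
def pairingWith (v : E) (x : M) : BTensor A E M →+ ℂ :=
  BTensor.lift (AddMonoidHom.mk'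
      (fun w => (β x).comp (DistribSMul.toAddMonoidHom M (h.form v w)))
      (fun w w' => AddMonoidHom.ext fun y => by
        change β x (h.form v (w + w') • y) = β x (h.form v w • y) + β x (h.form v w' • y)
        rw [map_add, add_smul, map_add]))
    (fun w a y => by
      change β x (h.form v (MulOpposite.op a • w) • y) = β x (h.form v w • a • y)
      rw [h.form_op_smul, mul_smul])

/-- The pairing `⟨v ⊗ x, w ⊗ y⟩ = ⟨x, (v|w) y⟩` on `E ⊗_A M` induced by a pairing on `M` for
which the action of `A` is a `*`-action. -/
def leftPairing : BTensor A E M →+ BTensor A E M →+ ℂ :=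
  BTensor.lift (AddMonoidHom.mk' (fun v => AddMonoidHom.mk' (h.pairingWith β v)
      (fun x x' => BTensor.hom_ext fun w y => by
        change β (x + x') (h.form v w • y) = β x (h.form v w • y) + β x' (h.form v w • y)
        rw [map_add, AddMonoidHom.add_apply]))
      (fun v v' => AddMonoidHom.ext fun x => BTensor.hom_ext fun w y => by
        change β x (h.form (v + v') w • y) = β x (h.form v w • y) + β x (h.form v' w • y)
        rw [map_add, AddMonoidHom.add_apply, add_smul, map_add]))
    (fun v a x => BTensor.hom_ext fun w y => by
      change β x (h.form (MulOpposite.op a • v) w • y) = β (a • x) (h.form v w • y)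
      rw [h.op_smul_form, mul_smul, hβ])

theorem leftPairing_tmul (v w : E) (x y : M) :
    h.leftPairing β hβ (BTensor.tmul A v x) (BTensor.tmul A w y) = β x (h.form v w • y) := rfl

/-- Twisting by a hermitian connection preserves symmetry of an operator. -/
theorem leftPairing_twist {nabla : UnivConnection 𝕜 A E} (hn : nabla.IsHermitian h)
    {incl : M₀ →+ M} (hincl : ∀ (a : A) x, incl (a • x) = a • incl x) {T : M₀ →+ M}
    (hT : ∀ (c : 𝕜) (x : M₀), T (algebraMap 𝕜 A c • x) = algebraMap 𝕜 A c • T x)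
    (sym : ∀ x y, β (T x) (incl y) = β (incl x) (T y)) (s t : BTensor A E M₀) :
    h.leftPairing β hβ (nabla.twist T hT s)
        (BTensor.map (AddMonoidHom.id E) incl (fun _ _ => rfl) hincl t) =
      h.leftPairing β hβ (BTensor.map (AddMonoidHom.id E) incl (fun _ _ => rfl) hincl s)
        (nabla.twist T hT t) := by
  have adj (u : A ⊗[𝕜] A) (x y : M₀) : β (UnivForm.commTensorLeft T hT u x) (incl y) =
      β (incl x) (UnivForm.commTensorLeft T hT (UnivForm.starTensor u) y +
        (star (LinearMap.mul' 𝕜 A u) • T y - T (star (LinearMap.mul' 𝕜 A u) • y))) := by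
    induction u using TensorProduct.induction_on with
    | zero => simp
    | tmul a b =>
      simp only [UnivForm.starTensor_tmul, UnivForm.commTensorLeft_tmul, hβ, map_sub, map_add, sym,
        AddMonoidHom.sub_apply, ← hincl, LinearMap.mul'_apply, star_mul, mul_smul, smul_sub]
      simp only [hβ, hincl, ← sym]
      simp only [← hincl, sym]
      abel
    | add u u' hu hu' =>
      simp only [map_add, AddMonoidHom.add_apply, star_add, add_smul, hu, hu', map_sub]
      abel
  have adj_form (ω : UnivForm 𝕜 A) (x y : M₀) : β (UnivForm.actLeft T hT ω x) (incl y) =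
      β (incl x) (UnivForm.actLeft T hT (UnivForm.starHom ω) y) := by
    refine (adj ω.val x y).trans ?_
    rw [UnivForm.mul_val, star_zero, zero_smul, zero_smul, map_zero, sub_zero, add_zero]
    rfl
  have left (χ : BTensor A E (UnivForm 𝕜 A)) (w : E) (x y : M₀) :
      h.leftPairing β hβ (UnivConnection.formAct T hT χ x) (BTensor.tmul A w (incl y)) =
        β (incl x) (UnivForm.actLeft T hT (UnivForm.starHom (h.formPair w χ)) y) := by
    induction χ using BTensor.induction_on with
    | h0 => simp
    | ht v ω =>
      rw [UnivConnection.formAct_tmul, leftPairing_tmul, ← hincl, adj_form, formPair_tmul,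
        UnivForm.starHom_smul, h.star_form, UnivForm.actLeft_op_smul]
    | ha s t hs ht => simp only [map_add, AddMonoidHom.add_apply, hs, ht]
  have right (χ : BTensor A E (UnivForm 𝕜 A)) (v : E) (x y : M₀) :
      h.leftPairing β hβ (BTensor.tmul A v (incl x)) (UnivConnection.formAct T hT χ y) =
        β (incl x) (UnivForm.actLeft T hT (h.formPair v χ) y) := by
    induction χ using BTensor.induction_on with
    | h0 => simp
    | ht w ω =>
      rw [UnivConnection.formAct_tmul, leftPairing_tmul, formPair_tmul, UnivForm.actLeft_smul]
    | ha s t hs ht => simp only [map_add, AddMonoidHom.add_apply, hs, ht]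
  induction s using BTensor.induction_on with
  | h0 => simp
  | ha s s' hs hs' => simp only [map_add, AddMonoidHom.add_apply, hs, hs']
  | ht v x =>
    induction t using BTensor.induction_on with
    | h0 => simp
    | ha t t' ht ht' => simp only [map_add, ht, ht']
    | ht w y =>
      have e : UnivForm.actLeft T hT (UnivForm.δ 𝕜 (h.form v w)) y =
          T (h.form v w • y) - h.form v w • T y := by
        simpa using UnivForm.actLeft_smul_δ T hT 1 (h.form v w) y
      rw [← hn v w, map_sub, AddMonoidHom.sub_apply, sub_eq_sub_iff_add_eq_add] at e
      rw [BTensor.map_tmul, BTensor.map_tmul, AddMonoidHom.id_apply, AddMonoidHom.id_apply,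
        UnivConnection.twist_tmul, UnivConnection.twist_tmul, map_add, map_add,
        AddMonoidHom.add_apply, left, right, leftPairing_tmul, leftPairing_tmul, ← hincl, sym,
        ← map_add, ← map_add]
      congr 1
      rw [e, add_comm]

end Left

section Right

open ConjModule

variable {K₀ K : Type*} [AddCommGroup K₀] [AddCommGroup K] [Module Aᵐᵒᵖ K₀] [Module Aᵐᵒᵖ K]
    (β : K →+ K →+ ℂ)
    (hβ : ∀ (a : A) x y, β (MulOpposite.op a • x) y = β x (MulOpposite.op (star a) • y))

theorem bar_op_smul (a : A) (x : K) :
    (bar (E := K)).toAddMonoidHom (MulOpposite.op a • x) =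
      star a • (bar (E := K)).toAddMonoidHom x := by
  change bar (MulOpposite.op a • x) = star a • bar x
  rw [smul_bar, star_star]

/-- The opposite pairing on the conjugate module. -/
def conjPairing : ConjModule K →+ ConjModule K →+ ℂ :=
  (β.compl₂ (bar (E := K)).symm.toAddMonoidHom).flip.compl₂ (bar (E := K)).symm.toAddMonoidHom

include hβ in
theorem conjPairing_smul (a : A) (x y : ConjModule K) :
    conjPairing β (a • x) y = conjPairing β x (star a • y) := by
  change β (bar.symm y) (MulOpposite.op (star a) • bar.symm x) =
    β (MulOpposite.op (star (star a)) • bar.symm y) (bar.symm x)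
  rw [hβ, star_star]

/-- The pairing `⟨x ⊗ v̄, y ⊗ w̄⟩ = ⟨x, y (w|v)⟩` on `K ⊗_A Ē` induced by a pairing on `K`, obtained
from `leftPairing` by passing to the conjugate module of `K`. -/
def rightPairing : BTensor A K (ConjModule E) →+ BTensor A K (ConjModule E) →+ ℂ :=
  ((h.leftPairing (conjPairing β) (conjPairing_smul β hβ)).flip.comp
    (swapRight E (bar (E := K)).toAddMonoidHom bar_op_smul)).compl₂
      (swapRight E (bar (E := K)).toAddMonoidHom bar_op_smul)

theorem rightPairing_apply (s t : BTensor A K (ConjModule E)) : h.rightPairing β hβ s t =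
    h.leftPairing (conjPairing β) (conjPairing_smul β hβ)
      (swapRight E (bar (E := K)).toAddMonoidHom bar_op_smul t)
      (swapRight E (bar (E := K)).toAddMonoidHom bar_op_smul s) := rfl

theorem rightPairing_tmul (v w : E) (x y : K) :
    h.rightPairing β hβ (BTensor.tmul A x (bar v)) (BTensor.tmul A y (bar w)) =
      β x (MulOpposite.op (h.form w v) • y) := by
  change β (MulOpposite.op (star (h.form w v)) • x) y = _
  rw [hβ, star_star]

theorem rightPairing_twist {nabla : UnivConnection 𝕜 A E} (hn : nabla.IsHermitian h)
    {incl : K₀ →+ K} (hincl : ∀ (a : A) x, incl (MulOpposite.op a • x) = MulOpposite.op a • incl x)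
    {T : K₀ →+ K} (hT : ∀ (c : 𝕜) (x : K₀), T (MulOpposite.op (algebraMap 𝕜 A c) • x) =
      MulOpposite.op (algebraMap 𝕜 A c) • T x)
    (sym : ∀ x y, β (T x) (incl y) = β (incl x) (T y)) (s t : BTensor A K₀ (ConjModule E)) :
    h.rightPairing β hβ (nabla.conjugate.twist T hT s)
        (BTensor.map incl (AddMonoidHom.id _) hincl (fun _ _ => rfl) t) =
      h.rightPairing β hβ (BTensor.map incl (AddMonoidHom.id _) hincl (fun _ _ => rfl) s)
        (nabla.conjugate.twist T hT t) := by
  let T' : ConjModule K₀ →+ ConjModule K := T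
  let incl' : ConjModule K₀ →+ ConjModule K := incl
  have hT' (c : 𝕜) (x : ConjModule K₀) : T' (algebraMap 𝕜 A c • x) = algebraMap 𝕜 A c • T' x := by
    change T (MulOpposite.op (star (algebraMap 𝕜 A c)) • bar.symm x) =
      MulOpposite.op (star (algebraMap 𝕜 A c)) • T (bar.symm x)
    rw [← algebraMap_star_comm, hT]
  have hincl' (a : A) (x : ConjModule K₀) : incl' (a • x) = a • incl' x :=
    hincl (star a) (bar.symm x)
  have e₁ (y : BTensor A K₀ (ConjModule E)) :
      swapRight E (bar (E := K)).toAddMonoidHom bar_op_smul (nabla.conjugate.twist T hT y) =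
        nabla.twist T' hT' (swapRight E (bar (E := K₀)).toAddMonoidHom bar_op_smul y) :=
    swapRight_twist nabla bar_op_smul bar_op_smul hT hT' (fun _ => rfl) y
  have e₂ (y : BTensor A K₀ (ConjModule E)) :
      swapRight E (bar (E := K)).toAddMonoidHom bar_op_smul
          (BTensor.map incl (AddMonoidHom.id _) hincl (fun _ _ => rfl) y) =
        BTensor.map (AddMonoidHom.id E) incl' (fun _ _ => rfl) hincl'
          (swapRight E (bar (E := K₀)).toAddMonoidHom bar_op_smul y) := by
    induction y using BTensor.induction_on with
    | h0 => simp only [map_zero]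
    | ht x f => rfl
    | ha s t hs ht => simp only [map_add, hs, ht]
  rw [rightPairing_apply, rightPairing_apply, e₁, e₂, e₁, e₂]
  exact (h.leftPairing_twist _ _ hn hincl' hT' (fun x y => (sym (bar.symm y) (bar.symm x)).symm)
    _ _).symm

end Right

end HermitianStructure

/-! ### Self-adjoint operators with compact resolvent -/

namespace LinearPMap

variable {H X : Type*} [NormedAddCommGroup H] [InnerProductSpace ℂ H] [CompleteSpace H]
    [NormedAddCommGroup X] [InnerProductSpace ℂ X]

/-- A densely defined symmetric relation which is closed under scalars is the graph of an operator:
symmetry determines the value at a vector of the domain. -/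
theorem exists_graph_eq_of_symmetric {Z : Type*} [AddCommGroup Z] (i T : Z →+ X)
    (hd : Dense (Set.range i)) (hsmul : ∀ (c : ℂ) (z : Z), ∃ z', i z' = c • i z)
    (sym : ∀ z w, ⟪T z, i w⟫_ℂ = ⟪i z, T w⟫_ℂ) :
    ∃ P : X →ₗ.[ℂ] X, ∀ x y : X, (x, y) ∈ P.graph ↔ ∃ z, i z = x ∧ T z = y := by
  have value (z : Z) (y : X) (hy : ∀ w, ⟪y, i w⟫_ℂ = ⟪i z, T w⟫_ℂ) : T z = y := by
    refine hd.eq_of_inner_left ℂ ?_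
    rintro _ ⟨w, rfl⟩
    rw [sym, hy]
  let dom : Submodule ℂ X :=
    { carrier := Set.range i
      add_mem' := by
        rintro _ _ ⟨z, rfl⟩ ⟨w, rfl⟩
        exact ⟨z + w, _root_.map_add i z w⟩
      zero_mem' := ⟨0, _root_.map_zero i⟩
      smul_mem' := by
        rintro c _ ⟨z, rfl⟩
        exact hsmul c z }
  choose f hf using fun x : dom => x.2
  let P : X →ₗ.[ℂ] X :=
    { domain := dom
      toFun :=
        { toFun := fun x => T (f x)
          map_add' := fun x y => value _ _ fun w => by
            rw [inner_add_left, sym, sym, hf, hf, hf, Submodule.coe_add, inner_add_left]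
          map_smul' := fun c x => value _ _ fun w => by
            rw [RingHom.id_apply, inner_smul_left, sym, hf, hf, Submodule.coe_smul,
              inner_smul_left] } }
  refine ⟨P, fun x y => ?_⟩
  rw [mem_graph_iff]
  constructor
  · rintro ⟨x', rfl, rfl⟩
    exact ⟨f x', hf x', rfl⟩
  · rintro ⟨z, rfl, rfl⟩
    refine ⟨⟨i z, z, rfl⟩, rfl, (value _ _ fun w => ?_).symm⟩
    change ⟪T (f _), i w⟫_ℂ = _
    rw [sym, hf]

variable [CompleteSpace X]

theorem inner_apply_of_isSelfAdjoint {D : H →ₗ.[ℂ] H} (hD : IsSelfAdjoint D) (x y : D.domain) :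
    ⟪D x, (y : H)⟫_ℂ = ⟪(x : H), D y⟫_ℂ := by
  have h := adjoint_isFormalAdjoint hD.dense_domain
  rw [isSelfAdjoint_def.1 hD] at h
  exact h x y

theorem mem_domain_of_bound {D : H →ₗ.[ℂ] H} (hD : IsSelfAdjoint D) {y : H} (C : ℝ)
    (h : ∀ ξ : D.domain, ‖⟪y, D ξ⟫_ℂ‖ ≤ C * ‖(ξ : H)‖) : y ∈ D.domain := by
  rw [← isSelfAdjoint_def.1 hD, mem_adjoint_domain_iff]
  exact AddMonoidHomClass.continuous_of_bound _ C h

theorem norm_le_of_isSelfAdjoint {T : X →ₗ.[ℂ] X} (hT : IsSelfAdjoint T) (z : ℂ) (x : T.domain) :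
    |z.im| * ‖(x : X)‖ ≤ ‖T x - z • (x : X)‖ := by
  by_cases hx : (x : X) = 0
  · simp [hx]
  have him : (⟪(x : X), T x⟫_ℂ).im = 0 := by
    have h := inner_apply_of_isSelfAdjoint hT x x
    rw [← inner_conj_symm] at h
    have := congrArg Complex.im h
    rw [Complex.conj_im] at this
    linarith
  have h1 : (⟪(x : X), T x - z • (x : X)⟫_ℂ).im = -(z.im * ‖(x : X)‖ ^ 2) := by
    rw [inner_sub_right, inner_smul_right, inner_self_eq_norm_sq_to_K, Complex.sub_im, him,
      zero_sub]
    congr 1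
    norm_cast
    exact Complex.im_mul_ofReal z _
  have h2 : |z.im| * ‖(x : X)‖ ^ 2 ≤ ‖(x : X)‖ * ‖T x - z • (x : X)‖ := by
    calc |z.im| * ‖(x : X)‖ ^ 2 = |(⟪(x : X), T x - z • (x : X)⟫_ℂ).im| := by
          rw [h1, abs_neg, abs_mul, abs_of_nonneg (sq_nonneg ‖(x : X)‖)]
      _ ≤ ‖⟪(x : X), T x - z • (x : X)⟫_ℂ‖ := Complex.abs_im_le_norm _
      _ ≤ _ := norm_inner_le_norm _ _
  have hpos : 0 < ‖(x : X)‖ := norm_pos_iff.2 hx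
  nlinarith

/-- The resolvent of a self-adjoint operator at a nonreal point. -/
theorem exists_resolvent {T : X →ₗ.[ℂ] X} (hT : IsSelfAdjoint T) {z : ℂ} (hz : z.im ≠ 0) :
    ∃ R : X →L[ℂ] X, (∀ x : X, ∃ hx : R x ∈ T.domain, T ⟨R x, hx⟩ - z • R x = x) ∧
      ∀ x : T.domain, R (T x - z • (x : X)) = x := by
  have hcl : _root_.IsClosed (T.graph : Set (X × X)) := hT.isClosed
  have : CompleteSpace T.graph := hcl.completeSpace_coe
  -- The bijection `(x, T x) ↦ T x - z x` from the graph of `T`.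
  let L : T.graph →L[ℂ] X :=
    (ContinuousLinearMap.snd ℂ X X - z • ContinuousLinearMap.fst ℂ X X).comp T.graph.subtypeL
  have hLx (p : T.graph) : L p = p.1.2 - z • p.1.1 := rfl
  have hgraph (p : T.graph) : ∃ x : T.domain, (x : X) = p.1.1 ∧ T x = p.1.2 :=
    (mem_graph_iff T).1 p.2
  have hpos : 0 < |z.im| := abs_pos.2 hz
  have hbound (p : T.graph) : ‖p‖ ≤ (1 + (1 + ‖z‖) / |z.im|) * ‖L p‖ := by
    obtain ⟨x, hx, hy⟩ := hgraph p
    have h1 : ‖p.1.1‖ ≤ ‖L p‖ / |z.im| := by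
      rw [le_div_iff₀ hpos, hLx, ← hx, ← hy, mul_comm]
      exact norm_le_of_isSelfAdjoint hT z x
    have h2 : ‖p.1.2‖ ≤ ‖L p‖ + ‖z‖ * ‖p.1.1‖ := by
      have : p.1.2 = L p + z • p.1.1 := by rw [hLx]; abel
      calc ‖p.1.2‖ = ‖L p + z • p.1.1‖ := by rw [← this]
        _ ≤ _ := (norm_add_le _ _).trans (by rw [norm_smul])
    have h3 : ‖z‖ * ‖p.1.1‖ ≤ ‖z‖ * (‖L p‖ / |z.im|) :=
      mul_le_mul_of_nonneg_left h1 (norm_nonneg z)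
    have e : (1 + (1 + ‖z‖) / |z.im|) * ‖L p‖ =
        ‖L p‖ + ‖L p‖ / |z.im| + ‖z‖ * (‖L p‖ / |z.im|) := by
      field_simp
      ring
    have h4 : 0 ≤ ‖L p‖ / |z.im| := by positivity
    have h5 : 0 ≤ ‖z‖ * (‖L p‖ / |z.im|) := by positivity
    rw [e]
    change max ‖p.1.1‖ ‖p.1.2‖ ≤ _
    refine max_le ?_ ?_
    · linarith [norm_nonneg (L p)]
    · linarith
  have hC : 0 ≤ 1 + (1 + ‖z‖) / |z.im| := by positivity
  have hanti : AntilipschitzWith ⟨_, hC⟩ L :=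
    AddMonoidHomClass.antilipschitz_of_bound L hbound
  have hker : L.ker = ⊥ := LinearMap.ker_eq_bot.2 hanti.injective
  have hrange : L.range = ⊤ := by
    have hclosed : _root_.IsClosed (L.range : Set X) := by
      exact hanti.isClosed_range L.uniformContinuous
    have : CompleteSpace L.range := hclosed.completeSpace_coe
    rw [← Submodule.orthogonal_eq_bot_iff, Submodule.eq_bot_iff]
    intro y hy
    have hy' (x : T.domain) : ⟪y, T x⟫_ℂ = ⟪(starRingEnd ℂ z) • y, (x : X)⟫_ℂ := by
      have h := (Submodule.mem_orthogonal' _ _).1 hy (T x - z • (x : X))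
        ⟨⟨((x : X), T x), T.mem_graph x⟩, rfl⟩
      rw [inner_sub_right, inner_smul_right, sub_eq_zero] at h
      rw [h, inner_smul_left, Complex.conj_conj]
    have hmem : y ∈ T.domain := by
      rw [← isSelfAdjoint_def.1 hT]
      exact mem_adjoint_domain_of_exists y ⟨_, fun x => (hy' x).symm⟩
    have hval : T ⟨y, hmem⟩ = (starRingEnd ℂ z) • y := by
      refine hT.dense_domain.eq_of_inner_left ℂ fun x hx => ?_
      rw [inner_apply_of_isSelfAdjoint hT ⟨y, hmem⟩ ⟨x, hx⟩]
      exact hy' ⟨x, hx⟩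
    have h := norm_le_of_isSelfAdjoint hT (starRingEnd ℂ z) ⟨y, hmem⟩
    rw [hval, sub_self, norm_zero, Complex.conj_im, abs_neg] at h
    have : ‖y‖ ≤ 0 := by
      by_contra hne
      push Not at hne
      exact absurd h (not_le.2 (mul_pos hpos hne))
    exact norm_le_zero_iff.1 this
  let e := ContinuousLinearEquiv.ofBijective L hker hrange
  have he (p : T.graph) : e p = p.1.2 - z • p.1.1 := rfl
  refine ⟨(ContinuousLinearMap.fst ℂ X X).comp (T.graph.subtypeL.comp
    (e.symm : X →L[ℂ] T.graph)), fun x => ?_, fun x => ?_⟩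
  · obtain ⟨x', hx, hy⟩ := hgraph (e.symm x)
    change ∃ hx : (e.symm x).1.1 ∈ T.domain, T ⟨(e.symm x).1.1, hx⟩ - z • (e.symm x).1.1 = x
    refine ⟨hx ▸ x'.2, ?_⟩
    have : (⟨(e.symm x).1.1, hx ▸ x'.2⟩ : T.domain) = x' := Subtype.ext hx.symm
    rw [this, hy, ← he, e.apply_symm_apply]
  · have : e.symm (T x - z • (x : X)) = ⟨((x : X), T x), T.mem_graph x⟩ := by
      rw [ContinuousLinearEquiv.symm_apply_eq]
      rfl
    change (e.symm (T x - z • (x : X))).1.1 = x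
    rw [this]

/-- A bounded operator `u` which maps the domain of `D` to the domain of `T` and for which
`T u - u D` is bounded. -/
def AlmostIntertwines (D : H →ₗ.[ℂ] H) (T : X →ₗ.[ℂ] X) (u : H →L[ℂ] X) : Prop :=
  ∃ C : ℝ, ∀ ξ : D.domain, ∃ h : u ξ ∈ T.domain, ‖T ⟨u ξ, h⟩ - u (D ξ)‖ ≤ C * ‖(ξ : H)‖

open ContinuousLinearMap (adjoint_inner_left adjoint_inner_right)

variable {D : H →ₗ.[ℂ] H} (hD : IsSelfAdjoint D) {T : X →ₗ.[ℂ] X}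
    (hd : Dense (T.domain : Set X))

include hD hd in
theorem AlmostIntertwines.adjoint {u : H →L[ℂ] X} (hu : AlmostIntertwines D T u) :
    ∃ C : ℝ, ∀ y : T.adjoint.domain, ∃ h : ContinuousLinearMap.adjoint u y ∈ D.domain,
      ‖D ⟨_, h⟩ - ContinuousLinearMap.adjoint u (T.adjoint y)‖ ≤ C * ‖(y : X)‖ := by
  obtain ⟨C₀, hC⟩ := hu
  refine ⟨|C₀|, fun y => ?_⟩
  set C := |C₀| with hC₀
  have key (ξ : D.domain) : ‖⟪ContinuousLinearMap.adjoint u y, D ξ⟫_ℂ -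
      ⟪ContinuousLinearMap.adjoint u (T.adjoint y), (ξ : H)⟫_ℂ‖ ≤ C * ‖(y : X)‖ * ‖(ξ : H)‖ := by
    obtain ⟨h, hle⟩ := hC ξ
    have e : ⟪T.adjoint y, u ξ⟫_ℂ = ⟪(y : X), T ⟨u ξ, h⟩⟫_ℂ :=
      adjoint_isFormalAdjoint hd y ⟨u ξ, h⟩
    rw [adjoint_inner_left, adjoint_inner_left, e, ← inner_sub_right, ← norm_neg,
      ← inner_neg_right, neg_sub]
    calc _ ≤ ‖(y : X)‖ * ‖T ⟨u ξ, h⟩ - u (D ξ)‖ := norm_inner_le_norm _ _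
      _ ≤ ‖(y : X)‖ * (C * ‖(ξ : H)‖) := by
          gcongr
          exact hle.trans (mul_le_mul_of_nonneg_right (le_abs_self C₀) (norm_nonneg _))
      _ = _ := by ring
  have hmem : ContinuousLinearMap.adjoint u y ∈ D.domain := by
    refine mem_domain_of_bound hD (C * ‖(y : X)‖ +
      ‖ContinuousLinearMap.adjoint u (T.adjoint y)‖) fun ξ => ?_
    have h1 := norm_le_insert' ⟪ContinuousLinearMap.adjoint u y, D ξ⟫_ℂ
      ⟪ContinuousLinearMap.adjoint u (T.adjoint y), (ξ : H)⟫_ℂ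
    have h2 := norm_inner_le_norm (𝕜 := ℂ) (ContinuousLinearMap.adjoint u (T.adjoint y)) (ξ : H)
    have h3 := key ξ
    rw [add_mul]
    linarith
  refine ⟨hmem, ?_⟩
  set w := D ⟨_, hmem⟩ - ContinuousLinearMap.adjoint u (T.adjoint y) with hw
  have hall (ξ : H) : ‖⟪w, ξ⟫_ℂ‖ ≤ C * ‖(y : X)‖ * ‖ξ‖ := by
    refine hD.dense_domain.induction (P := fun ξ => ‖⟪w, ξ⟫_ℂ‖ ≤ C * ‖(y : X)‖ * ‖ξ‖)
      (fun ξ hξ => ?_) (isClosed_le (by fun_prop) (by fun_prop)) ξ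
    rw [hw, inner_sub_left, inner_apply_of_isSelfAdjoint hD ⟨_, hmem⟩ ⟨ξ, hξ⟩]
    exact key ⟨ξ, hξ⟩
  by_cases h0 : w = 0
  · rw [h0, norm_zero]
    positivity
  · have h1 := hall w
    rw [inner_self_eq_norm_sq_to_K, norm_pow] at h1
    have hpos := norm_pos_iff.2 h0
    have h2 : ‖w‖ ^ 2 ≤ C * ‖(y : X)‖ * ‖w‖ := by simpa using h1
    nlinarith

omit [CompleteSpace H] [CompleteSpace X] in
theorem AlmostIntertwines.mem_domain {u : H →L[ℂ] X} (hu : AlmostIntertwines D T u) {ξ : H}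
    (hξ : ξ ∈ D.domain) : u ξ ∈ T.domain :=
  let ⟨_, hC⟩ := hu
  (hC ⟨ξ, hξ⟩).1

section Frame

variable (sym : ∀ x y : T.domain, ⟪T x, (y : X)⟫_ℂ = ⟪(x : X), T y⟫_ℂ)
    {ι : Type*} [Fintype ι] {a b : ι → H →L[ℂ] X}
    (hab : ∀ x, ∑ i, a i (ContinuousLinearMap.adjoint (b i) x) = x)
    (ha : ∀ i, AlmostIntertwines D T (a i)) (hb : ∀ i, AlmostIntertwines D T (b i))

include hD hd sym hab ha hb in
/-- If `1 = ∑ aᵢ bᵢ*` with `aᵢ`, `bᵢ` almost intertwining `D` and `T`, then the domain of the adjoint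
of the symmetric operator `T` is no larger than that of `T`. -/
theorem isSelfAdjoint_of_frame : IsSelfAdjoint T := by
  rw [isSelfAdjoint_def]
  have hle : T ≤ T.adjoint := IsFormalAdjoint.le_adjoint hd sym
  refine (eq_of_le_of_domain_eq hle (le_antisymm hle.1 fun y hy => ?_)).symm
  rw [← hab y]
  refine Submodule.sum_mem _ fun i _ => (ha i).mem_domain ?_
  obtain ⟨C, hC⟩ := (hb i).adjoint hD hd
  exact (hC ⟨y, hy⟩).1

theorem AlmostIntertwines.adjoint_of_isSelfAdjoint (hD : IsSelfAdjoint D) (hT : IsSelfAdjoint T)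
    {u : H →L[ℂ] X} (hu : AlmostIntertwines D T u) :
    ∃ C : ℝ, ∀ y : T.domain, ∃ h : ContinuousLinearMap.adjoint u y ∈ D.domain,
      ‖D ⟨_, h⟩ - ContinuousLinearMap.adjoint u (T y)‖ ≤ C * ‖(y : X)‖ := by
  have h := hu.adjoint hD hT.dense_domain
  rwa [isSelfAdjoint_def.1 hT] at h

include hD hab hb in
/-- The resolvent of `T` is `∑ aᵢ bᵢ* R`, and `bᵢ* R` factors through the resolvent of `D`. -/
theorem isCompactOperator_of_frame (hT : IsSelfAdjoint T)
    (z : ℂ) {K : H →L[ℂ] H} (hK : IsCompactOperator K)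
    (hK' : ∀ x : D.domain, K (D x - z • (x : H)) = x) {R : X →L[ℂ] X}
    (hR : ∀ x : X, ∃ hx : R x ∈ T.domain, T ⟨R x, hx⟩ - z • R x = x) : IsCompactOperator R := by
  have comp (i : ι) : IsCompactOperator ((ContinuousLinearMap.adjoint (b i)).comp R) := by
    obtain ⟨C₀, hC₀⟩ := (hb i).adjoint_of_isSelfAdjoint hD hT
    choose hRm hRz using hR
    choose hm hle using hC₀
    -- `bᵢ* R = K B` with the bounded operator `B = (D - z) bᵢ* R`.
    let B₀ : X →ₗ[ℂ] H :=
      { toFun := fun x => D ⟨_, hm ⟨R x, hRm x⟩⟩ - z • ContinuousLinearMap.adjoint (b i) (R x)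
        map_add' := fun x y => by
          have e : (⟨_, hm ⟨R (x + y), hRm (x + y)⟩⟩ : D.domain) =
              ⟨_, hm ⟨R x, hRm x⟩⟩ + ⟨_, hm ⟨R y, hRm y⟩⟩ := Subtype.ext (by
            simp only [Submodule.coe_add, _root_.map_add])
          rw [e, D.map_add, _root_.map_add, _root_.map_add, smul_add]
          abel
        map_smul' := fun c x => by
          have e : (⟨_, hm ⟨R (c • x), hRm (c • x)⟩⟩ : D.domain) =
              c • ⟨_, hm ⟨R x, hRm x⟩⟩ := Subtype.ext (by
            simp only [Submodule.coe_smul, _root_.map_smul])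
          rw [e, D.map_smul, _root_.map_smul, _root_.map_smul, RingHom.id_apply, smul_sub,
            smul_comm z c] }
    let B : X →L[ℂ] H := B₀.mkContinuous (‖ContinuousLinearMap.adjoint (b i)‖ + |C₀| * ‖R‖)
      fun x => by
        have e : B₀ x = (D ⟨_, hm ⟨R x, hRm x⟩⟩ - ContinuousLinearMap.adjoint (b i) (T ⟨R x, hRm x⟩)) +
            ContinuousLinearMap.adjoint (b i) x := by
          have h0 : ContinuousLinearMap.adjoint (b i) (T ⟨R x, hRm x⟩) =
              ContinuousLinearMap.adjoint (b i) x + z • ContinuousLinearMap.adjoint (b i) (R x) := by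
            rw [← _root_.map_smul, ← _root_.map_add, ← sub_eq_iff_eq_add.1 (hRz x)]
          rw [h0]
          change D _ - z • _ = _
          abel
        have h1 := (hle ⟨R x, hRm x⟩).trans
          (mul_le_mul_of_nonneg_right (le_abs_self C₀) (norm_nonneg (R x)))
        have h2 := mul_le_mul_of_nonneg_left (R.le_opNorm x) (abs_nonneg C₀)
        have h3 := (ContinuousLinearMap.adjoint (b i)).le_opNorm x
        rw [e]
        refine (norm_add_le _ _).trans ?_
        rw [add_mul, mul_assoc]
        linarith
    have e : ((ContinuousLinearMap.adjoint (b i)).comp R : X → H) = K ∘ B := funext fun x =>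
      (hK' ⟨_, hm ⟨R x, hRm x⟩⟩).symm
    rw [e]
    exact hK.comp_clm B
  have e : (R : X → X) = ∑ i, ((a i).comp ((ContinuousLinearMap.adjoint (b i)).comp R) : X → X) := by
    funext x
    rw [Finset.sum_apply]
    exact (hab (R x)).symm
  rw [e]
  refine Finset.sum_induction _ (fun f : X → X => IsCompactOperator f)
    (fun _ _ => IsCompactOperator.add) isCompactOperator_zero fun i _ => ?_
  exact (comp i).clm_comp (a i)

include hD hab ha hb in
theorem bounded_commutator_of_frame (hT : IsSelfAdjoint T) (M : X →L[ℂ] X)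
    (hM : ∀ i, AlmostIntertwines D T (M.comp (a i))) :
    ∃ C : ℝ, ∀ x : T.domain, ∃ h : M x ∈ T.domain, ‖T ⟨M x, h⟩ - M (T x)‖ ≤ C * ‖(x : X)‖ := by
  choose C₁ hC₁ using ha
  choose C₂ hC₂ using hM
  choose C₃ hC₃ using fun i => (hb i).adjoint_of_isSelfAdjoint hD hT
  refine ⟨∑ i, (|C₂ i| + ‖M‖ * |C₁ i|) * ‖ContinuousLinearMap.adjoint (b i)‖, fun x => ?_⟩
  let ξ (i : ι) : D.domain := ⟨_, (hC₃ i x).1⟩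
  have hx : x = ∑ i, (⟨a i (ξ i), (hC₁ i (ξ i)).1⟩ : T.domain) :=
    Subtype.ext (by rw [Submodule.coe_sum]; exact (hab x).symm)
  have hMx : M x = ((∑ i, (⟨M (a i (ξ i)), (hC₂ i (ξ i)).1⟩ : T.domain) : T.domain) : X) := by
    conv_lhs => rw [hx]
    rw [Submodule.coe_sum, _root_.map_sum, Submodule.coe_sum]
  have hmem : M x ∈ T.domain := hMx ▸ Subtype.coe_prop _
  refine ⟨hmem, ?_⟩
  have e1 : T ⟨M x, hmem⟩ = ∑ i, T ⟨M (a i (ξ i)), (hC₂ i (ξ i)).1⟩ := by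
    have : (⟨M x, hmem⟩ : T.domain) = ∑ i, ⟨M (a i (ξ i)), (hC₂ i (ξ i)).1⟩ := Subtype.ext hMx
    rw [this]
    exact _root_.map_sum T.toFun _ _
  have e2 : T x = ∑ i, T ⟨a i (ξ i), (hC₁ i (ξ i)).1⟩ := by
    conv_lhs => rw [hx]
    exact _root_.map_sum T.toFun _ _
  rw [e1, e2, _root_.map_sum, ← Finset.sum_sub_distrib, Finset.sum_mul]
  refine (norm_sum_le _ _).trans (Finset.sum_le_sum fun i _ => ?_)
  have h1 := (hC₁ i (ξ i)).2.trans
    (mul_le_mul_of_nonneg_right (le_abs_self (C₁ i)) (norm_nonneg (ξ i : H)))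
  have h2 := (hC₂ i (ξ i)).2.trans
    (mul_le_mul_of_nonneg_right (le_abs_self (C₂ i)) (norm_nonneg (ξ i : H)))
  have h3 : ‖(ξ i : H)‖ ≤ ‖ContinuousLinearMap.adjoint (b i)‖ * ‖(x : X)‖ :=
    (ContinuousLinearMap.adjoint (b i)).le_opNorm x
  have h4 : ‖M (T ⟨a i (ξ i), (hC₁ i (ξ i)).1⟩ - a i (D (ξ i)))‖ ≤
      ‖M‖ * (|C₁ i| * ‖(ξ i : H)‖) :=
    (M.le_opNorm _).trans (mul_le_mul_of_nonneg_left h1 (norm_nonneg M))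
  have e3 : T ⟨M (a i (ξ i)), (hC₂ i (ξ i)).1⟩ - M (T ⟨a i (ξ i), (hC₁ i (ξ i)).1⟩) =
      (T ⟨M (a i (ξ i)), (hC₂ i (ξ i)).1⟩ - M (a i (D (ξ i)))) -
        M (T ⟨a i (ξ i), (hC₁ i (ξ i)).1⟩ - a i (D (ξ i))) := by
    rw [_root_.map_sub]
    abel
  rw [e3]
  calc _ ≤ |C₂ i| * ‖(ξ i : H)‖ + ‖M‖ * (|C₁ i| * ‖(ξ i : H)‖) :=
        (norm_sub_le _ _).trans (add_le_add h2 h4)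
    _ = (|C₂ i| + ‖M‖ * |C₁ i|) * ‖(ξ i : H)‖ := by ring
    _ ≤ (|C₂ i| + ‖M‖ * |C₁ i|) * (‖ContinuousLinearMap.adjoint (b i)‖ * ‖(x : X)‖) := by gcongr
    _ = _ := by ring

end Frame

end LinearPMap

/-! ### Positivity of operator matrices -/

section Positivity

/-- A self-adjoint operator `G` is positive as soon as its form is nonnegative on the vectors
`p(G) w`, for all real polynomials `p` and all `w` in a set of vectors which determines operators:
approximating the negative part of `G` by polynomials shows that it vanishes. -/
theorem ContinuousLinearMap.nonneg_of_forall_polynomial {K : Type*} [NormedAddCommGroup K]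
    [InnerProductSpace ℂ K] [CompleteSpace K] {G : K →L[ℂ] K} (hG : IsSelfAdjoint G) (W : Set K)
    (hW : ∀ q : K →L[ℂ] K, (∀ w ∈ W, q w = 0) → q = 0)
    (h : ∀ p : Polynomial ℝ, ∀ w ∈ W,
      0 ≤ RCLike.re ⟪Polynomial.aeval G p w, G (Polynomial.aeval G p w)⟫_ℂ) : 0 ≤ G := by
  let f : ℝ → ℝ := fun t => max (-t) 0
  have hf : Continuous f := by fun_prop
  let g : ℝ → ℝ := fun t => f t * √(f t)
  have hg : Continuous g := by fun_prop
  let N := cfc f G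
  let Q := cfc g G
  -- The form is nonnegative on `N w`, where `N` is the negative part of `G`.
  have hN (w : K) (hw : w ∈ W) : 0 ≤ RCLike.re ⟪N w, G (N w)⟫_ℂ := by
    have hcl : IsClosed {T : K →L[ℂ] K | 0 ≤ RCLike.re ⟪T w, G (T w)⟫_ℂ} :=
      isClosed_le continuous_const (by fun_prop)
    refine hcl.closure_subset (Metric.mem_closure_iff.2 fun ε hε => ?_)
    obtain ⟨p, hp⟩ := exists_polynomial_near_of_continuousOn (-‖G‖) ‖G‖ f hf.continuousOn (ε / 2)
      (half_pos hε)
    refine ⟨Polynomial.aeval G p, h p w hw, ?_⟩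
    have e : N - Polynomial.aeval G p = cfc (fun t => f t - p.eval t) G := by
      rw [cfc_sub f (fun t => p.eval t) G hf.continuousOn p.continuous.continuousOn,
        cfc_polynomial p G]
    rw [dist_eq_norm, e]
    refine (norm_cfc_le (half_pos hε).le fun t ht => ?_).trans_lt (half_lt_self hε)
    rcases subsingleton_or_nontrivial K with hK | hK
    · have : Subsingleton (K →L[ℂ] K) := ⟨fun a b => ContinuousLinearMap.ext fun x =>
        Subsingleton.elim _ _⟩
      exact absurd ht (by simp [spectrum.of_subsingleton])
    · have := spectrum.norm_le_norm_of_mem ht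
      rw [Real.norm_eq_abs, abs_le] at this
      rw [Real.norm_eq_abs, abs_sub_comm]
      exact (hp t this).le
  have hNsa : IsSelfAdjoint N := cfc_predicate f G
  have hQsa : IsSelfAdjoint Q := cfc_predicate g G
  have hNGN : N * G * N = -(Q * Q) := by
    have e1 : N * G * N = cfc (fun t => f t * t * f t) G := by
      conv_lhs => rw [← cfc_id' ℝ G]
      rw [← cfc_mul f (fun t => t) G, ← cfc_mul (fun t => f t * t) f G]
    have e2 : Q * Q = cfc (fun t => g t * g t) G := (cfc_mul g g G).symm
    rw [e1, e2, ← cfc_neg]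
    congr 1
    funext t
    have hft : 0 ≤ f t := le_max_right _ _
    have h3 : f t * t = -(f t * f t) := by
      rcases le_total 0 t with ht | ht
      · have : f t = 0 := max_eq_right (by linarith)
        rw [this]; ring
      · have : f t = -t := max_eq_left (by linarith)
        rw [this]; ring
    calc f t * t * f t = -(f t * f t * f t) := by rw [h3]; ring
      _ = -(f t * f t * (√(f t) * √(f t))) := by rw [Real.mul_self_sqrt hft]
      _ = -(g t * g t) := by simp only [g]; ring
  have hQ0 : Q = 0 := hW Q fun w hw => by
    have h1 := hN w hw
    have e1 : ⟪N w, G (N w)⟫_ℂ = -⟪Q w, Q w⟫_ℂ := by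
      have a1 : ⟪N w, G (N w)⟫_ℂ = ⟪w, (N * G * N) w⟫_ℂ := by
        rw [← hNsa.adjoint_eq, ContinuousLinearMap.adjoint_inner_left, hNsa.adjoint_eq]
        rfl
      have a2 : ⟪Q w, Q w⟫_ℂ = ⟪w, (Q * Q) w⟫_ℂ := by
        conv_lhs => rw [← hQsa.adjoint_eq, ContinuousLinearMap.adjoint_inner_left, hQsa.adjoint_eq]
        rfl
      rw [a1, a2, hNGN, neg_apply, inner_neg_right]
    rw [e1, map_neg, inner_self_eq_norm_sq] at h1
    have h2 : ‖Q w‖ ^ 2 = 0 := le_antisymm (by linarith) (sq_nonneg _)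
    simpa using h2
  rw [StarOrderedRing.nonneg_iff_spectrum_nonneg (R := ℝ) G hG]
  intro t ht
  have hgt : g t ∈ spectrum ℝ Q := by
    rw [cfc_map_spectrum g G hG hg.continuousOn]
    exact ⟨t, ht, rfl⟩
  rw [hQ0] at hgt
  have hg0 : g t = 0 := by
    by_contra hne
    refine hgt ?_
    rw [spectrum.mem_resolventSet_iff, sub_zero]
    exact (IsUnit.mk0 _ hne).map _
  by_contra hneg
  push Not at hneg
  have hft : f t = -t := max_eq_left (by linarith)
  have : 0 < g t := by
    simp only [g, hft]
    have h1 : 0 < -t := by linarith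
    have h2 := Real.sqrt_pos.2 h1
    positivity
  exact this.ne' hg0

variable {H ι : Type*} [NormedAddCommGroup H] [InnerProductSpace ℂ H] [Fintype ι]

/-- The operator on `H ⊕ ⋯ ⊕ H` with a given matrix of operators. -/
def blockOp (c : ι → ι → H →L[ℂ] H) : PiLp 2 (fun _ : ι => H) →L[ℂ] PiLp 2 (fun _ : ι => H) :=
  ((PiLp.continuousLinearEquiv 2 ℂ fun _ : ι => H).symm :
      (ι → H) →L[ℂ] PiLp 2 (fun _ : ι => H)).comp
    (ContinuousLinearMap.pi fun i => ∑ j, (c i j).comp (PiLp.proj 2 (fun _ : ι => H) j))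

theorem blockOp_apply (c : ι → ι → H →L[ℂ] H) (x : PiLp 2 fun _ : ι => H) (i : ι) :
    blockOp c x i = ∑ j, c i j (x j) := by
  simp [blockOp]

theorem inner_blockOp (c : ι → ι → H →L[ℂ] H) (x y : PiLp 2 fun _ : ι => H) :
    ⟪x, blockOp c y⟫_ℂ = ∑ i, ∑ j, ⟪x i, c i j (y j)⟫_ℂ := by
  simp only [PiLp.inner_apply, blockOp_apply, inner_sum]

variable [CompleteSpace H]

theorem isSelfAdjoint_blockOp {c : ι → ι → H →L[ℂ] H}
    (hc : ∀ i j x y, ⟪c i j x, y⟫_ℂ = ⟪x, c j i y⟫_ℂ) : IsSelfAdjoint (blockOp c) := by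
  rw [ContinuousLinearMap.isSelfAdjoint_iff_isSymmetric]
  intro x y
  change ⟪blockOp c x, y⟫_ℂ = ⟪x, blockOp c y⟫_ℂ
  rw [inner_blockOp]
  simp only [PiLp.inner_apply, blockOp_apply, sum_inner, hc]
  exact Finset.sum_comm

set_option synthInstance.maxHeartbeats 100000 in
/-- A selfadjoint matrix over a real algebra of operators is positive if its form is nonnegative on
the columns `(π(aᵢ) x)ᵢ`. -/
theorem blockOp_nonneg {A : Type*} [Ring A] (π : A →+* (H →L[ℂ] H))
    (hreal : ∀ r : ℝ, ∃ a, π a = r • (1 : H →L[ℂ] H)) (m : ι → ι → A)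
    (hm : ∀ i j x y, ⟪π (m i j) x, y⟫_ℂ = ⟪x, π (m j i) y⟫_ℂ)
    (hpos : ∀ (a : ι → A) (x : H),
      0 ≤ RCLike.re (∑ i, ∑ j, ⟪π (a i) x, π (m i j) (π (a j) x)⟫_ℂ)) :
    0 ≤ blockOp fun i j => π (m i j) := by
  classical
  set G := blockOp fun i j => π (m i j) with hGdef
  -- Polynomials in `G` have matrices over `π(A)`.
  have col (p : Polynomial ℝ) (j : ι) : ∃ a : ι → A, ∀ x i,
      Polynomial.aeval G p (PiLp.single 2 j x) i = π (a i) x := by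
    induction p using Polynomial.induction_on' with
    | add p q hp hq =>
      obtain ⟨a, ha⟩ := hp
      obtain ⟨b, hb⟩ := hq
      refine ⟨a + b, fun x i => ?_⟩
      rw [_root_.map_add (Polynomial.aeval G) p q, add_apply, PiLp.add_apply, ha, hb,
        Pi.add_apply, map_add, add_apply]
    | monomial n r =>
      have pow (n : ℕ) : ∃ a : ι → A, ∀ x i, (G ^ n) (PiLp.single 2 j x) i = π (a i) x := by
        induction n with
        | zero =>
          refine ⟨Pi.single j 1, fun x i => ?_⟩
          rcases eq_or_ne i j with rfl | hij
          · simp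
          · simp [hij]
        | succ n ih =>
          obtain ⟨a, ha⟩ := ih
          refine ⟨fun i => ∑ k, m i k * a k, fun x i => ?_⟩
          rw [pow_succ', mul_apply_eq_comp, hGdef, blockOp_apply, map_sum,
            sum_apply]
          refine Finset.sum_congr rfl fun k _ => ?_
          rw [← hGdef, ha, map_mul, mul_apply_eq_comp]
      obtain ⟨a, ha⟩ := pow n
      obtain ⟨c, hc⟩ := hreal r
      refine ⟨fun i => c * a i, fun x i => ?_⟩
      rw [Polynomial.aeval_monomial, map_mul, hc, ← Algebra.smul_def, smul_mul_assoc, one_mul,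
        smul_apply, smul_apply, PiLp.smul_apply, ha]
  refine ContinuousLinearMap.nonneg_of_forall_polynomial (isSelfAdjoint_blockOp hm)
    {w | ∃ j x, w = PiLp.single 2 j x} (fun q hq => ?_) ?_
  · ext1 y
    have e : y = ∑ j, PiLp.single 2 j (y j) := by
      ext i
      simp
    rw [e, map_sum, zero_apply]
    exact Finset.sum_eq_zero fun j _ => hq _ ⟨j, _, rfl⟩
  · rintro p _ ⟨j, x, rfl⟩
    obtain ⟨a, ha⟩ := col p j
    rw [hGdef, inner_blockOp]
    simp only [← hGdef, ha]
    exact hpos a x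

end Positivity

/-! ### The inner product on the twisted space -/

theorem LinearIsometryEquiv.inner_map_map_antilinear {H : Type*} [NormedAddCommGroup H]
    [InnerProductSpace ℂ H] (J : H ≃ₗᵢ⋆[ℂ] H) (x y : H) : ⟪J x, J y⟫_ℂ = ⟪y, x⟫_ℂ := by
  have hre (x y : H) : (⟪J x, J y⟫_ℂ).re = (⟪x, y⟫_ℂ).re := by
    have h1 := norm_add_sq (𝕜 := ℂ) x y
    have h2 := norm_add_sq (𝕜 := ℂ) (J x) (J y)
    rw [← map_add, J.norm_map, J.norm_map, J.norm_map, h1] at h2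
    have h3 : RCLike.re ⟪x, y⟫_ℂ = RCLike.re ⟪J x, J y⟫_ℂ := by linarith
    exact h3.symm
  have him (z : H) : (⟪z, x⟫_ℂ).im = (⟪z, Complex.I • x⟫_ℂ).re * -1 := by
    rw [inner_smul_right]
    simp
  rw [← inner_conj_symm (J x)]
  apply Complex.ext
  · rw [Complex.conj_re, hre]
  · have h1 := hre y (Complex.I • x)
    rw [LinearIsometryEquiv.map_smulₛₗ, inner_smul_right, inner_smul_right] at h1
    have h2 : (⟪J y, J x⟫_ℂ).im = -(⟪y, x⟫_ℂ).im := by simpa using h1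
    rw [Complex.conj_im, h2, neg_neg]

namespace RealSpectralTriple

variable {𝕜 A H E : Type*} [RCLike 𝕜] [Ring A]
    [StarRing A] [Algebra 𝕜 A] [StarModule 𝕜 A] [NormedAddCommGroup H] [InnerProductSpace ℂ H]
    [CompleteSpace H] (S : RealSpectralTriple 𝕜 A H) [AddCommGroup E] [Module 𝕜 E]
    [Module Aᵐᵒᵖ E] [IsScalarTower 𝕜 Aᵐᵒᵖ E]

theorem inner_π (a : A) (x y : H) : ⟪S.π a x, y⟫_ℂ = ⟪x, S.π (star a) y⟫_ℂ := by
  rw [S.π_star, ContinuousLinearMap.adjoint_inner_right]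

/-- Right multiplication by an element of `A`, as a bounded operator. -/
def rightOp (b : A) : H →L[ℂ] H :=
  (S.J.toContinuousLinearEquiv : H →L⋆[ℂ] H).comp
    ((S.π (star b)).comp (S.J.symm.toContinuousLinearEquiv : H →L⋆[ℂ] H))

theorem rightOp_apply (b : A) (x : H) : S.rightOp b x = S.J (S.π (star b) (S.J.symm x)) := rfl

theorem rightOp_J (b : A) (x : H) : S.rightOp b (S.J x) = S.J (S.π (star b) x) := by
  rw [rightOp_apply, S.J.symm_apply_apply]

theorem π_rightOp (a b : A) (x : H) : S.π a (S.rightOp b x) = S.rightOp b (S.π a x) :=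
  S.commutant a (star b) x

theorem inner_rightOp (b : A) (x y : H) :
    ⟪S.rightOp b x, y⟫_ℂ = ⟪x, S.rightOp (star b) y⟫_ℂ := by
  obtain ⟨x, rfl⟩ := S.J.surjective x
  obtain ⟨y, rfl⟩ := S.J.surjective y
  rw [rightOp_J, rightOp_J, LinearIsometryEquiv.inner_map_map_antilinear,
    LinearIsometryEquiv.inner_map_map_antilinear, inner_π, star_star]

variable {S} (h : HermitianStructure S E)

theorem exists_π_eq_real_smul (r : ℝ) : ∃ a : A, S.π a = r • (1 : H →L[ℂ] H) := by
  refine ⟨algebraMap 𝕜 A (r : 𝕜), ?_⟩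
  rw [S.π_algebraMap]
  ext x
  simp

theorem leftBlock_nonneg {ι : Type*} [Fintype ι] (e : ι → E) :
    0 ≤ blockOp fun i j => S.π (h.form (e i) (e j)) := by
  refine blockOp_nonneg S.π exists_π_eq_real_smul (fun i j => h.form (e i) (e j))
    (fun i j x y => ?_) (fun a x => ?_)
  · rw [S.inner_π, h.star_form]
  · -- The sum is `⟪x, (v|v) x⟫` for `v = ∑ eᵢ aᵢ`.
    have key : ∑ i, ∑ j, ⟪S.π (a i) x, S.π (h.form (e i) (e j)) (S.π (a j) x)⟫_ℂ =
        ⟪x, S.π (h.form (∑ i, MulOpposite.op (a i) • e i) (∑ i, MulOpposite.op (a i) • e i)) x⟫_ℂ := by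
      simp only [map_sum, AddMonoidHom.finsetSum_apply, h.form_op_smul, h.op_smul_form, map_mul,
        sum_apply, inner_sum, mul_apply_eq_comp, S.inner_π]
      exact Finset.sum_comm
    rw [key]
    exact (h.form_nonneg _).re_inner_nonneg_right x

theorem rightBlock_nonneg {ι : Type*} [Fintype ι] (e : ι → E) :
    0 ≤ blockOp fun k l => S.rightOp (h.form (e l) (e k)) := by
  rw [ContinuousLinearMap.nonneg_iff_isPositive, ContinuousLinearMap.isPositive_def]
  refine ⟨(ContinuousLinearMap.isSelfAdjoint_iff_isSymmetric).1
    (isSelfAdjoint_blockOp fun k l x y => by rw [inner_rightOp, h.star_form]), fun x => ?_⟩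
  have hl := (ContinuousLinearMap.nonneg_iff_isPositive _).1 (leftBlock_nonneg h e)
  have h1 := hl.re_inner_nonneg_right (WithLp.toLp 2 fun k => S.J.symm (x k))
  rw [inner_blockOp] at h1
  rw [ContinuousLinearMap.reApplyInnerSelf_apply, ← inner_re_symm, inner_blockOp]
  convert h1 using 1
  rw [map_sum, map_sum]
  refine Finset.sum_congr rfl fun k _ => ?_
  rw [map_sum, map_sum]
  refine Finset.sum_congr rfl fun l _ => ?_
  obtain ⟨y, hy⟩ := S.J.surjective (x k)
  obtain ⟨z, hz⟩ := S.J.surjective (x l)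
  simp only [← hy, ← hz, S.J.symm_apply_apply]
  rw [rightOp_J, LinearIsometryEquiv.inner_map_map_antilinear, h.star_form, inner_re_symm]

set_option synthInstance.maxHeartbeats 100000 in
/-- The left and the right Gram matrices are commuting positive operator matrices; the square root of
the second one still commutes with the left action. -/
theorem gram_form_nonneg {ι : Type*} [Fintype ι] (e : ι → E) (ξ : ι → ι → H) :
    0 ≤ RCLike.re (∑ i, ∑ j, ∑ k, ∑ l, ⟪ξ i k, S.π (h.form (e i) (e j))
      (S.rightOp (h.form (e l) (e k)) (ξ j l))⟫_ℂ) := by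
  classical
  set R := blockOp fun k l => S.rightOp (h.form (e l) (e k)) with hR
  have hR0 : 0 ≤ R := rightBlock_nonneg h e
  set Q := CFC.sqrt R with hQ
  have hQQ : Q * Q = R := CFC.sqrt_mul_sqrt_self R hR0
  have hQsa : IsSelfAdjoint Q := (CFC.sqrt_nonneg R).isSelfAdjoint
  let Δ (a : A) : PiLp 2 (fun _ : ι => H) →L[ℂ] PiLp 2 (fun _ : ι => H) :=
    blockOp fun k l => if k = l then S.π a else 0
  have hΔ (a : A) (x : PiLp 2 fun _ : ι => H) (k : ι) : Δ a x k = S.π a (x k) := by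
    rw [blockOp_apply, Finset.sum_eq_single k]
    · rw [if_pos rfl]
    · intro l _ hl
      rw [if_neg hl.symm, zero_apply]
    · simp
  have comm (a : A) : Commute R (Δ a) := by
    refine ContinuousLinearMap.ext fun x => ?_
    ext k
    rw [mul_apply_eq_comp, mul_apply_eq_comp, hΔ, hR, blockOp_apply, blockOp_apply, map_sum]
    refine Finset.sum_congr rfl fun l _ => ?_
    rw [hΔ, π_rightOp]
  have commQ (a : A) : Commute Q (Δ a) := (comm a).cfcₙ_nnreal _
  let Ξ (i : ι) : PiLp 2 fun _ : ι => H := WithLp.toLp 2 (ξ i)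
  have e1 (i j : ι) : ∑ k, ∑ l, ⟪ξ i k, S.π (h.form (e i) (e j))
      (S.rightOp (h.form (e l) (e k)) (ξ j l))⟫_ℂ =
        ∑ k, ⟪Q (Ξ i) k, S.π (h.form (e i) (e j)) (Q (Ξ j) k)⟫_ℂ := by
    have e2 : ⟪Ξ i, Δ (h.form (e i) (e j)) (R (Ξ j))⟫_ℂ =
        ⟪Q (Ξ i), Δ (h.form (e i) (e j)) (Q (Ξ j))⟫_ℂ := by
      conv_rhs => rw [← hQsa.adjoint_eq, ContinuousLinearMap.adjoint_inner_left, hQsa.adjoint_eq]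
      rw [← mul_apply_eq_comp, ← mul_apply_eq_comp, ← mul_apply_eq_comp, ← hQQ, ← mul_assoc,
        (commQ _).eq]
    rw [PiLp.inner_apply, PiLp.inner_apply] at e2
    simp only [hΔ] at e2
    rw [← e2]
    refine Finset.sum_congr rfl fun k _ => ?_
    rw [hR, blockOp_apply, map_sum, inner_sum]
  simp only [e1]
  have e3 : ∑ i, ∑ j, ∑ k, ⟪Q (Ξ i) k, S.π (h.form (e i) (e j)) (Q (Ξ j) k)⟫_ℂ =
      ∑ k, ∑ i, ∑ j, ⟪Q (Ξ i) k, S.π (h.form (e i) (e j)) (Q (Ξ j) k)⟫_ℂ := by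
    exact (Finset.sum_congr rfl fun i _ => Finset.sum_comm).trans Finset.sum_comm
  rw [e3, map_sum]
  refine Finset.sum_nonneg fun k _ => ?_
  have hl := (ContinuousLinearMap.nonneg_iff_isPositive _).1 (leftBlock_nonneg h e)
  have h1 := hl.re_inner_nonneg_right (WithLp.toLp 2 fun i => Q (Ξ i) k)
  rwa [inner_blockOp] at h1

end RealSpectralTriple

namespace BTensor

variable {A M N ι : Type*} [Ring A] [AddCommGroup M] [AddCommGroup N] [Module Aᵐᵒᵖ M] [Module A N]

theorem sum_tmul (s : Finset ι) (g : ι → M) (y : N) :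
    tmul A (∑ i ∈ s, g i) y = ∑ i ∈ s, tmul A (g i) y :=
  map_sum ((mk A M N).flip y) g s

theorem tmul_sum (s : Finset ι) (x : M) (g : ι → N) :
    tmul A x (∑ i ∈ s, g i) = ∑ i ∈ s, tmul A x (g i) :=
  map_sum (mk A M N x) g s

end BTensor

namespace RealSpectralTriple

variable {𝕜 A H E : Type*} [RCLike 𝕜] [Ring A]
    [StarRing A] [Algebra 𝕜 A] [StarModule 𝕜 A] [NormedAddCommGroup H] [InnerProductSpace ℂ H]
    [CompleteSpace H] (S : RealSpectralTriple 𝕜 A H) [AddCommGroup E] [Module 𝕜 E]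
    [Module Aᵐᵒᵖ E] [IsScalarTower 𝕜 Aᵐᵒᵖ E]

omit [Module 𝕜 E] [IsScalarTower 𝕜 Aᵐᵒᵖ E] in
theorem twist_induction {p : S.TwistSpace E → Prop} (x : S.TwistSpace E) (h0 : p 0)
    (ht : ∀ v ξ w, p (S.elem v ξ w)) (ha : ∀ x y, p x → p y → p (x + y)) : p x := by
  induction x using BTensor.induction_on with
  | h0 => exact h0
  | ha x y hx hy => exact ha x y hx hy
  | ht y f =>
    induction y using BTensor.induction_on with
    | h0 => rw [BTensor.zero_tmul]; exact h0
    | ha y z hy hz => rw [BTensor.add_tmul]; exact ha _ _ hy hz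
    | ht v ξ => exact ht v (S.vec.symm ξ) (ConjModule.bar.symm f)

/-- The elementary tensor with given outer factors, as a linear map in the middle factor. -/
def elemₗ (v w : E) : H →ₗ[ℂ] S.TwistSpace E where
  toFun ξ := S.elem v ξ w
  map_add' ξ η := by
    simp only [elem, map_add, BTensor.tmul_add, BTensor.add_tmul]
  map_smul' _ _ := rfl

omit [Module 𝕜 E] [IsScalarTower 𝕜 Aᵐᵒᵖ E] in
theorem elemₗ_apply (v w : E) (ξ : H) : S.elemₗ v w ξ = S.elem v ξ w := rfl

omit [Module 𝕜 E] [IsScalarTower 𝕜 Aᵐᵒᵖ E] in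
theorem smul_elem (c : ℂ) (v w : E) (ξ : H) : c • S.elem v ξ w = S.elem v (c • ξ) w := rfl

omit [Module 𝕜 E] [IsScalarTower 𝕜 Aᵐᵒᵖ E] in
theorem elem_op_smul_left (v w : E) (a : A) (ξ : H) :
    S.elem (MulOpposite.op a • v) ξ w = S.elem v (S.π a ξ) w :=
  congrArg (BTensor.tmul A · (ConjModule.bar w)) (BTensor.smul_tmul v a (S.vec ξ))

omit [Module 𝕜 E] [IsScalarTower 𝕜 Aᵐᵒᵖ E] in
theorem elem_op_smul_right (v w : E) (a : A) (ξ : H) :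
    S.elem v ξ (MulOpposite.op a • w) = S.elem v (S.rightOp (star a) ξ) w := by
  have e : ConjModule.bar (MulOpposite.op a • w) = star a • ConjModule.bar w := by
    rw [ConjModule.smul_bar, star_star]
  rw [elem, e, ← BTensor.smul_tmul]
  rfl

/-- The inner product of `H`, as a pairing on the bimodule `H`. -/
noncomputable def innerHom : S.Space →+ S.Space →+ ℂ :=
  AddMonoidHom.mk' (fun x => AddMonoidHom.mk' (fun y => ⟪S.vec.symm x, S.vec.symm y⟫_ℂ)
      (fun y y' => by rw [map_add, inner_add_right]))
    (fun x x' => AddMonoidHom.ext fun y => by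
      change ⟪S.vec.symm (x + x'), S.vec.symm y⟫_ℂ = _
      rw [map_add, inner_add_left]
      rfl)

theorem innerHom_smul (a : A) (x y : S.Space) :
    S.innerHom (a • x) y = S.innerHom x (star a • y) :=
  S.inner_π a (S.vec.symm x) (S.vec.symm y)

theorem innerHom_op_smul (a : A) (x y : S.Space) :
    S.innerHom (MulOpposite.op a • x) y = S.innerHom x (MulOpposite.op (star a) • y) :=
  S.inner_rightOp a (S.vec.symm x) (S.vec.symm y)

variable {S} (h : HermitianStructure S E)

theorem leftPairing_op_smul (a : A) (x y : BTensor A E S.Space) :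
    h.leftPairing S.innerHom S.innerHom_smul (MulOpposite.op a • x) y =
      h.leftPairing S.innerHom S.innerHom_smul x (MulOpposite.op (star a) • y) := by
  induction x using BTensor.induction_on with
  | h0 => simp
  | ha x x' hx hx' => simp only [smul_add, map_add, AddMonoidHom.add_apply, hx, hx']
  | ht v ξ =>
    induction y using BTensor.induction_on with
    | h0 => simp
    | ha y y' hy hy' => simp only [smul_add, map_add, hy, hy']
    | ht w η =>
      rw [BTensor.op_smul_tmul, BTensor.op_smul_tmul, h.leftPairing_tmul, h.leftPairing_tmul,
        innerHom_op_smul, smul_comm (h.form v w)]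

/-- The inner product on `E ⊗_A H ⊗_A Ē`, as a biadditive pairing. -/
noncomputable def twistPairing : S.TwistSpace E →+ S.TwistSpace E →+ ℂ :=
  h.rightPairing (h.leftPairing S.innerHom S.innerHom_smul) (leftPairing_op_smul h)

theorem twistPairing_elem (v₁ w₁ v₂ w₂ : E) (ξ η : H) :
    twistPairing h (S.elem v₁ ξ v₂) (S.elem w₁ η w₂) =
      ⟪ξ, S.π (h.form v₁ w₁) (S.rightOp (h.form w₂ v₂) η)⟫_ℂ := by
  rw [twistPairing, elem, elem, h.rightPairing_tmul, BTensor.op_smul_tmul, h.leftPairing_tmul]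
  rfl

theorem twistPairing_symm (x y : S.TwistSpace E) :
    (starRingEnd ℂ) (twistPairing h y x) = twistPairing h x y := by
  induction x using S.twist_induction with
  | h0 => simp
  | ha x x' hx hx' => simp only [map_add, AddMonoidHom.add_apply, hx, hx']
  | ht v₁ ξ v₂ =>
    induction y using S.twist_induction with
    | h0 => simp
    | ha y y' hy hy' => simp only [map_add, AddMonoidHom.add_apply, hy, hy']
    | ht w₁ η w₂ =>
      rw [twistPairing_elem, twistPairing_elem, inner_conj_symm, S.inner_π, S.inner_rightOp,
        h.star_form, h.star_form, π_rightOp]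

theorem twistPairing_smul_right (c : ℂ) (x y : S.TwistSpace E) :
    twistPairing h x (c • y) = c * twistPairing h x y := by
  induction x using S.twist_induction with
  | h0 => simp
  | ha x x' hx hx' => simp only [map_add, AddMonoidHom.add_apply, hx, hx', mul_add]
  | ht v₁ ξ v₂ =>
    induction y using S.twist_induction with
    | h0 => simp
    | ha y y' hy hy' => simp only [smul_add, map_add, hy, hy', mul_add]
    | ht w₁ η w₂ =>
      rw [smul_elem, twistPairing_elem, twistPairing_elem, map_smul, map_smul, inner_smul_right]

theorem twistPairing_smul_left (c : ℂ) (x y : S.TwistSpace E) :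
    twistPairing h (c • x) y = (starRingEnd ℂ) c * twistPairing h x y := by
  rw [← twistPairing_symm, twistPairing_smul_right, map_mul, twistPairing_symm]

/-- The map `v₁ ⊗ ξ ↦ (v|v₁) ξ`. -/
def contractLeft (v : E) : BTensor A E S.Space →+ S.Space :=
  BTensor.lift (AddMonoidHom.mk' (fun v₁ => DistribSMul.toAddMonoidHom S.Space (h.form v v₁))
      (fun v₁ v₂ => AddMonoidHom.ext fun ξ => by simp [add_smul]))
    (fun v₁ a ξ => by simp [h.form_op_smul, mul_smul])

theorem contractLeft_tmul (v v₁ : E) (ξ : S.Space) :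
    contractLeft h v (BTensor.tmul A v₁ ξ) = h.form v v₁ • ξ := by simp [contractLeft]

theorem contractLeft_op_smul (v : E) (a : A) (x : BTensor A E S.Space) :
    contractLeft h v (MulOpposite.op a • x) = MulOpposite.op a • contractLeft h v x := by
  induction x using BTensor.induction_on with
  | h0 => simp
  | ht w ξ => rw [BTensor.op_smul_tmul, contractLeft_tmul, contractLeft_tmul, smul_comm]
  | ha x y hx hy => simp only [smul_add, map_add, hx, hy]

/-- The map `v₁ ⊗ ξ ⊗ v̄₂ ↦ (v|v₁) ξ (v₂|w)`, the adjoint of `ξ ↦ v ⊗ ξ ⊗ w̄`. -/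
def contract (v w : E) : S.TwistSpace E →+ H :=
  S.vec.symm.toAddMonoidHom.comp <|
    BTensor.lift (AddMonoidHom.mk' (fun x => AddMonoidHom.mk' (fun f =>
          MulOpposite.op (h.form (ConjModule.bar.symm f) w) • contractLeft h v x)
        (fun f f' => by
          rw [map_add, map_add, AddMonoidHom.add_apply, MulOpposite.op_add, add_smul]))
      (fun x x' => AddMonoidHom.ext fun f => by
        change MulOpposite.op (h.form (ConjModule.bar.symm f) w) • contractLeft h v (x + x') = _
        rw [map_add, smul_add]
        rfl))
    (fun x a f => by
      change MulOpposite.op (h.form (ConjModule.bar.symm f) w) •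
          contractLeft h v (MulOpposite.op a • x) =
        MulOpposite.op (h.form (MulOpposite.op (star a) • ConjModule.bar.symm f) w) •
          contractLeft h v x
      rw [contractLeft_op_smul, h.op_smul_form, star_star, MulOpposite.op_mul, mul_smul])

theorem contract_elem (v w v₁ v₂ : E) (ξ : H) :
    contract h v w (S.elem v₁ ξ v₂) = S.π (h.form v v₁) (S.rightOp (h.form v₂ w) ξ) := by
  rw [π_rightOp]
  rfl

theorem twistPairing_elem_left (v w : E) (ξ : H) (x : S.TwistSpace E) :
    twistPairing h (S.elem v ξ w) x = ⟪ξ, contract h v w x⟫_ℂ := by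
  induction x using S.twist_induction with
  | h0 => simp
  | ha x x' hx hx' => rw [map_add, map_add, inner_add_right, hx, hx']
  | ht v₁ η v₂ => rw [twistPairing_elem, contract_elem]

/-- A pair of dual families `e`, `f` of `E`: every `v` is `∑ eᵢ (fᵢ|v)`. -/
theorem exists_frame [Module.Finite Aᵐᵒᵖ E] [Module.Projective Aᵐᵒᵖ E] :
    ∃ (n : ℕ) (e f : Fin n → E), ∀ v, ∑ i, MulOpposite.op (h.form (f i) v) • e i = v := by
  obtain ⟨n, p, s, -, -, hps⟩ := Module.Finite.exists_comp_eq_id_of_projective Aᵐᵒᵖ E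
  let φ (i : Fin n) : E →ₗ[Aᵐᵒᵖ] A :=
    { toFun := fun v => (s v i).unop
      map_add' := fun v w => by simp
      map_smul' := fun a v => by simp }
  choose f hf using fun i => h.selfDual (φ i)
  refine ⟨n, fun i => p (Pi.single i 1), f, fun v => ?_⟩
  have hv : p (s v) = v := LinearMap.congr_fun hps v
  conv_rhs => rw [← hv, ← Finset.univ_sum_single (s v), map_sum]
  refine Finset.sum_congr rfl fun i _ => ?_
  rw [← hf, ← map_smul, ← Pi.single_smul]
  simp [φ]

section Frame

variable {n : ℕ} {e f : Fin n → E}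
    (hef : ∀ v, ∑ i, MulOpposite.op (h.form (f i) v) • e i = v)

include hef

theorem sum_elem_contract (x : S.TwistSpace E) :
    ∑ i, ∑ k, S.elem (e i) (contract h (f i) (f k) x) (e k) = x := by
  induction x using S.twist_induction with
  | h0 => simp [← elemₗ_apply]
  | ha x y hx hy =>
    conv_rhs => rw [← hx, ← hy]
    simp only [map_add, ← elemₗ_apply, Finset.sum_add_distrib]
  | ht v ξ w =>
    have e1 (i k : Fin n) : S.elem (e i) (contract h (f i) (f k) (S.elem v ξ w)) (e k) =
        S.elem (MulOpposite.op (h.form (f i) v) • e i) ξ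
          (MulOpposite.op (h.form (f k) w) • e k) := by
      rw [contract_elem, elem_op_smul_left, elem_op_smul_right, h.star_form, π_rightOp]
    simp only [e1]
    conv_rhs => rw [← hef v, ← hef w]
    simp only [elem, map_sum, BTensor.sum_tmul, BTensor.tmul_sum]
    exact Finset.sum_comm

theorem twistPairing_nonneg (x : S.TwistSpace E) : 0 ≤ RCLike.re (twistPairing h x x) := by
  have h1 := gram_form_nonneg h e fun i k => contract h (f i) (f k) x
  convert h1 using 2
  conv_lhs => rw [← sum_elem_contract h hef x]
  simp only [map_sum, AddMonoidHom.finsetSum_apply, twistPairing_elem]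
  exact (Finset.sum_congr rfl fun j _ => Finset.sum_comm).trans (Finset.sum_comm.trans
    (Finset.sum_congr rfl fun i _ => Finset.sum_congr rfl fun j _ => Finset.sum_comm))

/-- The inner product space structure of `E ⊗_A H ⊗_A Ē`. -/
@[reducible] noncomputable def twistCore : InnerProductSpace.Core ℂ (S.TwistSpace E) :=
  let pre : PreInnerProductSpace.Core ℂ (S.TwistSpace E) :=
    { inner := fun x y => twistPairing h x y
      conj_inner_symm := twistPairing_symm h
      re_inner_nonneg := twistPairing_nonneg h hef
      add_left := fun x y z => by rw [map_add, AddMonoidHom.add_apply]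
      smul_left := fun x y c => twistPairing_smul_left h c x y }
  { pre with
    definite := fun x hx => by
      have key (y : S.TwistSpace E) : twistPairing h y x = 0 := by
        have h1 : ‖twistPairing h y x‖ * ‖twistPairing h x y‖ ≤
            RCLike.re (twistPairing h y y) * RCLike.re (twistPairing h x x) :=
          @InnerProductSpace.Core.inner_mul_inner_self_le ℂ _ _ _ _ pre y x
        have h2 : twistPairing h x x = 0 := hx
        rw [← twistPairing_symm h x y, RCLike.norm_conj, h2, map_zero, mul_zero] at h1
        exact norm_eq_zero.1 (mul_self_eq_zero.1 (le_antisymm h1 (mul_self_nonneg _)))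
      have h2 (i k : Fin n) : contract h (f i) (f k) x = 0 := by
        have h3 := key (S.elem (f i) (contract h (f i) (f k) x) (f k))
        rw [twistPairing_elem_left] at h3
        exact inner_self_eq_zero.1 h3
      rw [← sum_elem_contract h hef x]
      simp [h2, ← elemₗ_apply] }

end Frame

section Realization

/-! The twisted space is studied through a linear isomorphism `Φ` onto an inner product space which
realizes its pairing. -/

variable {X : Type*} [NormedAddCommGroup X] [InnerProductSpace ℂ X] (Φ : S.TwistSpace E ≃ₗ[ℂ] X)
    (hΦ : ∀ x y, ⟪Φ x, Φ y⟫_ℂ = twistPairing h x y)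

include hΦ in
theorem norm_elem_le (v w : E) (ξ : H) : ‖Φ (S.elem v ξ w)‖ ≤
    √‖(S.π (h.form v v)).comp (S.rightOp (h.form w w))‖ * ‖ξ‖ := by
  set B := (S.π (h.form v v)).comp (S.rightOp (h.form w w)) with hB
  have h1 : ‖Φ (S.elem v ξ w)‖ ^ 2 = RCLike.re ⟪ξ, B ξ⟫_ℂ := by
    rw [← inner_self_eq_norm_sq (𝕜 := ℂ), hΦ, twistPairing_elem]
    rfl
  have h2 : RCLike.re ⟪ξ, B ξ⟫_ℂ ≤ ‖B‖ * ‖ξ‖ ^ 2 :=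
    calc _ ≤ ‖⟪ξ, B ξ⟫_ℂ‖ := RCLike.re_le_norm _
      _ ≤ ‖ξ‖ * ‖B ξ‖ := norm_inner_le_norm _ _
      _ ≤ ‖ξ‖ * (‖B‖ * ‖ξ‖) := by gcongr; exact B.le_opNorm ξ
      _ = _ := by ring
  refine le_of_sq_le_sq ?_ (by positivity)
  rw [mul_pow, Real.sq_sqrt (norm_nonneg B), h1]
  exact h2

/-- The bounded operator `ξ ↦ v ⊗ ξ ⊗ w̄`. -/
noncomputable def elemL (v w : E) : H →L[ℂ] X :=
  (Φ.toLinearMap ∘ₗ S.elemₗ v w).mkContinuous _ (norm_elem_le h Φ hΦ v w)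

theorem elemL_apply (v w : E) (ξ : H) : elemL h Φ hΦ v w ξ = Φ (S.elem v ξ w) := rfl

include hΦ in
theorem norm_contract_le (v w : E) (x : S.TwistSpace E) :
    ‖contract h v w x‖ ≤ ‖elemL h Φ hΦ v w‖ * ‖Φ x‖ := by
  set y := contract h v w x with hy
  have h1 : ‖y‖ * ‖y‖ ≤ ‖elemL h Φ hΦ v w‖ * ‖Φ x‖ * ‖y‖ := by
    have e : ⟪elemL h Φ hΦ v w y, Φ x⟫_ℂ = ⟪y, y⟫_ℂ := by
      rw [elemL_apply, hΦ, twistPairing_elem_left]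
    calc ‖y‖ * ‖y‖ = ‖⟪elemL h Φ hΦ v w y, Φ x⟫_ℂ‖ := by
          rw [e, inner_self_eq_norm_sq_to_K]
          simp [sq]
      _ ≤ ‖elemL h Φ hΦ v w y‖ * ‖Φ x‖ := norm_inner_le_norm _ _
      _ ≤ ‖elemL h Φ hΦ v w‖ * ‖y‖ * ‖Φ x‖ := by
        gcongr
        exact ContinuousLinearMap.le_opNorm _ _
      _ = _ := by ring
  rcases eq_or_lt_of_le (norm_nonneg y) with h0 | h0
  · rw [← h0]
    positivity
  · exact le_of_mul_le_mul_right h1 h0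

include hΦ in
/-- The maps `elemL` and `contract` are bounded, and a frame expresses `1` as a finite sum of products
of the two, so a Cauchy sequence converges as soon as its coordinates in `H` do. -/
theorem completeSpace_twist [Module.Finite Aᵐᵒᵖ E] [Module.Projective Aᵐᵒᵖ E] :
    CompleteSpace X := by
  obtain ⟨n, e, f, hef⟩ := exists_frame h
  refine Metric.complete_of_cauchySeq_tendsto fun u hu => ?_
  have hc (i k : Fin n) : ∃ ξ, Filter.Tendsto (fun m => contract h (f i) (f k) (Φ.symm (u m)))
      Filter.atTop (nhds ξ) := by
    refine cauchySeq_tendsto_of_complete ?_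
    have hb (x : X) : ‖((contract h (f i) (f k)).comp Φ.symm.toLinearMap.toAddMonoidHom) x‖ ≤
        ‖elemL h Φ hΦ (f i) (f k)‖ * ‖x‖ := by
      have := norm_contract_le h Φ hΦ (f i) (f k) (Φ.symm x)
      rwa [Φ.apply_symm_apply] at this
    exact hu.map (AddMonoidHomClass.uniformContinuous_of_bound _ _ hb)
  choose ξ hξ using hc
  refine ⟨∑ i, ∑ k, elemL h Φ hΦ (e i) (e k) (ξ i k), ?_⟩
  have e1 : u = fun m => ∑ i, ∑ k, elemL h Φ hΦ (e i) (e k)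
      (contract h (f i) (f k) (Φ.symm (u m))) := by
    funext m
    simp only [elemL_apply, ← map_sum]
    rw [sum_elem_contract h hef, Φ.apply_symm_apply]
  rw [e1]
  refine tendsto_finsetSum _ fun i _ => tendsto_finsetSum _ fun k _ => ?_
  exact ((elemL h Φ hΦ (e i) (e k)).continuous.tendsto _).comp (hξ i k)

variable [CompleteSpace X]

theorem adjoint_elemL (v w : E) (x : S.TwistSpace E) :
    ContinuousLinearMap.adjoint (elemL h Φ hΦ v w) (Φ x) = contract h v w x := by
  refine ext_inner_left ℂ fun ξ => ?_
  rw [ContinuousLinearMap.adjoint_inner_right, elemL_apply, hΦ, twistPairing_elem_left]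

end Realization

end RealSpectralTriple

/-! ### The twisted Dirac operator up to bounded terms -/

namespace RealSpectralTriple

variable {𝕜 A H E : Type*} [RCLike 𝕜] [Ring A]
    [StarRing A] [Algebra 𝕜 A] [StarModule 𝕜 A] [NormedAddCommGroup H] [InnerProductSpace ℂ H]
    [CompleteSpace H] (S : RealSpectralTriple 𝕜 A H) [AddCommGroup E] [Module 𝕜 E]
    [Module Aᵐᵒᵖ E] [IsScalarTower 𝕜 Aᵐᵒᵖ E]

/-- The norm of a vector of the domain, as a vector of `H`. -/
noncomputable def domNorm (ξ : S.Dom) : ℝ := ‖S.vec.symm (S.incl ξ)‖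

theorem domNorm_nonneg (ξ : S.Dom) : 0 ≤ S.domNorm ξ := norm_nonneg _

/-- A map from the domain of the Dirac operator which is bounded for the norm of `H`. -/
def IsBddOnDom {X : Type*} [NormedAddCommGroup X] (g : S.Dom → X) : Prop :=
  ∃ C : ℝ, ∀ ξ, ‖g ξ‖ ≤ C * S.domNorm ξ

namespace IsBddOnDom

variable {S} {X : Type*} [NormedAddCommGroup X] {g g' : S.Dom → X}

theorem congr (hg : S.IsBddOnDom g) (e : ∀ ξ, g' ξ = g ξ) : S.IsBddOnDom g' :=
  (funext e : g' = g) ▸ hg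

theorem zero : S.IsBddOnDom fun _ => (0 : X) := ⟨0, fun ξ => by simp⟩

theorem add (hg : S.IsBddOnDom g) (hg' : S.IsBddOnDom g') : S.IsBddOnDom fun ξ => g ξ + g' ξ := by
  obtain ⟨C, hC⟩ := hg
  obtain ⟨C', hC'⟩ := hg'
  refine ⟨C + C', fun ξ => (norm_add_le _ _).trans ?_⟩
  rw [add_mul]
  exact add_le_add (hC ξ) (hC' ξ)

theorem neg (hg : S.IsBddOnDom g) : S.IsBddOnDom fun ξ => -g ξ := by
  obtain ⟨C, hC⟩ := hg
  exact ⟨C, fun ξ => by rw [norm_neg]; exact hC ξ⟩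

theorem sub (hg : S.IsBddOnDom g) (hg' : S.IsBddOnDom g') : S.IsBddOnDom fun ξ => g ξ - g' ξ := by
  simpa only [sub_eq_add_neg] using hg.add hg'.neg

theorem clm_comp {Y : Type*} [NormedAddCommGroup Y] [NormedSpace ℂ X] [NormedSpace ℂ Y]
    (hg : S.IsBddOnDom g) (B : X →L[ℂ] Y) : S.IsBddOnDom fun ξ => B (g ξ) := by
  obtain ⟨C, hC⟩ := hg
  refine ⟨‖B‖ * C, fun ξ => (B.le_opNorm _).trans ?_⟩
  rw [mul_assoc]
  exact mul_le_mul_of_nonneg_left (hC ξ) (norm_nonneg B)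

theorem comp_dom (hg : S.IsBddOnDom g) {p : S.Dom → S.Dom} {C : ℝ}
    (hp : ∀ ξ, S.domNorm (p ξ) ≤ C * S.domNorm ξ) : S.IsBddOnDom fun ξ => g (p ξ) := by
  obtain ⟨C', hC'⟩ := hg
  refine ⟨|C'| * C, fun ξ => (hC' (p ξ)).trans ?_⟩
  rw [mul_assoc]
  exact (mul_le_mul_of_nonneg_right (le_abs_self C') (S.domNorm_nonneg _)).trans
    (mul_le_mul_of_nonneg_left (hp ξ) (abs_nonneg _))

theorem comp_op_smul (hg : S.IsBddOnDom g) (a : A) :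
    S.IsBddOnDom fun ξ => g (MulOpposite.op a • ξ) :=
  hg.comp_dom fun ξ => (S.rightOp a).le_opNorm (S.vec.symm (S.incl ξ))

end IsBddOnDom

theorem isBddOnDom_commutator (a : A) :
    S.IsBddOnDom fun ξ => S.vec.symm (S.dirac (a • ξ) - a • S.dirac ξ) :=
  let ⟨C, hC⟩ := S.bounded_commutator a
  ⟨C, fun ξ => hC ξ⟩

theorem dirac_J (x : H) (hx : x ∈ S.D.domain) :
    S.J (S.D ⟨x, hx⟩) = S.ε' • S.D ⟨S.J x, S.J_mem_domain x hx⟩ := S.J_D ⟨x, hx⟩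

/-- Commutators with right multiplications are bounded: they are conjugate to commutators with left
multiplications under `J`. -/
theorem isBddOnDom_right_commutator (a : A) :
    S.IsBddOnDom fun ξ =>
      S.vec.symm (S.dirac (MulOpposite.op a • ξ) - MulOpposite.op a • S.dirac ξ) := by
  obtain ⟨C, hC⟩ := S.bounded_commutator (star a)
  refine ⟨C, fun ξ => ?_⟩
  obtain ⟨x, hx⟩ := ξ
  obtain ⟨y, rfl⟩ := S.J.surjective x
  have hy : y ∈ S.D.domain := by
    simpa only [S.J.symm_apply_apply] using S.J_symm_mem_domain _ hx
  have hπ := S.π_mem_domain (star a) y hy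
  let ξ : S.Dom := ⟨S.J y, hx⟩
  have e1 : S.vec.symm (S.dirac (MulOpposite.op a • ξ)) =
      S.D ⟨S.J (S.π (star a) y), S.J_mem_domain _ hπ⟩ :=
    congrArg S.D (Subtype.ext (S.rightOp_J a y))
  have e2 : S.vec.symm (MulOpposite.op a • S.dirac ξ) = S.rightOp a (S.D ⟨S.J y, hx⟩) := rfl
  have e3 : S.D ⟨S.J y, hx⟩ = S.ε' • S.J (S.D ⟨y, hy⟩) := by
    rw [S.dirac_J, smul_smul, Int.units_mul_self, one_smul]
  have e4 : S.D ⟨S.J (S.π (star a) y), S.J_mem_domain _ hπ⟩ =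
      S.ε' • S.J (S.D ⟨S.π (star a) y, hπ⟩) := by
    rw [S.dirac_J, smul_smul, Int.units_mul_self, one_smul]
  have e5 : ‖S.vec.symm (S.dirac (MulOpposite.op a • ξ) - MulOpposite.op a • S.dirac ξ)‖ =
      ‖S.D ⟨S.π (star a) y, hπ⟩ - S.π (star a) (S.D ⟨y, hy⟩)‖ := by
    rw [map_sub, e1, e2, e3, e4,
      ← S.J.norm_map (S.D ⟨S.π (star a) y, hπ⟩ - S.π (star a) (S.D ⟨y, hy⟩)), map_sub S.J,
      ← S.rightOp_J]
    rcases Int.units_eq_one_or S.ε' with h | h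
    · rw [h, one_smul, one_smul]
    · rw [h, Units.neg_smul, Units.neg_smul, one_smul, one_smul, map_neg, ← norm_neg]
      congr 1
      abel
  have e6 : S.domNorm ξ = ‖y‖ := S.J.norm_map y
  change ‖S.vec.symm (S.dirac (MulOpposite.op a • ξ) - MulOpposite.op a • S.dirac ξ)‖ ≤
    C * S.domNorm ξ
  rw [e5, e6]
  exact hC ⟨y, hy⟩

theorem isBddOnDom_actLeft (ω : UnivForm 𝕜 A) :
    S.IsBddOnDom fun ξ => S.vec.symm (UnivForm.actLeft S.dirac S.dirac_smul ω ξ) := by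
  change S.IsBddOnDom fun ξ => S.vec.symm (UnivForm.commTensorLeft S.dirac S.dirac_smul ω.val ξ)
  induction ω.val using TensorProduct.induction_on with
  | zero => simpa using IsBddOnDom.zero
  | tmul a b => exact (S.isBddOnDom_commutator b).clm_comp (S.π a)
  | add s t hs ht => simpa only [map_add, AddMonoidHom.add_apply] using hs.add ht

section Realization

variable {S} (h : HermitianStructure S E) {X : Type*} [NormedAddCommGroup X]
    [InnerProductSpace ℂ X] (Φ : S.TwistSpace E ≃ₗ[ℂ] X)
    (hΦ : ∀ x y, ⟪Φ x, Φ y⟫_ℂ = twistPairing h x y)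

/-- A map `g` from the domain to `E ⊗_A H` such that `ξ ↦ g ξ ⊗ w̄` is bounded for all `w`. -/
def IsBddTensor (g : S.Dom → BTensor A E S.Space) : Prop :=
  ∀ f : ConjModule E, S.IsBddOnDom fun ξ => Φ (BTensor.tmul A (g ξ) f)

namespace IsBddTensor

variable {Φ} {g g' : S.Dom → BTensor A E S.Space}

omit [Module 𝕜 E] [IsScalarTower 𝕜 Aᵐᵒᵖ E] in
theorem congr (hg : IsBddTensor Φ g) (e : ∀ ξ, g' ξ = g ξ) : IsBddTensor Φ g' :=
  (funext e : g' = g) ▸ hg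

omit [Module 𝕜 E] [IsScalarTower 𝕜 Aᵐᵒᵖ E] in
theorem zero : IsBddTensor Φ fun _ => 0 := fun f => by
  simpa only [BTensor.zero_tmul, map_zero] using IsBddOnDom.zero

omit [Module 𝕜 E] [IsScalarTower 𝕜 Aᵐᵒᵖ E] in
theorem add (hg : IsBddTensor Φ g) (hg' : IsBddTensor Φ g') :
    IsBddTensor Φ fun ξ => g ξ + g' ξ := fun f => by
  simpa only [BTensor.add_tmul, map_add] using (hg f).add (hg' f)

omit [Module 𝕜 E] [IsScalarTower 𝕜 Aᵐᵒᵖ E] in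
theorem sub (hg : IsBddTensor Φ g) (hg' : IsBddTensor Φ g') :
    IsBddTensor Φ fun ξ => g ξ - g' ξ := fun f => by
  have e (x y : BTensor A E S.Space) : BTensor.tmul A (x - y) f =
      BTensor.tmul A x f - BTensor.tmul A y f :=
    map_sub ((BTensor.mk A (BTensor A E S.Space) (ConjModule E)).flip f) x y
  simpa only [e, map_sub] using (hg f).sub (hg' f)

omit [Module 𝕜 E] [IsScalarTower 𝕜 Aᵐᵒᵖ E] in
theorem op_smul (hg : IsBddTensor Φ g) (a : A) :
    IsBddTensor Φ fun ξ => MulOpposite.op a • g ξ := fun f => by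
  simpa only [BTensor.smul_tmul] using hg (a • f)

omit [Module 𝕜 E] [IsScalarTower 𝕜 Aᵐᵒᵖ E] in
theorem comp_op_smul (hg : IsBddTensor Φ g) (a : A) :
    IsBddTensor Φ fun ξ => g (MulOpposite.op a • ξ) := fun f => (hg f).comp_op_smul a

include hΦ in
theorem tmul (v : E) {k : S.Dom → S.Space} (hk : S.IsBddOnDom fun ξ => S.vec.symm (k ξ)) :
    IsBddTensor Φ fun ξ => BTensor.tmul A v (k ξ) := fun f =>
  hk.clm_comp (elemL h Φ hΦ v (ConjModule.bar.symm f))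

end IsBddTensor

include hΦ in
theorem isBddTensor_formAct (χ : BTensor A E (UnivForm 𝕜 A)) :
    IsBddTensor Φ fun ξ => UnivConnection.formAct S.dirac S.dirac_smul χ ξ := by
  induction χ using BTensor.induction_on with
  | h0 => simpa using IsBddTensor.zero
  | ht v ω =>
    simp only [UnivConnection.formAct_tmul]
    exact IsBddTensor.tmul h hΦ v (S.isBddOnDom_actLeft ω)
  | ha s t hs ht => simpa only [map_add, AddMonoidHom.add_apply] using hs.add ht

include hΦ in
/-- The twist from the right only involves commutators of `1 ⊗_∇ D` with right multiplications. The
latter commute with the unbounded part of `1 ⊗_∇ D` up to commutators of `D`, and with its connection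
part up to bounded terms. -/
theorem isBddOnDom_formAct_twist (nabla : UnivConnection 𝕜 A E)
    (hT : ∀ (c : 𝕜) (x : BTensor A E S.Dom), nabla.twist S.dirac S.dirac_smul
        (MulOpposite.op (algebraMap 𝕜 A c) • x) =
      MulOpposite.op (algebraMap 𝕜 A c) • nabla.twist S.dirac S.dirac_smul x)
    (v : E) (θ : BTensor A (UnivForm 𝕜 A) (ConjModule E)) :
    S.IsBddOnDom fun ξ => Φ (UnivLeftConnection.formAct (nabla.twist S.dirac S.dirac_smul) hT θ
      (BTensor.tmul A v ξ)) := by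
  induction θ using BTensor.induction_on with
  | h0 => simpa using IsBddOnDom.zero
  | ha s t hs ht => simpa only [map_add, AddMonoidHom.add_apply] using hs.add ht
  | ht ω f =>
    refine (?_ : IsBddTensor Φ fun ξ => UnivForm.commTensorRight
      (nabla.twist S.dirac S.dirac_smul) hT ω.val (BTensor.tmul A v ξ)) f
    induction ω.val using TensorProduct.induction_on with
    | zero => simpa using IsBddTensor.zero
    | add s t hs ht => simpa only [map_add, AddMonoidHom.add_apply] using hs.add ht
    | tmul a b =>
      have hχ := isBddTensor_formAct h Φ hΦ (nabla.toHom v)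
      have h1 := ((hχ.comp_op_smul b).sub (hχ.op_smul b)).add
        (IsBddTensor.tmul h hΦ v (S.isBddOnDom_right_commutator b))
      refine (h1.comp_op_smul a).congr fun ξ => ?_
      have e (y z : S.Space) : BTensor.tmul A v (y - z) = BTensor.tmul A v y - BTensor.tmul A v z :=
        map_sub (BTensor.mk A E S.Space v) y z
      simp only [UnivForm.commTensorRight_tmul, BTensor.op_smul_tmul, UnivConnection.twist_tmul,
        smul_add, e]
      abel

variable (S) in
/-- The elementary tensor `v ⊗ ξ ⊗ w̄` in `E ⊗_A Dom(D) ⊗_A Ē`. -/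
def domElem (v : E) (ξ : S.Dom) (w : E) : S.TwistDom E :=
  BTensor.tmul A (BTensor.tmul A v ξ) (ConjModule.bar w)

include hΦ in
/-- Up to bounded terms the twisted Dirac operator is `v ⊗ ξ ⊗ w̄ ↦ v ⊗ D ξ ⊗ w̄`. -/
theorem isBddOnDom_twistLeftRight (nabla : UnivConnection 𝕜 A E) (v w : E) :
    S.IsBddOnDom fun ξ => Φ (S.twistLeftRight nabla (S.domElem v ξ w)) -
      Φ (S.elem v (S.vec.symm (S.dirac ξ)) w) := by
  have h1 := isBddTensor_formAct h Φ hΦ (nabla.toHom v) (ConjModule.bar w)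
  have h2 := isBddOnDom_formAct_twist h Φ hΦ nabla
    (fun c x => nabla.twist_comm_op S.dirac S.dirac_smul _ (S.dirac_op_smul c) x) v
    (nabla.conjugate.toHom (ConjModule.bar w))
  refine (h1.add h2).congr fun ξ => ?_
  rw [← map_add, ← map_sub]
  congr 1
  rw [twistLeftRight, domElem, UnivLeftConnection.twist_tmul, UnivConnection.twist_tmul,
    BTensor.add_tmul, elem, S.vec.apply_symm_apply]
  abel

end Realization

end RealSpectralTriple

/-! ### The twisted Dirac operator as a self-adjoint operator -/

namespace RealSpectralTriple

variable {𝕜 A H E : Type*} [RCLike 𝕜] [Ring A]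
    [StarRing A] [Algebra 𝕜 A] [StarModule 𝕜 A] [NormedAddCommGroup H] [InnerProductSpace ℂ H]
    [CompleteSpace H] {S : RealSpectralTriple 𝕜 A H} [AddCommGroup E] [Module 𝕜 E]
    [Module Aᵐᵒᵖ E] [IsScalarTower 𝕜 Aᵐᵒᵖ E]

theorem innerHom_dirac (ξ η : S.Dom) :
    S.innerHom (S.dirac ξ) (S.incl η) = S.innerHom (S.incl ξ) (S.dirac η) :=
  LinearPMap.inner_apply_of_isSelfAdjoint S.selfAdjoint ξ η

theorem twistPairing_twistLeftRight (h : HermitianStructure S E) {nabla : UnivConnection 𝕜 A E}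
    (hn : nabla.IsHermitian h) (z w : S.TwistDom E) :
    twistPairing h (S.twistLeftRight nabla z) (S.twistIncl E w) =
      twistPairing h (S.twistIncl E z) (S.twistLeftRight nabla w) :=
  h.rightPairing_twist _ (leftPairing_op_smul h) hn _ _
    (fun x y => h.leftPairing_twist _ _ hn S.incl_smul S.dirac_smul innerHom_dirac x y) z w

omit [Module 𝕜 E] [IsScalarTower 𝕜 Aᵐᵒᵖ E] in
theorem exists_twistIncl_eq_smul (c : ℂ) (z : S.TwistDom E) :
    ∃ z' : S.TwistDom E, S.twistIncl E z' = c • S.twistIncl E z := by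
  induction z using BTensor.induction_on with
  | h0 => exact ⟨0, by simp⟩
  | ha x y hx hy =>
    obtain ⟨x', hx'⟩ := hx
    obtain ⟨y', hy'⟩ := hy
    exact ⟨x' + y', by rw [map_add, map_add, smul_add, hx', hy']⟩
  | ht y f =>
    induction y using BTensor.induction_on with
    | h0 => exact ⟨0, by rw [BTensor.zero_tmul, map_zero, smul_zero]⟩
    | ha x y hx hy =>
      obtain ⟨x', hx'⟩ := hx
      obtain ⟨y', hy'⟩ := hy
      exact ⟨x' + y', by rw [BTensor.add_tmul, map_add, map_add, smul_add, hx', hy']⟩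
    | ht v ξ =>
      exact ⟨S.domElem v ⟨_, S.D.domain.smul_mem c ξ.2⟩ (ConjModule.bar.symm f), rfl⟩

section Realization

variable (h : HermitianStructure S E) {X : Type*} [NormedAddCommGroup X]
    [InnerProductSpace ℂ X] (Φ : S.TwistSpace E ≃ₗ[ℂ] X)
    (hΦ : ∀ x y, ⟪Φ x, Φ y⟫_ℂ = twistPairing h x y)

include hΦ in
theorem dense_range_twistIncl : Dense (Set.range fun z => Φ (S.twistIncl E z)) := by
  let R : AddSubgroup X := (Φ.toLinearMap.toAddMonoidHom.comp (S.twistIncl E)).range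
  intro y
  obtain ⟨x, rfl⟩ := Φ.surjective y
  change Φ x ∈ R.topologicalClosure
  induction x using S.twist_induction with
  | h0 => rw [map_zero]; exact zero_mem _
  | ha x y hx hy => rw [map_add]; exact add_mem hx hy
  | ht v ξ w =>
    have h1 : elemL h Φ hΦ v w ξ ∈ closure (R : Set X) :=
      map_mem_closure (elemL h Φ hΦ v w).continuous (S.selfAdjoint.dense_domain ξ)
        fun x hx => ⟨S.domElem v ⟨x, hx⟩ w, rfl⟩
    exact h1

include hΦ in
theorem exists_twistDirac {nabla : UnivConnection 𝕜 A E} (hn : nabla.IsHermitian h) :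
    ∃ P : X →ₗ.[ℂ] X, ∀ x y : X, (x, y) ∈ P.graph ↔
      ∃ z, Φ (S.twistIncl E z) = x ∧ Φ (S.twistLeftRight nabla z) = y :=
  LinearPMap.exists_graph_eq_of_symmetric
    (Φ.toLinearMap.toAddMonoidHom.comp (S.twistIncl E))
    (Φ.toLinearMap.toAddMonoidHom.comp (S.twistLeftRight nabla))
    (dense_range_twistIncl h Φ hΦ)
    (fun c z => (exists_twistIncl_eq_smul c z).imp fun _ hz' =>
      (congrArg Φ hz').trans (map_smul Φ c _))
    (fun z w => (hΦ _ _).trans ((twistPairing_twistLeftRight h hn z w).trans (hΦ _ _).symm))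

section Operator

variable {nabla : UnivConnection 𝕜 A E} {P : X →ₗ.[ℂ] X}
    (hP : ∀ x y : X, (x, y) ∈ P.graph ↔
      ∃ z, Φ (S.twistIncl E z) = x ∧ Φ (S.twistLeftRight nabla z) = y)

include hP

omit [IsScalarTower 𝕜 Aᵐᵒᵖ E] [Module 𝕜 E] in
theorem twistDirac_apply (z : S.TwistDom E) :
    ∃ hz : Φ (S.twistIncl E z) ∈ P.domain,
      P ⟨_, hz⟩ = Φ (S.twistLeftRight nabla z) := by
  obtain ⟨y, hy, hy'⟩ := (LinearPMap.mem_graph_iff _).1 ((hP _ _).2 ⟨z, rfl, rfl⟩)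
  dsimp only at hy hy'
  exact ⟨hy ▸ y.2, by rw [← hy']; exact congrArg P (Subtype.ext hy.symm)⟩

omit [IsScalarTower 𝕜 Aᵐᵒᵖ E] [Module 𝕜 E] in
theorem exists_of_twistDirac_domain (x : P.domain) :
    ∃ z, Φ (S.twistIncl E z) = x ∧ Φ (S.twistLeftRight nabla z) = P x :=
  (hP _ _).1 (P.mem_graph x)

include hΦ in
theorem twistDirac_symmetric (hn : nabla.IsHermitian h) (x y : P.domain) :
    ⟪P x, (y : X)⟫_ℂ = ⟪(x : X), P y⟫_ℂ := by
  obtain ⟨z, hz, hz'⟩ := exists_of_twistDirac_domain Φ hP x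
  obtain ⟨w, hw, hw'⟩ := exists_of_twistDirac_domain Φ hP y
  rw [← hz, ← hz', ← hw, ← hw', hΦ, hΦ, twistPairing_twistLeftRight h hn]

include hΦ in
theorem twistDirac_dense_domain : Dense (P.domain : Set X) := by
  refine (dense_range_twistIncl h Φ hΦ).mono ?_
  rintro _ ⟨z, rfl⟩
  exact (twistDirac_apply Φ hP z).1

theorem almostIntertwines_elemL (v w : E) :
    LinearPMap.AlmostIntertwines S.D P (elemL h Φ hΦ v w) := by
  obtain ⟨C, hC⟩ := isBddOnDom_twistLeftRight h Φ hΦ nabla v w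
  refine ⟨C, fun ξ => ?_⟩
  obtain ⟨h1, h2⟩ := twistDirac_apply Φ hP (S.domElem v ξ w)
  refine ⟨h1, ?_⟩
  have h3 := hC ξ
  beta_reduce at h3
  rw [← h2] at h3
  exact h3

section Frame

variable [CompleteSpace X] {n : ℕ} {e f : Fin n → E}
    (hef : ∀ v, ∑ i, MulOpposite.op (h.form (f i) v) • e i = v)

include hef

omit hP in
theorem sum_elemL_adjoint (x : X) :
    ∑ p : Fin n × Fin n, elemL h Φ hΦ (e p.1) (e p.2)
      (ContinuousLinearMap.adjoint (elemL h Φ hΦ (f p.1) (f p.2)) x) = x := by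
  obtain ⟨x, rfl⟩ := Φ.surjective x
  rw [Fintype.sum_prod_type]
  simp only [adjoint_elemL, elemL_apply, ← map_sum]
  rw [sum_elem_contract h hef]

include hΦ in
theorem isSelfAdjoint_twistDirac (hn : nabla.IsHermitian h) : IsSelfAdjoint P :=
  LinearPMap.isSelfAdjoint_of_frame S.selfAdjoint (twistDirac_dense_domain h Φ hΦ hP)
    (twistDirac_symmetric h Φ hΦ hP hn) (sum_elemL_adjoint h Φ hΦ hef)
    (fun _ => almostIntertwines_elemL h Φ hΦ hP _ _)
    (fun _ => almostIntertwines_elemL h Φ hΦ hP _ _)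

include hΦ in
theorem exists_compact_resolvent_twistDirac (hn : nabla.IsHermitian h) {z : ℂ} (hz : z.im ≠ 0) :
    ∃ R : X →L[ℂ] X, IsCompactOperator R ∧
      (∀ x : X, ∃ hx : R x ∈ P.domain, P ⟨R x, hx⟩ - z • R x = x) ∧
      ∀ x : P.domain, R (P x - z • (x : X)) = x := by
  have hsa := isSelfAdjoint_twistDirac h Φ hΦ hP hef hn
  obtain ⟨R, hR, hR'⟩ := LinearPMap.exists_resolvent hsa hz
  obtain ⟨K, hK, -, hK'⟩ := S.compactResolvent z hz
  exact ⟨R, LinearPMap.isCompactOperator_of_frame S.selfAdjoint (sum_elemL_adjoint h Φ hΦ hef)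
    (fun _ => almostIntertwines_elemL h Φ hΦ hP _ _) hsa z hK hK' hR, hR, hR'⟩

include hΦ in
/-- An operator acting on the left factors only, by an endomorphism of `E`, has a bounded
commutator with the twisted Dirac operator. -/
theorem bounded_commutator_twistDirac (hn : nabla.IsHermitian h) (T : E → E) (B : X →L[ℂ] X)
    (hB : ∀ v ξ w, B (Φ (S.elem v ξ w)) = Φ (S.elem (T v) ξ w)) :
    ∃ C : ℝ, ∀ x : P.domain, ∃ hx : B x ∈ P.domain, ‖P ⟨B x, hx⟩ - B (P x)‖ ≤ C * ‖(x : X)‖ := by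
  refine LinearPMap.bounded_commutator_of_frame S.selfAdjoint (sum_elemL_adjoint h Φ hΦ hef)
    (fun _ => almostIntertwines_elemL h Φ hΦ hP _ _)
    (fun _ => almostIntertwines_elemL h Φ hΦ hP _ _)
    (isSelfAdjoint_twistDirac h Φ hΦ hP hef hn) B fun p => ?_
  have e1 : B.comp (elemL h Φ hΦ (e p.1) (e p.2)) = elemL h Φ hΦ (T (e p.1)) (e p.2) :=
    ContinuousLinearMap.ext fun ξ => hB _ _ _
  rw [e1]
  exact almostIntertwines_elemL h Φ hΦ hP _ _

end Frame

end Operator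

end Realization

end RealSpectralTriple

/-! ### The twisted real structure -/

section ConjSwap

open ConjModule

variable {A M N E : Type*} [Ring A] [StarRing A] [AddCommGroup M] [AddCommGroup N]
    [AddCommGroup E] [Module Aᵐᵒᵖ E] [Module A M] [Module Aᵐᵒᵖ M] [SMulCommClass A Aᵐᵒᵖ M]
    [Module A N] [Module Aᵐᵒᵖ N] [SMulCommClass A Aᵐᵒᵖ N]

omit [StarRing A] in
theorem BTensor.hom_ext₃ {P Q : Type*} [AddCommGroup P] [Module A P] [AddCommGroup Q]
    {f g : BTensor A (BTensor A E M) P →+ Q}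
    (h : ∀ v x p, f (tmul A (tmul A v x) p) = g (tmul A (tmul A v x) p)) : f = g :=
  hom_ext fun y p => by
    induction y using induction_on with
    | h0 => rw [zero_tmul, map_zero, map_zero]
    | ht v x => exact h v x p
    | ha y z hy hz => rw [add_tmul, map_add, map_add, hy, hz]

variable (E) in
/-- The map `v ⊗ x ⊗ w̄ ↦ w ⊗ J x ⊗ v̄`, for an antilinear map `J` of bimodules exchanging the left
and the right action. -/
def conjSwap (J : M →+ N) (hJ : ∀ (a : A) x, J (a • x) = MulOpposite.op (star a) • J x)
    (hJ' : ∀ (a : A) x, J (MulOpposite.op a • x) = star a • J x) :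
    BTensor A (BTensor A E M) (ConjModule E) →+ BTensor A (BTensor A E N) (ConjModule E) :=
  (BTensor.assoc (A := A) (M := E) (N := N) (P := ConjModule E)).symm.toAddMonoidHom.comp
    (swapRight E (swapLeft E J hJ) (swapLeft_op_smul J hJ hJ'))

theorem assoc_conjSwap (J : M →+ N) (hJ : ∀ (a : A) x, J (a • x) = MulOpposite.op (star a) • J x)
    (hJ' : ∀ (a : A) x, J (MulOpposite.op a • x) = star a • J x)
    (y : BTensor A (BTensor A E M) (ConjModule E)) : BTensor.assoc (conjSwap E J hJ hJ' y) =
      swapRight E (swapLeft E J hJ) (swapLeft_op_smul J hJ hJ') y :=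
  AddEquiv.apply_symm_apply _ _

end ConjSwap

namespace RealSpectralTriple

variable {𝕜 A H E : Type*} [RCLike 𝕜] [Ring A]
    [StarRing A] [Algebra 𝕜 A] [StarModule 𝕜 A] [NormedAddCommGroup H] [InnerProductSpace ℂ H]
    [CompleteSpace H] (S : RealSpectralTriple 𝕜 A H) [AddCommGroup E] [Module 𝕜 E]
    [Module Aᵐᵒᵖ E] [IsScalarTower 𝕜 Aᵐᵒᵖ E]

/-- The real structure of `S`, as an additive map of bimodules. -/
def JHom : S.Space →+ S.Space := S.J.toLinearEquiv.toLinearMap.toAddMonoidHom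

theorem JHom_smul (a : A) (x : S.Space) : S.JHom (a • x) = MulOpposite.op (star a) • S.JHom x := by
  refine Eq.trans ?_ (S.rightOp_J (star a) (S.vec.symm x)).symm
  rw [star_star]
  rfl

theorem JHom_op_smul (a : A) (x : S.Space) :
    S.JHom (MulOpposite.op a • x) = star a • S.JHom x := by
  obtain ⟨y, rfl⟩ : ∃ y : H, S.vec (S.J y) = x := S.J.surjective (S.vec.symm x)
  change S.J (S.rightOp a (S.J y)) = S.π (star a) (S.J (S.J y))
  rw [S.rightOp_J, S.J_sq, S.J_sq, Units.smul_def, Units.smul_def, map_zsmul]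

theorem π_J (b : A) (x : H) : S.π b (S.J x) = S.J (S.rightOp (star b) x) := by
  have h := S.JHom_op_smul (star b) (S.vec x)
  rw [star_star] at h
  exact h.symm

/-- The real structure of `S` on the domain of the Dirac operator. -/
def JDom : S.Dom →+ S.Dom :=
  AddMonoidHom.mk' (fun ξ => ⟨S.J ξ.1, S.J_mem_domain _ ξ.2⟩) fun ξ η =>
    Subtype.ext (map_add S.J ξ.1 η.1)

theorem JDom_smul (a : A) (x : S.Dom) : S.JDom (a • x) = MulOpposite.op (star a) • S.JDom x :=
  S.incl_injective (S.JHom_smul a (S.incl x))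

theorem JDom_op_smul (a : A) (x : S.Dom) : S.JDom (MulOpposite.op a • x) = star a • S.JDom x :=
  S.incl_injective (S.JHom_op_smul a (S.incl x))

variable (E) in
/-- The map `v ⊗ ξ ⊗ w̄ ↦ w ⊗ J ξ ⊗ v̄` on `E ⊗_A H ⊗_A Ē`. -/
def twistJ : S.TwistSpace E →+ S.TwistSpace E := conjSwap E S.JHom S.JHom_smul S.JHom_op_smul

variable (E) in
/-- The map `v ⊗ ξ ⊗ w̄ ↦ w ⊗ J ξ ⊗ v̄` on `E ⊗_A Dom(D) ⊗_A Ē`. -/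
def twistJDom : S.TwistDom E →+ S.TwistDom E := conjSwap E S.JDom S.JDom_smul S.JDom_op_smul

omit [Module 𝕜 E] [IsScalarTower 𝕜 Aᵐᵒᵖ E] in
theorem twistJ_elem (v w : E) (ξ : H) : S.twistJ E (S.elem v ξ w) = S.elem w (S.J ξ) v := rfl

omit [Module 𝕜 E] [IsScalarTower 𝕜 Aᵐᵒᵖ E] in
theorem twistIncl_twistJDom (z : S.TwistDom E) :
    S.twistIncl E (S.twistJDom E z) = S.twistJ E (S.twistIncl E z) :=
  DFunLike.congr_fun (f := (S.twistIncl E).comp (S.twistJDom E))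
    (g := (S.twistJ E).comp (S.twistIncl E)) (BTensor.hom_ext₃ fun _ _ _ => rfl) z

omit [Module 𝕜 E] [IsScalarTower 𝕜 Aᵐᵒᵖ E] in
theorem twistJ_twistJ (x : S.TwistSpace E) : S.twistJ E (S.twistJ E x) = S.ε • x := by
  induction x using S.twist_induction with
  | h0 => simp
  | ha x y hx hy => rw [map_add, map_add, smul_add, hx, hy]
  | ht v ξ w =>
    rw [twistJ_elem, twistJ_elem, S.J_sq, Units.smul_def, Units.smul_def, ← elemₗ_apply, map_zsmul,
      elemₗ_apply]

omit [Module 𝕜 E] [IsScalarTower 𝕜 Aᵐᵒᵖ E] in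
theorem twistJ_smul (c : ℂ) (x : S.TwistSpace E) :
    S.twistJ E (c • x) = starRingEnd ℂ c • S.twistJ E x := by
  induction x using S.twist_induction with
  | h0 => simp
  | ha x y hx hy => rw [smul_add, map_add, map_add, smul_add, hx, hy]
  | ht v ξ w =>
    rw [smul_elem, twistJ_elem, twistJ_elem, LinearIsometryEquiv.map_smulₛₗ S.J, smul_elem]

theorem units_smul_J_D (x : S.D.domain) :
    S.ε' • S.J (S.D x) = S.D ⟨S.J x, S.J_mem_domain x x.2⟩ := by
  rw [S.J_D, smul_smul, Int.units_mul_self, one_smul]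

omit [Module 𝕜 E] [IsScalarTower 𝕜 Aᵐᵒᵖ E] in
theorem assoc_twistLeftRight (nabla : UnivConnection 𝕜 A E) (x : S.TwistDom E) :
    BTensor.assoc (S.twistLeftRight nabla x) = S.twistRightLeft nabla (BTensor.assoc x) :=
  UnivConnection.assoc_twist_twist S.dirac S.dirac_smul S.dirac_op_smul nabla nabla.conjugate _ _ x

omit [Module 𝕜 E] [IsScalarTower 𝕜 Aᵐᵒᵖ E] in
/-- The map `J̃ = ε' J` on `H` satisfies `J̃ D = D J`, so exchanging the outer factors of the tensor
product turns `(1 ⊗_∇ D) ⊗_∇̄ 1` into `1 ⊗_∇ (D ⊗_∇̄ 1)`, which is the same operator. -/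
theorem twistJ_twistLeftRight (nabla : UnivConnection 𝕜 A E) (z : S.TwistDom E) :
    S.twistJ E (S.twistLeftRight nabla z) = S.ε' • S.twistLeftRight nabla (S.twistJDom E z) := by
  let K : S.Space →+ S.Space := (S.ε' : ℤ) • S.JHom
  have hK (a : A) (x : S.Space) : K (a • x) = MulOpposite.op (star a) • K x := by
    simp only [K, AddMonoidHom.smul_apply, JHom_smul, smul_comm (S.ε' : ℤ)]
  have hK' (a : A) (x : S.Space) : K (MulOpposite.op a • x) = star a • K x := by
    simp only [K, AddMonoidHom.smul_apply, JHom_op_smul, smul_comm (S.ε' : ℤ)]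
  have hKD (ξ : S.Dom) : K (S.dirac ξ) = S.dirac (S.JDom ξ) := S.units_smul_J_D ξ
  have e1 : conjSwap E K hK hK' = (S.ε' : ℤ) • S.twistJ E := BTensor.hom_ext₃ fun v x f => by
    change BTensor.tmul A (BTensor.tmul A (ConjModule.bar.symm f) (K x)) (ConjModule.bar v) =
      (S.ε' : ℤ) • S.elem (ConjModule.bar.symm f) (S.J (S.vec.symm x)) v
    rw [← elemₗ_apply, ← map_zsmul]
    rfl
  have e2 := swapRight_twist nabla (swapLeft_op_smul S.JDom S.JDom_smul S.JDom_op_smul)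
    (swapLeft_op_smul K hK hK')
    (fun c x => nabla.twist_comm_op S.dirac S.dirac_smul _ (S.dirac_op_smul c) x)
    (fun c x => nabla.conjugate.twist_comm S.dirac S.dirac_op_smul _ (S.dirac_smul c) x)
    (fun x => swapLeft_twist nabla S.JDom_smul hK S.dirac_smul S.dirac_op_smul hKD x) z
  rw [← assoc_conjSwap K hK hK', ← assoc_conjSwap S.JDom S.JDom_smul S.JDom_op_smul] at e2
  have e3 := BTensor.assoc.injective
    (e2.trans (S.assoc_twistLeftRight nabla (S.twistJDom E z)).symm)
  have e4 : (S.ε' : ℤ) • S.twistJ E (S.twistLeftRight nabla z) =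
      S.twistLeftRight nabla (S.twistJDom E z) := by
    rw [← e3, ← AddMonoidHom.smul_apply, ← e1]
    rfl
  rw [← e4, ← Units.smul_def, smul_smul, Int.units_mul_self, one_smul]

variable {S} in
theorem twistPairing_twistJ (h : HermitianStructure S E) (x y : S.TwistSpace E) :
    twistPairing h (S.twistJ E x) (S.twistJ E y) = twistPairing h y x := by
  induction x using S.twist_induction with
  | h0 => simp
  | ha x x' hx hx' => simp only [map_add, AddMonoidHom.add_apply, hx, hx']
  | ht v₁ ξ v₂ =>
    induction y using S.twist_induction with
    | h0 => simp
    | ha y y' hy hy' => simp only [map_add, AddMonoidHom.add_apply, hy, hy']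
    | ht w₁ η w₂ =>
      rw [twistJ_elem, twistJ_elem, twistPairing_elem, twistPairing_elem]
      rw [S.rightOp_J, π_J, LinearIsometryEquiv.inner_map_map_antilinear, inner_rightOp, inner_π,
        star_star, h.star_form, h.star_form]

end RealSpectralTriple

/-! ### The twisted spectral triple -/

namespace RealSpectralTriple

variable {𝕜 A H E : Type*} [RCLike 𝕜] [Ring A]
    [StarRing A] [Algebra 𝕜 A] [StarModule 𝕜 A] [NormedAddCommGroup H] [InnerProductSpace ℂ H]
    [CompleteSpace H] (S : RealSpectralTriple 𝕜 A H) [AddCommGroup E] [Module 𝕜 E]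
    [Module Aᵐᵒᵖ E] [IsScalarTower 𝕜 Aᵐᵒᵖ E]

/-- The operator `v ⊗ ξ ⊗ w̄ ↦ T v ⊗ ξ ⊗ w̄` on `E ⊗_A H ⊗_A Ē`. -/
def twistAct (T : Module.End Aᵐᵒᵖ E) : S.TwistSpace E →ₗ[ℂ] S.TwistSpace E :=
  let F : S.TwistSpace E →+ S.TwistSpace E :=
    BTensor.map (BTensor.map T.toAddMonoidHom (AddMonoidHom.id S.Space)
        (fun a v => map_smul T (MulOpposite.op a) v) (fun _ _ => rfl))
      (AddMonoidHom.id (ConjModule E))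
      (fun a x => by
        induction x using BTensor.induction_on with
        | h0 => rw [smul_zero, map_zero, smul_zero]
        | ht v x => rfl
        | ha x y hx hy => simp only [smul_add, map_add, hx, hy])
      (fun _ _ => rfl)
  { F with
    map_smul' := fun c x => by
      change F (c • x) = c • F x
      induction x using S.twist_induction with
      | h0 => rw [smul_zero, map_zero, smul_zero]
      | ht v ξ w => rfl
      | ha x y hx hy => simp only [smul_add, map_add, hx, hy] }

omit [Module 𝕜 E] [IsScalarTower 𝕜 Aᵐᵒᵖ E] in
theorem twistAct_elem (T : Module.End Aᵐᵒᵖ E) (v w : E) (ξ : H) :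
    S.twistAct T (S.elem v ξ w) = S.elem (T v) ξ w := rfl

variable {S} in
theorem twistPairing_twistAct (h : HermitianStructure S E) (T : h.EndAlg) (x y : S.TwistSpace E) :
    twistPairing h (S.twistAct (h.toEnd (star T)) x) y =
      twistPairing h x (S.twistAct (h.toEnd T) y) := by
  induction x using S.twist_induction with
  | h0 => simp
  | ha x x' hx hx' => simp only [map_add, AddMonoidHom.add_apply, hx, hx']
  | ht v₁ ξ v₂ =>
    induction y using S.twist_induction with
    | h0 => simp
    | ha y y' hy hy' => simp only [map_add, hy, hy']
    | ht w₁ η w₂ =>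
      rw [twistAct_elem, twistAct_elem, twistPairing_elem, twistPairing_elem, h.star_form_apply]

section Realization

variable {S} (h : HermitianStructure S E) {X : Type*} [NormedAddCommGroup X]
    [InnerProductSpace ℂ X] (Φ : S.TwistSpace E ≃ₗ[ℂ] X)
    (hΦ : ∀ x y, ⟪Φ x, Φ y⟫_ℂ = twistPairing h x y)

include hΦ in
/-- In terms of a frame, `T = ∑ T eᵢ (fᵢ|·)` is a finite sum of bounded operators. -/
theorem continuous_twistAct [Module.Finite Aᵐᵒᵖ E] [Module.Projective Aᵐᵒᵖ E] [CompleteSpace X]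
    (T : Module.End Aᵐᵒᵖ E) : Continuous fun x => Φ (S.twistAct T (Φ.symm x)) := by
  obtain ⟨n, e, f, hef⟩ := exists_frame h
  have e1 : (fun x => Φ (S.twistAct T (Φ.symm x))) = fun x => ∑ i, ∑ k,
      elemL h Φ hΦ (T (e i)) (e k) (ContinuousLinearMap.adjoint (elemL h Φ hΦ (f i) (f k)) x) := by
    funext x
    obtain ⟨x, rfl⟩ := Φ.surjective x
    rw [Φ.symm_apply_apply]
    conv_lhs => rw [← sum_elem_contract h hef x]
    simp only [map_sum, adjoint_elemL, elemL_apply, twistAct_elem]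
  rw [e1]
  fun_prop

/-- The operator `v ⊗ ξ ⊗ w̄ ↦ T v ⊗ ξ ⊗ w̄`, as a bounded operator. -/
def twistActL [Module.Finite Aᵐᵒᵖ E] [Module.Projective Aᵐᵒᵖ E] [CompleteSpace X]
    (T : Module.End Aᵐᵒᵖ E) : X →L[ℂ] X where
  toLinearMap := Φ.toLinearMap ∘ₗ S.twistAct T ∘ₗ Φ.symm.toLinearMap
  cont := continuous_twistAct h Φ hΦ T

theorem twistActL_apply [Module.Finite Aᵐᵒᵖ E] [Module.Projective Aᵐᵒᵖ E] [CompleteSpace X]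
    (T : Module.End Aᵐᵒᵖ E) (x : S.TwistSpace E) :
    twistActL h Φ hΦ T (Φ x) = Φ (S.twistAct T x) :=
  congrArg (fun y => Φ (S.twistAct T y)) (Φ.symm_apply_apply x)

omit [Module 𝕜 E] [IsScalarTower 𝕜 Aᵐᵒᵖ E] in
theorem clm_ext_elem {B C : X →L[ℂ] X}
    (hBC : ∀ v ξ w, B (Φ (S.elem v ξ w)) = C (Φ (S.elem v ξ w))) : B = C := by
  ext x
  obtain ⟨x, rfl⟩ := Φ.surjective x
  induction x using S.twist_induction with
  | h0 => simp
  | ht v ξ w => exact hBC v ξ w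
  | ha x y hx hy => simp only [map_add, hx, hy]

/-- The map `v ⊗ ξ ⊗ w̄ ↦ w ⊗ J ξ ⊗ v̄`, as an antiunitary operator. -/
def twistJL : X ≃ₗᵢ⋆[ℂ] X where
  toFun x := Φ (S.twistJ E (Φ.symm x))
  map_add' x y := by simp only [map_add]
  map_smul' c x := by rw [map_smul, twistJ_smul, map_smul]
  invFun x := S.ε • Φ (S.twistJ E (Φ.symm x))
  left_inv x := by
    beta_reduce
    rw [Φ.symm_apply_apply, twistJ_twistJ, Units.smul_def, Units.smul_def, map_zsmul,
      ← Units.smul_def, ← Units.smul_def, smul_smul, Int.units_mul_self, one_smul,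
      Φ.apply_symm_apply]
  right_inv x := by
    simp only [Units.smul_def, map_zsmul]
    rw [Φ.symm_apply_apply, twistJ_twistJ, Units.smul_def, map_zsmul,
      ← Units.smul_def, ← Units.smul_def, smul_smul, Int.units_mul_self, one_smul,
      Φ.apply_symm_apply]
  norm_map' x := by
    change ‖Φ (S.twistJ E (Φ.symm x))‖ = ‖x‖
    rw [← sq_eq_sq₀ (norm_nonneg _) (norm_nonneg _), ← inner_self_eq_norm_sq (𝕜 := ℂ),
      ← inner_self_eq_norm_sq (𝕜 := ℂ), hΦ, twistPairing_twistJ, ← hΦ, Φ.apply_symm_apply]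

theorem twistJL_apply (x : S.TwistSpace E) : twistJL h Φ hΦ (Φ x) = Φ (S.twistJ E x) :=
  congrArg (fun y => Φ (S.twistJ E y)) (Φ.symm_apply_apply x)

theorem twistJL_symm_elem (v w : E) (ξ : H) :
    (twistJL h Φ hΦ).symm (Φ (S.elem v ξ w)) = Φ (S.elem w (S.J.symm ξ) v) := by
  rw [LinearIsometryEquiv.symm_apply_eq, twistJL_apply, twistJ_elem, S.J.apply_symm_apply]

include hΦ in
/-- The twisted spectral triple, carried over to a Hilbert space `X` along `Φ`. -/
theorem exists_twistTriple [Module.Finite Aᵐᵒᵖ E] [Module.Projective Aᵐᵒᵖ E] [CompleteSpace X]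
    {nabla : UnivConnection 𝕜 A E} (hn : nabla.IsHermitian h) :
    ∃ S' : RealSpectralTriple 𝕜 h.EndAlg X,
      (∀ (T : h.EndAlg) (x : S.TwistSpace E), S'.π T (Φ x) = Φ (S.twistAct (h.toEnd T) x)) ∧
      (∀ x y : X, (x, y) ∈ S'.D.graph ↔
        ∃ z, Φ (S.twistIncl E z) = x ∧ Φ (S.twistLeftRight nabla z) = y) ∧
      (∀ x : S.TwistSpace E, S'.J (Φ x) = Φ (S.twistJ E x)) ∧
      S'.ε = S.ε ∧ S'.ε' = S.ε' := by
  obtain ⟨n, e, f, hef⟩ := exists_frame h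
  obtain ⟨P, hP⟩ := exists_twistDirac h Φ hΦ hn
  have hcomm (T : h.EndAlg) := bounded_commutator_twistDirac h Φ hΦ hP hef hn (h.toEnd T)
    (twistActL h Φ hΦ (h.toEnd T)) fun v ξ w => twistActL_apply h Φ hΦ _ _
  have hJ (x : P.domain) : ∃ hx : twistJL h Φ hΦ x ∈ P.domain,
      twistJL h Φ hΦ (P x) = S.ε' • P ⟨_, hx⟩ := by
    obtain ⟨z, hz, hz'⟩ := exists_of_twistDirac_domain Φ hP x
    obtain ⟨h1, h2⟩ := twistDirac_apply Φ hP (S.twistJDom E z)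
    have h3 : Φ (S.twistIncl E (S.twistJDom E z)) = twistJL h Φ hΦ x := by
      rw [← hz, twistJL_apply, twistIncl_twistJDom]
    refine ⟨h3 ▸ h1, ?_⟩
    have h4 : P ⟨_, h3 ▸ h1⟩ = P ⟨_, h1⟩ := congrArg P (Subtype.ext h3.symm)
    rw [h4, h2, ← hz', twistJL_apply, twistJ_twistLeftRight, Units.smul_def, Units.smul_def,
      map_zsmul]
  refine ⟨{
    π :=
      { toFun := fun T => twistActL h Φ hΦ (h.toEnd T)
        map_one' := clm_ext_elem Φ fun v ξ w => by
          rw [twistActL_apply, twistAct_elem, map_one]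
          rfl
        map_mul' := fun T U => clm_ext_elem Φ fun v ξ w => by
          rw [mul_apply_eq_comp, twistActL_apply, twistActL_apply, twistActL_apply, map_mul]
          rfl
        map_zero' := clm_ext_elem Φ fun v ξ w => by
          rw [twistActL_apply, twistAct_elem, map_zero, LinearMap.zero_apply, elem,
            BTensor.zero_tmul, BTensor.zero_tmul, map_zero]
          rfl
        map_add' := fun T U => clm_ext_elem Φ fun v ξ w => by
          rw [add_apply, twistActL_apply, twistActL_apply, twistActL_apply]
          refine (congrArg Φ ?_).trans (map_add Φ _ _)
          rw [twistAct_elem, twistAct_elem, twistAct_elem, map_add, LinearMap.add_apply, elem, elem,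
            elem, BTensor.add_tmul, BTensor.add_tmul] }
    π_algebraMap := fun c => clm_ext_elem Φ fun v ξ w => by
      have e1 : h.toEnd (algebraMap 𝕜 h.EndAlg c) v = MulOpposite.op (algebraMap 𝕜 A c) • v := by
        change c • v = _
        rw [Algebra.algebraMap_eq_smul_one, MulOpposite.op_smul, smul_assoc, MulOpposite.op_one,
          one_smul]
      change twistActL h Φ hΦ _ (Φ (S.elem v ξ w)) = RCLike.map 𝕜 ℂ c • Φ (S.elem v ξ w)
      rw [twistActL_apply, twistAct_elem, e1, elem_op_smul_left, S.π_algebraMap, ← map_smul,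
        smul_elem]
      rfl
    π_star := fun T => (ContinuousLinearMap.eq_adjoint_iff _ _).2 fun x y => by
      obtain ⟨x, rfl⟩ := Φ.surjective x
      obtain ⟨y, rfl⟩ := Φ.surjective y
      change ⟪twistActL h Φ hΦ (h.toEnd (star T)) (Φ x), Φ y⟫_ℂ =
        ⟪Φ x, twistActL h Φ hΦ (h.toEnd T) (Φ y)⟫_ℂ
      rw [twistActL_apply, twistActL_apply, hΦ, hΦ, twistPairing_twistAct]
    D := P
    selfAdjoint := isSelfAdjoint_twistDirac h Φ hΦ hP hef hn
    compactResolvent := fun z hz => exists_compact_resolvent_twistDirac h Φ hΦ hP hef hn hz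
    π_mem_domain := fun T x hx =>
      let ⟨_, hC⟩ := hcomm T
      (hC ⟨x, hx⟩).1
    bounded_commutator := fun T =>
      let ⟨C, hC⟩ := hcomm T
      ⟨C, fun x => (hC x).2⟩
    J := twistJL h Φ hΦ
    ε := S.ε
    ε' := S.ε'
    J_sq := fun x => by
      obtain ⟨x, rfl⟩ := Φ.surjective x
      rw [twistJL_apply, twistJL_apply, twistJ_twistJ, Units.smul_def, Units.smul_def, map_zsmul]
    J_mem_domain := fun x hx => (hJ ⟨x, hx⟩).1
    J_D := fun x => (hJ x).2
    commutant := fun T U x => by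
      obtain ⟨x, rfl⟩ := Φ.surjective x
      change twistActL h Φ hΦ (h.toEnd T) (twistJL h Φ hΦ (twistActL h Φ hΦ (h.toEnd U)
          ((twistJL h Φ hΦ).symm (Φ x)))) =
        twistJL h Φ hΦ (twistActL h Φ hΦ (h.toEnd U)
          ((twistJL h Φ hΦ).symm (twistActL h Φ hΦ (h.toEnd T) (Φ x))))
      induction x using S.twist_induction with
      | h0 => simp only [map_zero]
      | ha x y hx hy => simp only [map_add, hx, hy]
      | ht v ξ w =>
        simp only [twistActL_apply, twistAct_elem, twistJL_symm_elem, twistJL_apply,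
          twistJ_elem] },
    fun T x => twistActL_apply h Φ hΦ _ x, hP, twistJL_apply h Φ hΦ, rfl, rfl⟩

end Realization

end RealSpectralTriple

theorem mainTheorem4 {𝕜 A H E : Type*} [RCLike 𝕜] [Ring A] [StarRing A] [Algebra 𝕜 A]
    [StarModule 𝕜 A] [NormedAddCommGroup H] [InnerProductSpace ℂ H] [CompleteSpace H]
    (S : RealSpectralTriple 𝕜 A H)
    [AddCommGroup E] [Module 𝕜 E] [Module Aᵐᵒᵖ E] [IsScalarTower 𝕜 Aᵐᵒᵖ E]
    [Module.Finite Aᵐᵒᵖ E] [Module.Projective Aᵐᵒᵖ E]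
    (nabla : UnivConnection 𝕜 A E) :
    (∀ x : S.TwistDom E,
      BTensor.assoc (S.twistLeftRight nabla x) = S.twistRightLeft nabla (BTensor.assoc x)) ∧
    (∀ h : HermitianStructure S E, nabla.IsHermitian h →
      ∃ core : InnerProductSpace.Core ℂ (S.TwistSpace E),
        (∀ (v₁ w₁ v₂ w₂ : E) (ξ η : H),
          core.inner (S.elem v₁ ξ v₂) (S.elem w₁ η w₂) =
            ⟪ξ, S.π (h.form v₁ w₁) (S.J (S.π (star (h.form w₂ v₂)) (S.J.symm η)))⟫_ℂ) ∧
        letI : NormedAddCommGroup (S.TwistSpace E) := core.toNormedAddCommGroup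
        letI : InnerProductSpace ℂ (S.TwistSpace E) := InnerProductSpace.ofCore core.toCore
        ∃ _ : CompleteSpace (S.TwistSpace E),
        ∃ S' : RealSpectralTriple 𝕜 h.EndAlg (S.TwistSpace E),
          (∀ (T : h.EndAlg) (v₁ v₂ : E) (ξ : H),
            S'.π T (S.elem v₁ ξ v₂) = S.elem (h.toEnd T v₁) ξ v₂) ∧
          (∀ x y : S.TwistSpace E, (x, y) ∈ S'.D.graph ↔
            ∃ z : S.TwistDom E, S.twistIncl E z = x ∧ S.twistLeftRight nabla z = y) ∧
          (∀ (v₁ v₂ : E) (ξ : H), S'.J (S.elem v₁ ξ v₂) = S.elem v₂ (S.J ξ) v₁) ∧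
          S'.ε = S.ε ∧ S'.ε' = S.ε') := by
  refine ⟨S.assoc_twistLeftRight nabla, fun h hn => ?_⟩
  obtain ⟨n, e, f, hef⟩ := RealSpectralTriple.exists_frame h
  let core := RealSpectralTriple.twistCore h hef
  let : NormedAddCommGroup (S.TwistSpace E) := core.toNormedAddCommGroup
  let : InnerProductSpace ℂ (S.TwistSpace E) := InnerProductSpace.ofCore core.toCore
  have hΦ (x y : S.TwistSpace E) : ⟪LinearEquiv.refl ℂ (S.TwistSpace E) x,
      LinearEquiv.refl ℂ (S.TwistSpace E) y⟫_ℂ = RealSpectralTriple.twistPairing h x y := rfl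
  have hc := RealSpectralTriple.completeSpace_twist h (LinearEquiv.refl ℂ _) hΦ
  obtain ⟨S', hπ, hD, hJ, hε, hε'⟩ :=
    RealSpectralTriple.exists_twistTriple h (LinearEquiv.refl ℂ _) hΦ hn
  exact ⟨core, fun v₁ w₁ v₂ w₂ ξ η => RealSpectralTriple.twistPairing_elem h v₁ w₁ v₂ w₂ ξ η, hc, S',
    fun T v₁ v₂ ξ => hπ T (S.elem v₁ ξ v₂), hD, fun v₁ v₂ ξ => hJ (S.elem v₁ ξ v₂), hε, hε'⟩
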